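/- Let $d\ge 1$. Let $\Gamma$ be the set of locally finite subsets of $\mathbb R^d$, $\Gamma_0$ the set of finite subsets with the Borel $\sigma$-algebra of the disjoint union topology of the quotient spaces $\{(x_1,\dots,x_n)\in(\mathbb R^d)^n: x_i\ne x_j \text{ for } i\neq j\}/S_n$, $n\ge0$, and let $\Gamma^2$, $\Gamma_0^2$ be the sets of pairs $(\gamma^+,\gamma^-)$ of disjoint elements of $\Gamma$, $\Gamma_0$, respectively. Points $x$ are identified with $\{x\}$. For $z>0$ let $\lambda_z=\sum_{n\ge0}\frac{z^n}{n!}m^{(n)}$ be the Lebesgue–Poisson measure on $\Gamma_0$, where $m^{(n)}$ is the image of $dx_1\cdots dx_n$ under $(x_1,\dots,x_n)\mapsto\{x_1,\dots,x_n\}$; put $\lambda_z^2=\lambda_z\otimes\lambda_z$ on $\Gamma_0^2$ and $\lambda^2=\lambda_1^2$. For $C>0$ let $\mathcal L_C=L^1(\Gamma_0^2,\lambda_C^2)$, that is, $\|G\|_{\mathcal L_C}=\int_{\Gamma_0^2}|G(\eta^+,\eta^-)|\,C^{|\eta^+|+|\eta^-|}\,d\lambda^2$, and let $\mathcal K_C$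 be the space of $k:\Gamma_0^2\to\mathbb R$ with $C^{-|\eta^+|-|\eta^-|}k(\eta^+,\eta^-)\in L^\infty(\Gamma_0^2,\lambda^2)$. Let $B_{\rm bs}(\Gamma_0^2)$ be the set of bounded measurable $G:\Gamma_0^2\to\mathbb R$ for which there are $N^\pm\in\mathbb N_0$ and bounded Borel sets $\Lambda^\pm$ such that $G(\eta^+,\eta^-)=0$ unless $\eta^\pm\subset\Lambda^\pm$ and $|\eta^\pm|\le N^\pm$. Put $$(\mathcal KG)(\gamma^+,\gamma^-)=\sum_{\substack{\eta^+\subset\gamma^+,\ |\eta^+|<\infty\\ \eta^-\subset\gamma^-,\ |\eta^-|<\infty}}G(\eta^+,\eta^-),\qquad (\mathcal K^{-1}F)(\eta^+,\eta^-)=\sum_{\substack{\xi^+\subset\eta^+\\ \xi^-\subset\eta^-}}(-1)^{|\eta^+\setminus\xi^+|+|\eta^-\setminus\xi^-|}F(\xi^+,\xi^-),$$ where the first sum is used for $G\in B_{\rm bs}(\Gamma_0^2)$ and $(\gamma^+,\gamma^-)\in\Gamma^2$, or for arbitrary $G$ and finite $\gamma^\pm$. Let $a^\pm:\mathbb R^d\times\Gamma^2\to[0,\infty)$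 be such that their restrictions to $\mathbb R^d\times\Gamma_0^2$ are measurable and $a^\pm(\cdot,\eta^+,\eta^-)\in L^1_{\rm loc}(\mathbb R^d,dx)$ for all $(\eta^+,\eta^-)\in\Gamma_0^2$. Let \begin{align*}(L_0F)(\gamma^+,\gamma^-)=&\sum_{x\in\gamma^+}a^+(x,\gamma^+\setminus x,\gamma^-)\bigl(F(\gamma^+\setminus x,\gamma^-\cup x)-F(\gamma^+,\gamma^-)\bigr)\\&+\sum_{y\in\gamma^-}a^-(y,\gamma^+,\gamma^-\setminus y)\bigl(F(\gamma^+\cup y,\gamma^-\setminus y)-F(\gamma^+,\gamma^-)\bigr),\end{align*} let $\hat L_0G=\mathcal K^{-1}L_0\mathcal KG$ on $\Gamma_0^2$, and let $A^\pm(x,\xi^+,\xi^-,\eta^+,\eta^-)=\bigl(\mathcal K^{-1}a^\pm(x,\cdot\cup\xi^+,\cdot\cup\xi^-)\bigr)(\eta^+,\eta^-)$. For measurable $k$ write $\hat L_0^*k=h$ if, for all $G\in B_{\rm bs}(\Gamma_0^2)$, $(\hat L_0G)k$ and $Gh$ are $\lambda^2$-integrable and $\int(\hat L_0G)\,k\,d\lambda^2=\int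 G\,h\,d\lambda^2$. **(i)** If $G\in B_{\rm bs}(\Gamma_0^2)$, then for every $(\eta^+,\eta^-)\in\Gamma_0^2$ \begin{align*}(\hat L_0G)(\eta^+,\eta^-)=&\sum_{\substack{\xi^+\subset\eta^+\\ \xi^-\subset\eta^-}}\sum_{x\in\xi^+}\bigl(G(\xi^+\setminus x,\xi^-\cup x)-G(\xi^+,\xi^-)\bigr)A^+(x,\xi^+\setminus x,\xi^-,\eta^+\setminus\xi^+,\eta^-\setminus\xi^-)\\&+\sum_{\substack{\xi^+\subset\eta^+\\ \xi^-\subset\eta^-}}\sum_{y\in\xi^-}\bigl(G(\xi^+\cup y,\xi^-\setminus y)-G(\xi^+,\xi^-)\bigr)A^-(y,\xi^+,\xi^-\setminus y,\eta^+\setminus\xi^+,\eta^-\setminus\xi^-).\end{align*} **(ii)** Let $C>0$ and suppose, in addition, that $N_0:\Gamma_0^2\to\mathbb R$ is $\lambda^2$-integrable over $\{(\eta^+,\eta^-)\in\Gamma_0^2:|\eta^+|=n,\ |\eta^-|=m,\ \eta^\pm\subset\Lambda\}$ for all integers $n,m\ge1$ and all bounded Borel sets $\Lambda$, and that, for $\lambda^2$-a.a.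 $(\eta^+,\eta^-)\in\Gamma_0^2$, \begin{align*}&\sum_{x\in\eta^+}\Bigl(\|A^+(x,\eta^+\setminus x,\eta^-,\cdot,\cdot)\|_{\mathcal L_C}+\|A^-(x,\eta^+\setminus x,\eta^-,\cdot,\cdot)\|_{\mathcal L_C}\Bigr)\\&+\sum_{y\in\eta^-}\Bigl(\|A^+(y,\eta^+,\eta^-\setminus y,\cdot,\cdot)\|_{\mathcal L_C}+\|A^-(y,\eta^+,\eta^-\setminus y,\cdot,\cdot)\|_{\mathcal L_C}\Bigr)\le N_0(\eta^+,\eta^-)<\infty.\end{align*} Then, for each $G\in\mathcal L_C$ with $N_0G\in\mathcal L_C$, we have $\hat L_0G\in\mathcal L_C$; here $\hat L_0G$ is again given by the expression in (i), and changing $G$ on a $\lambda^2$-null set changes $\hat L_0G$ only on a $\lambda^2$-null set. **(iii)** If, moreover, there are $A>0$, $M\in\mathbb N_0$, $\nu\ge1$ with $N_0(\eta^+,\eta^-)\le A(1+|\eta^+|+|\eta^-|)^M\nu^{|\eta^+|+|\eta^-|}$ on $\Gamma_0^2$, then for every $\alpha\in(0,\frac1\nu)$ and every $k\in\mathcal K_{\alpha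 C}$ the function $\hat L_0^*k$ exists, is unique up to $\lambda^2$-null sets, belongs to $\mathcal K_C$, and \begin{align*}(\hat L_0^*k)(\eta^+,\eta^-)=&\sum_{y\in\eta^-}\int_{\Gamma_0^2}d\lambda^2(\xi^+,\xi^-)\,k\bigl(\xi^+\cup\eta^+\cup y,\ \xi^-\cup(\eta^-\setminus y)\bigr)A^+(y,\eta^+,\eta^-\setminus y,\xi^+,\xi^-)\\&-\sum_{x\in\eta^+}\int_{\Gamma_0^2}d\lambda^2(\xi^+,\xi^-)\,k(\xi^+\cup\eta^+,\xi^-\cup\eta^-)A^+(x,\eta^+\setminus x,\eta^-,\xi^+,\xi^-)\\&+\sum_{x\in\eta^+}\int_{\Gamma_0^2}d\lambda^2(\xi^+,\xi^-)\,k\bigl(\xi^+\cup(\eta^+\setminus x),\ \xi^-\cup\eta^-\cup x\bigr)A^-(x,\eta^+\setminus x,\eta^-,\xi^+,\xi^-)\\&-\sum_{y\in\eta^-}\int_{\Gamma_0^2}d\lambda^2(\xi^+,\xi^-)\,k(\xi^+\cup\eta^+,\xi^-\cup\eta^-)A^-(y,\eta^+,\eta^-\setminus y,\xi^+,\xi^-)\end{align*}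 for $\lambda^2$-a.a. $(\eta^+,\eta^-)\in\Gamma_0^2$, all integrals being absolutely convergent for $\lambda^2$-a.a. $(\eta^+,\eta^-)$. -/

import Mathlib

open MeasureTheory Set Filter
open scoped ENNReal

noncomputable section

namespace Flip

/-- The underlying space `ℝ^d`. -/
abbrev E (d : ℕ) : Type := EuclideanSpace ℝ (Fin d)

/-! ### Infinite configurations -/

/-- The configuration space `Γ`: locally finite subsets of `ℝ^d`. -/
abbrev Conf (d : ℕ) : Type :=
  {γ : Set (E d) // ∀ Λ : Set (E d), IsCompact Λ → (γ ∩ Λ).Finite}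

/-- The two-component configuration space `Γ²`: disjoint pairs of configurations. -/
abbrev Conf2 (d : ℕ) : Type :=
  {γ : Conf d × Conf d // Disjoint γ.1.1 γ.2.1}

namespace Conf

/-- `γ \ x`. -/
def erase {d : ℕ} (γ : Conf d) (x : E d) : Conf d :=
  ⟨γ.1 \ {x}, fun Λ hΛ => (γ.2 Λ hΛ).subset (by intro z hz; exact ⟨hz.1.1, hz.2⟩)⟩

/-- `γ ∪ x`. -/
def insert {d : ℕ} (γ : Conf d) (x : E d) : Conf d :=
  ⟨γ.1 ∪ {x}, fun Λ hΛ => ((γ.2 Λ hΛ).union (finite_singleton x)).subset (by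
    rintro z ⟨hz | hz, hz'⟩
    · exact Or.inl ⟨hz, hz'⟩
    · exact Or.inr hz)⟩

end Conf

namespace Conf2

/-- `γ⁺`, as a set. -/
def plus {d : ℕ} (γ : Conf2 d) : Set (E d) := γ.1.1.1

/-- `γ⁻`, as a set. -/
def minus {d : ℕ} (γ : Conf2 d) : Set (E d) := γ.1.2.1

/-- `(γ⁺ \ x, γ⁻)`. -/
def erasePlus {d : ℕ} (γ : Conf2 d) (x : E d) : Conf2 d :=
  ⟨(γ.1.1.erase x, γ.1.2), γ.2.mono_left sdiff_subset⟩

/-- `(γ⁺, γ⁻ \ y)`. -/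
def eraseMinus {d : ℕ} (γ : Conf2 d) (y : E d) : Conf2 d :=
  ⟨(γ.1.1, γ.1.2.erase y), γ.2.mono_right sdiff_subset⟩

/-- `(γ⁺ \ x, γ⁻ ∪ x)`. -/
def flipToMinus {d : ℕ} (γ : Conf2 d) (x : E d) : Conf2 d :=
  ⟨(γ.1.1.erase x, γ.1.2.insert x),
    disjoint_union_right.2 ⟨γ.2.mono_left sdiff_subset, disjoint_sdiff_left⟩⟩

/-- `(γ⁺ ∪ y, γ⁻ \ y)`. -/
def flipToPlus {d : ℕ} (γ : Conf2 d) (y : E d) : Conf2 d :=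
  ⟨(γ.1.1.insert y, γ.1.2.erase y),
    disjoint_union_left.2 ⟨γ.2.mono_right sdiff_subset, disjoint_sdiff_right⟩⟩

end Conf2

/-! ### Finite configurations -/

/-- The space `Γ₀` of finite configurations: finite subsets of `ℝ^d`.  (A structure, because
Mathlib equips `Finset` with a σ-algebra other than the Borel σ-algebra of `Γ₀`.) -/
structure FinConf (d : ℕ) : Type where
  /-- The set of points of the configuration. -/
  pts : Finset (E d)

/-- The map `(x₁, …, xₙ) ↦ {x₁, …, xₙ}` on `n`-tuples of pairwise distinct points. -/
def toFinConf (d n : ℕ) (x : {x : Fin n → E d // Function.Injective x}) : FinConf d :=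
  ⟨Finset.univ.map ⟨x.1, x.2⟩⟩

/-- The topology of `Γ₀`: the disjoint union over `n` of the quotient topologies on
`Γ^(n)`, the quotient of the `n`-tuples of distinct points by permutations.  A set is open
iff all its preimages under the maps `toFinConf d n` are open. -/
instance finConfTopology (d : ℕ) : TopologicalSpace (FinConf d) :=
  ⨆ n : ℕ, TopologicalSpace.coinduced (toFinConf d n) inferInstance

/-- The Borel σ-algebra of `Γ₀`. -/
instance finConfMeasurableSpace (d : ℕ) : MeasurableSpace (FinConf d) :=
  borel (FinConf d)

/-- The space `Γ₀²` of pairs of disjoint finite configurations, with the σ-algebra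
(and the topology) induced from the product `Γ₀ × Γ₀`. -/
abbrev FinConf2 (d : ℕ) : Type :=
  {η : FinConf d × FinConf d // Disjoint η.1.pts η.2.pts}

namespace FinConf2

/-- `η⁺`. -/
def plus {d : ℕ} (η : FinConf2 d) : Finset (E d) := η.1.1.pts

/-- `η⁻`. -/
def minus {d : ℕ} (η : FinConf2 d) : Finset (E d) := η.1.2.pts

/-- `|η⁺| + |η⁻|`. -/
def size {d : ℕ} (η : FinConf2 d) : ℕ := η.plus.card + η.minus.card

/-- The inclusion `Γ₀² ⊆ Γ²`. -/
def toConf2 {d : ℕ} (η : FinConf2 d) : Conf2 d :=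
  ⟨(⟨(η.plus : Set (E d)), fun _ _ => η.plus.finite_toSet.inter_of_left _⟩,
    ⟨(η.minus : Set (E d)), fun _ _ => η.minus.finite_toSet.inter_of_left _⟩),
    Finset.disjoint_coe.2 η.2⟩

/-- `(η⁺ \ x, η⁻)`. -/
def erasePlus {d : ℕ} (η : FinConf2 d) (x : E d) : FinConf2 d :=
  ⟨(⟨η.plus \ {x}⟩, ⟨η.minus⟩), η.2.mono_left Finset.sdiff_subset⟩

/-- `(η⁺, η⁻ \ y)`. -/
def eraseMinus {d : ℕ} (η : FinConf2 d) (y : E d) : FinConf2 d :=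
  ⟨(⟨η.plus⟩, ⟨η.minus \ {y}⟩), η.2.mono_right Finset.sdiff_subset⟩

/-- `(η⁺ \ x, η⁻ ∪ x)`. -/
def flipToMinus {d : ℕ} (η : FinConf2 d) (x : E d) : FinConf2 d :=
  ⟨(⟨η.plus \ {x}⟩, ⟨η.minus ∪ {x}⟩), Finset.disjoint_union_right.2
    ⟨η.2.mono_left Finset.sdiff_subset, Finset.sdiff_disjoint⟩⟩

/-- `(η⁺ ∪ y, η⁻ \ y)`. -/
def flipToPlus {d : ℕ} (η : FinConf2 d) (y : E d) : FinConf2 d :=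
  ⟨(⟨η.plus ∪ {y}⟩, ⟨η.minus \ {y}⟩), Finset.disjoint_union_left.2
    ⟨η.2.mono_right Finset.sdiff_subset, Finset.disjoint_sdiff⟩⟩

/-- `(η⁺ \ ξ⁺, η⁻ \ ξ⁻)`. -/
def diff {d : ℕ} (η ξ : FinConf2 d) : FinConf2 d :=
  ⟨(⟨η.plus \ ξ.plus⟩, ⟨η.minus \ ξ.minus⟩),
    (η.2.mono_left Finset.sdiff_subset).mono_right Finset.sdiff_subset⟩

/-- `(η⁺ ∪ ξ⁺, η⁻ ∪ ξ⁻)`.  If this pair is not disjoint, it is not a point of `Γ₀²`, and the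
value `(∅, ∅)` is a dummy; for fixed `ξ` this happens only for a null set of `η`. -/
def union {d : ℕ} (η ξ : FinConf2 d) : FinConf2 d :=
  if h : Disjoint (η.plus ∪ ξ.plus) (η.minus ∪ ξ.minus) then
    ⟨(⟨η.plus ∪ ξ.plus⟩, ⟨η.minus ∪ ξ.minus⟩), h⟩
  else ⟨(⟨∅⟩, ⟨∅⟩), Finset.disjoint_empty_left _⟩

/-- The finite set of all `ξ ∈ Γ₀²` with `ξ⁺ ⊆ η⁺` and `ξ⁻ ⊆ η⁻`. -/
def subs {d : ℕ} (η : FinConf2 d) : Finset (FinConf2 d) :=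
  ((η.plus.powerset ×ˢ η.minus.powerset).subtype (fun p => Disjoint p.1 p.2)).map
    ⟨fun p => ⟨(⟨p.1.1⟩, ⟨p.1.2⟩), p.2⟩, by
      rintro ⟨⟨a, b⟩, h⟩ ⟨⟨a', b'⟩, h'⟩ hab
      simpa using hab⟩

end FinConf2

/-- `Γ_Λ^(n,m)`: the `η ∈ Γ₀²` with `|η⁺| = n`, `|η⁻| = m` and `η⁺, η⁻ ⊆ Λ`. -/
def localSector (d : ℕ) (Λ : Set (E d)) (n m : ℕ) : Set (FinConf2 d) :=
  {η | η.plus.card = n ∧ η.minus.card = m ∧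
    (η.plus : Set (E d)) ⊆ Λ ∧ (η.minus : Set (E d)) ⊆ Λ}

/-! ### Lebesgue–Poisson measures and function spaces -/

/-- The image `m^(n)` of `dx₁ ⋯ dxₙ` (on tuples of distinct points) under
`(x₁, …, xₙ) ↦ {x₁, …, xₙ}`. -/
def sectorMeasure (d n : ℕ) : Measure (FinConf d) :=
  ((volume : Measure (Fin n → E d)).comap Subtype.val).map (toFinConf d n)

/-- The Lebesgue–Poisson measure `λ_z = ∑ₙ zⁿ / n! m^(n)` on `Γ₀`. -/
def lebesguePoisson (d : ℕ) (z : ℝ) : Measure (FinConf d) :=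
  Measure.sum fun n : ℕ => ENNReal.ofReal (z ^ n / (n.factorial : ℝ)) • sectorMeasure d n

/-- The measure `λ_z² = λ_z ⊗ λ_z` on `Γ₀²`. -/
def lebesguePoisson2 (d : ℕ) (z : ℝ) : Measure (FinConf2 d) :=
  ((lebesguePoisson d z).prod (lebesguePoisson d z)).comap Subtype.val

/-- The measure `λ² = λ_1²` on `Γ₀²`. -/
def lam2 (d : ℕ) : Measure (FinConf2 d) := lebesguePoisson2 d 1

/-- `B_bs(Γ₀²)`: bounded measurable functions with bounded support. -/
def IsBbs {d : ℕ} (G : FinConf2 d → ℝ) : Prop :=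
  Measurable G ∧ (∃ c : ℝ, ∀ η, |G η| ≤ c) ∧
    ∃ (Np Nm : ℕ) (Λp Λm : Set (E d)),
      Bornology.IsBounded Λp ∧ MeasurableSet Λp ∧ Bornology.IsBounded Λm ∧ MeasurableSet Λm ∧
      ∀ η : FinConf2 d, G η ≠ 0 →
        η.plus.card ≤ Np ∧ (η.plus : Set (E d)) ⊆ Λp ∧
        η.minus.card ≤ Nm ∧ (η.minus : Set (E d)) ⊆ Λm

/-- `G ∈ 𝓛_C = L¹(Γ₀², λ_C²)`. -/
def MemL {d : ℕ} (C : ℝ) (G : FinConf2 d → ℝ) : Prop :=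
  Integrable G (lebesguePoisson2 d C)

/-- The norm of `𝓛_C`, with value `∞` for functions of infinite norm. -/
def normL {d : ℕ} (C : ℝ) (G : FinConf2 d → ℝ) : ℝ≥0∞ :=
  ∫⁻ η, ‖G η‖ₑ ∂(lebesguePoisson2 d C)

/-- `k ∈ 𝓚_C`: the function `k(η⁺, η⁻) C^(-|η⁺|-|η⁻|)` is in `L^∞(Γ₀², λ²)`. -/
def MemK {d : ℕ} (C : ℝ) (k : FinConf2 d → ℝ) : Prop :=
  MemLp (fun η => k η * (C ^ η.size)⁻¹) ∞ (lam2 d)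

/-! ### The `K`-transform and the flip generator -/

/-- The `K`-transform
`(KG)(γ⁺, γ⁻) = ∑ G(η⁺, η⁻)` over all finite `η⁺ ⊆ γ⁺`, `η⁻ ⊆ γ⁻`. -/
def KTransform {d : ℕ} (G : FinConf2 d → ℝ) (γ : Conf2 d) : ℝ :=
  ∑ᶠ (η : FinConf2 d) (_ : (η.plus : Set (E d)) ⊆ γ.plus ∧ (η.minus : Set (E d)) ⊆ γ.minus),
    G η

/-- `(K⁻¹F)(η) = ∑_{ξ ⊆ η} (-1)^(|η⁺ \ ξ⁺| + |η⁻ \ ξ⁻|) F(ξ)` for functions `F` on `Γ₀²`. -/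
def KInv {d : ℕ} (F : FinConf2 d → ℝ) (η : FinConf2 d) : ℝ :=
  ∑ ξ ∈ η.subs, (-1 : ℝ) ^ (η.diff ξ).size * F ξ

/-- The flip generator `L₀` with rates `aP = a⁺`, `aM = a⁻`, on functions on `Γ²`. -/
def L0 {d : ℕ} (aP aM : E d → Conf2 d → ℝ) (F : Conf2 d → ℝ) (γ : Conf2 d) : ℝ :=
  (∑ᶠ (x : E d) (_ : x ∈ γ.plus), aP x (γ.erasePlus x) * (F (γ.flipToMinus x) - F γ)) +
  ∑ᶠ (y : E d) (_ : y ∈ γ.minus), aM y (γ.eraseMinus y) * (F (γ.flipToPlus y) - F γ)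

/-- `L̂₀ = K⁻¹ L₀ K`, where `K⁻¹` is applied to the restriction of `L₀ K G` to `Γ₀²`. -/
def hatL0 {d : ℕ} (aP aM : E d → Conf2 d → ℝ) (G : FinConf2 d → ℝ) : FinConf2 d → ℝ :=
  KInv fun η => L0 aP aM (KTransform G) η.toConf2

/-- The standing assumptions on a rate `a`: it is nonnegative, measurable on `ℝ^d × Γ₀²`, and
`a(·, η⁺, η⁻)` is locally integrable for each `(η⁺, η⁻) ∈ Γ₀²`. -/
structure IsRate {d : ℕ} (a : E d → Conf2 d → ℝ) : Prop where
  nonneg : ∀ x γ, 0 ≤ a x γ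
  measurable : Measurable fun p : E d × FinConf2 d => a p.1 p.2.toConf2
  locallyIntegrable : ∀ η : FinConf2 d, LocallyIntegrable (fun x => a x η.toConf2) volume

/-- The transformed rate
`A(x, ξ⁺, ξ⁻, η⁺, η⁻) = (K⁻¹ a(x, · ∪ ξ⁺, · ∪ ξ⁻))(η⁺, η⁻)`. -/
def transformedRate {d : ℕ} (a : E d → Conf2 d → ℝ) (x : E d) (ξ η : FinConf2 d) : ℝ :=
  KInv (fun ζ => a x (ζ.union ξ).toConf2) η

/-- The explicit expression for `L̂₀ G`. -/
def hatL0Formula {d : ℕ} (aP aM : E d → Conf2 d → ℝ) (G : FinConf2 d → ℝ)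
    (η : FinConf2 d) : ℝ :=
  (∑ ξ ∈ η.subs, ∑ x ∈ ξ.plus,
    (G (ξ.flipToMinus x) - G ξ) * transformedRate aP x (ξ.erasePlus x) (η.diff ξ)) +
  ∑ ξ ∈ η.subs, ∑ y ∈ ξ.minus,
    (G (ξ.flipToPlus y) - G ξ) * transformedRate aM y (ξ.eraseMinus y) (η.diff ξ)

/-- `N₀` is integrable with respect to `λ²` over `Γ_Λ^(n,m)`, for all positive integers `n, m`
and all bounded Borel sets `Λ`. -/
def IsLocallyIntegrableBound {d : ℕ} (N₀ : FinConf2 d → ℝ) : Prop :=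
  ∀ n m : ℕ, 1 ≤ n → 1 ≤ m → ∀ Λ : Set (E d), Bornology.IsBounded Λ → MeasurableSet Λ →
    IntegrableOn N₀ (localSector d Λ n m) (lam2 d)

/-- The bound `N₀` on the `𝓛_C`-norms of the transformed rates. -/
def RateBound {d : ℕ} (aP aM : E d → Conf2 d → ℝ) (C : ℝ) (N₀ : FinConf2 d → ℝ) : Prop :=
  ∀ᵐ η ∂(lam2 d),
    (∑ x ∈ η.plus, (normL C (transformedRate aP x (η.erasePlus x)) +
        normL C (transformedRate aM x (η.erasePlus x)))) +
      (∑ y ∈ η.minus, (normL C (transformedRate aP y (η.eraseMinus y)) +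
        normL C (transformedRate aM y (η.eraseMinus y))))
    ≤ ENNReal.ofReal (N₀ η)

/-! ### The dual operator -/

/-- `h = L̂₀* k`: the function `h` satisfies `∫ (L̂₀ G) k dλ² = ∫ G h dλ²` for all
`G ∈ B_bs(Γ₀²)`, both integrals being absolutely convergent. -/
def IsHatL0Dual {d : ℕ} (aP aM : E d → Conf2 d → ℝ) (k h : FinConf2 d → ℝ) : Prop :=
  ∀ G : FinConf2 d → ℝ, IsBbs G →
    Integrable (fun η => hatL0 aP aM G η * k η) (lam2 d) ∧
    Integrable (fun η => G η * h η) (lam2 d) ∧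
    ∫ η, hatL0 aP aM G η * k η ∂(lam2 d) = ∫ η, G η * h η ∂(lam2 d)

/-- The explicit expression for `L̂₀* k`. -/
def hatL0DualFormula {d : ℕ} (aP aM : E d → Conf2 d → ℝ) (k : FinConf2 d → ℝ)
    (η : FinConf2 d) : ℝ :=
  (∑ y ∈ η.minus, ∫ ξ, k (ξ.union (η.flipToPlus y)) *
      transformedRate aP y (η.eraseMinus y) ξ ∂(lam2 d)) -
  (∑ x ∈ η.plus, ∫ ξ, k (ξ.union η) *
      transformedRate aP x (η.erasePlus x) ξ ∂(lam2 d)) +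
  (∑ x ∈ η.plus, ∫ ξ, k (ξ.union (η.flipToMinus x)) *
      transformedRate aM x (η.erasePlus x) ξ ∂(lam2 d)) -
  ∑ y ∈ η.minus, ∫ ξ, k (ξ.union η) *
      transformedRate aM y (η.eraseMinus y) ξ ∂(lam2 d)

/-- All integrals in the explicit expression for `(L̂₀* k)(η)` converge absolutely. -/
def HatL0DualConverges {d : ℕ} (aP aM : E d → Conf2 d → ℝ) (k : FinConf2 d → ℝ)
    (η : FinConf2 d) : Prop :=
  (∀ y ∈ η.minus,
    Integrable (fun ξ => k (ξ.union (η.flipToPlus y)) *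
      transformedRate aP y (η.eraseMinus y) ξ) (lam2 d) ∧
    Integrable (fun ξ => k (ξ.union η) *
      transformedRate aM y (η.eraseMinus y) ξ) (lam2 d)) ∧
  (∀ x ∈ η.plus,
    Integrable (fun ξ => k (ξ.union η) *
      transformedRate aP x (η.erasePlus x) ξ) (lam2 d) ∧
    Integrable (fun ξ => k (ξ.union (η.flipToMinus x)) *
      transformedRate aM x (η.erasePlus x) ξ) (lam2 d))

end Flip

end

noncomputable section

namespace Flip

variable {d : ℕ}

/-! ### Sums over finite configurations -/

namespace FinConf2

/-! The formula for `hatL0` is finite combinatorics. On a finite configuration the K-transform sums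
`G` over all sub-configurations, and `KInv` is Möbius inversion of this sum. It is therefore enough
that both sides have the same sum over sub-configurations (`KInv_sum_subs`). Two facts give this.
Flipping `x` changes `KG` by the sum of the differences of `G` over those sub-configurations that
contain `x` (`sum_subs_flipToMinus_sub`). The rate itself is recovered by summing its transform
(`sum_subs_KInv`).

The analytic statements rest on two changes of variables for `lam2`. The first is the Minlos lemma
(`isIntensity_subs`): splitting `η` in all ways into `ξ` and `η \ ξ` turns `λ²` into `λ² ⊗ λ²`. The
second is the flip symmetry (`isIntensity_flipToMinus`, `isIntensity_minus`): the pairs formed by a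
plus point and the configuration with that point flipped have the same intensity as the pairs formed
by a minus point and the configuration itself. Both yield equalities of `lintegral`s, and they also
show that null sets stay null under flips, splittings and unions.

With absolute values inside, these formulas bound the norm of `hatL0 G` by the integral of `|G|`
times the sum of the norms of the transformed rates: the unflipped terms give the sum over plus
points, the flipped ones the sum over minus points. The total is at most `N₀ |G|`. Without absolute
values, and with a factor `k` that depends only on the union of the two pieces, the same computation
produces the dual formula (`integral_flipPart_mul`).

If `|k| ≤ b (αC)^n` on configurations of size `n`, then the dual function is at most `b (αC)^n N₀`,
and the growth `(1 + n)^M ν^n` of `N₀` is absorbed because `αν < 1`. Uniqueness follows by testing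
with indicators of bounded sets. The rate `a⁻` is reduced to the case of `a⁺` by exchanging the two
components.

Measurability is the remaining difficulty, since the σ-algebra comes from a quotient topology. It is
identified with the one generated by the events of hitting an open set
(`finConfMeasurableSpace_eq`), and the points of a configuration are then enumerated measurably. -/

@[ext]
lemma ext {η ξ : FinConf2 d} (hp : η.plus = ξ.plus) (hm : η.minus = ξ.minus) : η = ξ := by
  obtain ⟨⟨⟨a⟩, ⟨b⟩⟩, h⟩ := η
  obtain ⟨⟨⟨a'⟩, ⟨b'⟩⟩, h'⟩ := ξ
  simp only [plus, minus] at hp hm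
  subst hp hm
  rfl

lemma disjoint (η : FinConf2 d) : Disjoint η.plus η.minus := η.2

lemma notMem_minus {η : FinConf2 d} {x : E d} (hx : x ∈ η.plus) : x ∉ η.minus :=
  Finset.disjoint_left.1 η.disjoint hx

lemma notMem_plus {η : FinConf2 d} {x : E d} (hx : x ∈ η.minus) : x ∉ η.plus :=
  Finset.disjoint_right.1 η.disjoint hx

/-- The pair `(p, q)` of finite configurations, with the dummy value `(∅, ∅)` if `p` and `q`
are not disjoint. -/
def ofPair (p q : FinConf d) : FinConf2 d :=
  if h : Disjoint p.pts q.pts then ⟨(p, q), h⟩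
  else ⟨(⟨∅⟩, ⟨∅⟩), Finset.disjoint_empty_left _⟩

lemma ofPair_of_disjoint {p q : FinConf d} (h : Disjoint p.pts q.pts) :
    ofPair p q = ⟨(p, q), h⟩ := dif_pos h

@[simp]
lemma ofPair_fst_snd (η : FinConf2 d) : ofPair η.1.1 η.1.2 = η := ofPair_of_disjoint η.2

@[simp]
lemma ofPair_plus_minus (η : FinConf2 d) : ofPair ⟨η.plus⟩ ⟨η.minus⟩ = η := ofPair_of_disjoint η.2

@[simp] lemma plus_erasePlus (η : FinConf2 d) (x : E d) :
    (η.erasePlus x).plus = η.plus \ {x} := rfl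
@[simp] lemma minus_erasePlus (η : FinConf2 d) (x : E d) : (η.erasePlus x).minus = η.minus := rfl
@[simp] lemma plus_eraseMinus (η : FinConf2 d) (x : E d) : (η.eraseMinus x).plus = η.plus := rfl
@[simp] lemma minus_eraseMinus (η : FinConf2 d) (x : E d) :
    (η.eraseMinus x).minus = η.minus \ {x} := rfl
@[simp] lemma plus_flipToMinus (η : FinConf2 d) (x : E d) :
    (η.flipToMinus x).plus = η.plus \ {x} := rfl
@[simp] lemma minus_flipToMinus (η : FinConf2 d) (x : E d) :
    (η.flipToMinus x).minus = η.minus ∪ {x} := rfl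
@[simp] lemma plus_flipToPlus (η : FinConf2 d) (x : E d) :
    (η.flipToPlus x).plus = η.plus ∪ {x} := rfl
@[simp] lemma minus_flipToPlus (η : FinConf2 d) (x : E d) :
    (η.flipToPlus x).minus = η.minus \ {x} := rfl
@[simp] lemma plus_diff (η ξ : FinConf2 d) : (η.diff ξ).plus = η.plus \ ξ.plus := rfl
@[simp] lemma minus_diff (η ξ : FinConf2 d) : (η.diff ξ).minus = η.minus \ ξ.minus := rfl

lemma plus_union {η ξ : FinConf2 d} (h : Disjoint (η.plus ∪ ξ.plus) (η.minus ∪ ξ.minus)) :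
    (η.union ξ).plus = η.plus ∪ ξ.plus := by
  rw [union, dif_pos h]; rfl

lemma minus_union {η ξ : FinConf2 d} (h : Disjoint (η.plus ∪ ξ.plus) (η.minus ∪ ξ.minus)) :
    (η.union ξ).minus = η.minus ∪ ξ.minus := by
  rw [union, dif_pos h]; rfl

lemma mem_subs {η ξ : FinConf2 d} :
    ξ ∈ η.subs ↔ ξ.plus ⊆ η.plus ∧ ξ.minus ⊆ η.minus := by
  simp only [subs, Finset.mem_map, Finset.mem_subtype, Finset.mem_product, Finset.mem_powerset]
  constructor
  · rintro ⟨⟨⟨a, b⟩, h⟩, hab, rfl⟩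
    exact hab
  · intro h
    exact ⟨⟨(ξ.plus, ξ.minus), ξ.2⟩, h, rfl⟩

lemma sum_subs {M : Type*} [AddCommMonoid M] (η : FinConf2 d) (f : FinConf2 d → M) :
    ∑ ξ ∈ η.subs, f ξ =
      ∑ a ∈ η.plus.powerset, ∑ b ∈ η.minus.powerset, f (ofPair ⟨a⟩ ⟨b⟩) := by
  rw [← Finset.sum_product']
  refine Finset.sum_bij' (fun ξ _ => (ξ.plus, ξ.minus)) (fun p _ => ofPair ⟨p.1⟩ ⟨p.2⟩)
    ?_ ?_ ?_ ?_ ?_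
  · intro ξ hξ
    simpa [mem_subs] using hξ
  · rintro ⟨a, b⟩ h
    simp only [Finset.mem_product, Finset.mem_powerset] at h
    rw [mem_subs, ofPair_of_disjoint ((η.disjoint.mono_left h.1).mono_right h.2)]
    exact h
  · intro ξ _
    simp
  · rintro ⟨a, b⟩ h
    simp only [Finset.mem_product, Finset.mem_powerset] at h
    simp only
    rw [ofPair_of_disjoint ((η.disjoint.mono_left h.1).mono_right h.2)]
    rfl
  · intro ξ _
    simp

lemma self_mem_subs (η : FinConf2 d) : η ∈ η.subs := mem_subs.2 ⟨subset_rfl, subset_rfl⟩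

lemma diff_mem_subs (η ξ : FinConf2 d) : η.diff ξ ∈ η.subs :=
  mem_subs.2 ⟨Finset.sdiff_subset, Finset.sdiff_subset⟩

lemma disjoint_union_of_mem_subs {η ξ ζ : FinConf2 d} (hξ : ξ ∈ η.subs) (hζ : ζ ∈ η.subs) :
    Disjoint (ξ.plus ∪ ζ.plus) (ξ.minus ∪ ζ.minus) := by
  rw [mem_subs] at hξ hζ
  exact (η.disjoint.mono_left (Finset.union_subset hξ.1 hζ.1)).mono_right
    (Finset.union_subset hξ.2 hζ.2)

lemma subs_trans {η ξ ζ : FinConf2 d} (h : ζ ∈ ξ.subs) (h' : ξ ∈ η.subs) : ζ ∈ η.subs := by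
  rw [mem_subs] at *
  exact ⟨h.1.trans h'.1, h.2.trans h'.2⟩

lemma union_mem_subs {η ξ ζ : FinConf2 d} (hξ : ξ ∈ η.subs) (hζ : ζ ∈ η.subs) :
    ξ.union ζ ∈ η.subs := by
  have h := disjoint_union_of_mem_subs hξ hζ
  rw [mem_subs] at *
  rw [plus_union h, minus_union h]
  exact ⟨Finset.union_subset hξ.1 hζ.1, Finset.union_subset hξ.2 hζ.2⟩

lemma diff_union_cancel {η ξ : FinConf2 d} (hξ : ξ ∈ η.subs) : (η.diff ξ).union ξ = η := by
  have h := disjoint_union_of_mem_subs (diff_mem_subs η ξ) hξ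
  rw [mem_subs] at hξ
  apply FinConf2.ext
  · rw [plus_union h]; exact Finset.sdiff_union_of_subset hξ.1
  · rw [minus_union h]; exact Finset.sdiff_union_of_subset hξ.2

lemma union_diff_cancel {η ξ ρ : FinConf2 d} (hξ : ξ ∈ η.subs) (hρ : ρ ∈ (η.diff ξ).subs) :
    (ρ.union ξ).diff ξ = ρ := by
  have h := disjoint_union_of_mem_subs (subs_trans hρ (diff_mem_subs η ξ)) hξ
  rw [mem_subs] at hρ
  apply FinConf2.ext
  · rw [plus_diff, plus_union h]
    exact Finset.union_sdiff_cancel_right (Finset.sdiff_disjoint.mono_left hρ.1)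
  · rw [minus_diff, minus_union h]
    exact Finset.union_sdiff_cancel_right (Finset.sdiff_disjoint.mono_left hρ.2)

/-- Summation over the configurations between `ξ` and `η`. -/
lemma sum_filter_subs {M : Type*} [AddCommMonoid M] {η ξ : FinConf2 d} (hξ : ξ ∈ η.subs)
    (f : FinConf2 d → M) :
    ∑ ζ ∈ η.subs with ξ.plus ⊆ ζ.plus ∧ ξ.minus ⊆ ζ.minus, f ζ =
      ∑ ρ ∈ (η.diff ξ).subs, f (ρ.union ξ) := by
  refine Finset.sum_bij' (fun ζ _ => ζ.diff ξ) (fun ρ _ => ρ.union ξ) ?_ ?_ ?_ ?_ ?_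
  · intro ζ hζ
    rw [Finset.mem_filter, mem_subs] at hζ
    exact mem_subs.2 ⟨Finset.sdiff_subset_sdiff hζ.1.1 subset_rfl,
      Finset.sdiff_subset_sdiff hζ.1.2 subset_rfl⟩
  · intro ρ hρ
    have hρ' := subs_trans hρ (diff_mem_subs η ξ)
    have h := disjoint_union_of_mem_subs hρ' hξ
    rw [Finset.mem_filter]
    refine ⟨union_mem_subs hρ' hξ, ?_⟩
    rw [plus_union h, minus_union h]
    exact ⟨Finset.subset_union_right, Finset.subset_union_right⟩
  · intro ζ hζ
    rw [Finset.mem_filter] at hζ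
    exact diff_union_cancel (mem_subs.2 hζ.2)
  · intro ρ hρ
    exact union_diff_cancel hξ hρ
  · intro ζ hζ
    rw [Finset.mem_filter] at hζ
    rw [diff_union_cancel (mem_subs.2 hζ.2)]

/-- A chain `ξ ⊆ ζ ⊆ η` is encoded by `ξ` and the difference `ρ = ζ \ ξ`, a sub-configuration of `η
\ ξ`. This is the discrete counterpart of the Minlos lemma. -/
lemma sum_subs_subs {M : Type*} [AddCommMonoid M] (η : FinConf2 d)
    (f : FinConf2 d → FinConf2 d → M) :
    ∑ ζ ∈ η.subs, ∑ ξ ∈ ζ.subs, f ξ ζ =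
      ∑ ξ ∈ η.subs, ∑ ρ ∈ (η.diff ξ).subs, f ξ (ρ.union ξ) := by
  rw [Finset.sum_comm' (s' := fun ξ => {ζ ∈ η.subs | ξ.plus ⊆ ζ.plus ∧ ξ.minus ⊆ ζ.minus})
    (t' := η.subs)]
  · exact Finset.sum_congr rfl fun ξ hξ => sum_filter_subs hξ _
  · intro ζ ξ
    rw [Finset.mem_filter, ← mem_subs]
    exact ⟨fun h => ⟨h, subs_trans h.2 h.1⟩, fun h => h.1⟩

/-- The sum factors over the two components, and each factor is the alternating sum `(1 - 1)^n`. -/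
lemma sum_neg_one_pow_size (η : FinConf2 d) :
    ∑ ξ ∈ η.subs, (-1 : ℝ) ^ ξ.size = if η.size = 0 then 1 else 0 := by
  have key : ∀ s : Finset (E d), ∑ a ∈ s.powerset, (-1 : ℝ) ^ a.card =
      if s = ∅ then 1 else 0 := fun s => by
    exact_mod_cast congrArg (Int.cast (R := ℝ)) (Finset.sum_powerset_neg_one_pow_card (x := s))
  have : ∑ ξ ∈ η.subs, (-1 : ℝ) ^ ξ.size =
      (∑ a ∈ η.plus.powerset, (-1 : ℝ) ^ a.card) * ∑ b ∈ η.minus.powerset, (-1 : ℝ) ^ b.card := by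
    rw [sum_subs, Finset.sum_mul_sum]
    refine Finset.sum_congr rfl fun a ha => Finset.sum_congr rfl fun b hb => ?_
    rw [Finset.mem_powerset] at ha hb
    rw [ofPair_of_disjoint ((η.disjoint.mono_left ha).mono_right hb), ← pow_add]
    rfl
  rw [this, key, key, size]
  simp only [Nat.add_eq_zero_iff, Finset.card_eq_zero]
  split_ifs <;> simp_all

lemma size_diff {η ξ : FinConf2 d} (h : ξ ∈ η.subs) : (η.diff ξ).size + ξ.size = η.size := by
  rw [mem_subs] at h
  have h1 := Finset.card_sdiff_add_card_eq_card h.1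
  have h2 := Finset.card_sdiff_add_card_eq_card h.2
  simp only [size, plus_diff, minus_diff]
  omega

lemma size_diff_eq_zero {η ξ : FinConf2 d} (h : ξ ∈ η.subs) : (η.diff ξ).size = 0 ↔ ξ = η := by
  rw [mem_subs] at h
  constructor
  · intro h0
    simp only [size, plus_diff, minus_diff, Nat.add_eq_zero_iff, Finset.card_eq_zero,
      Finset.sdiff_eq_empty_iff_subset] at h0
    exact FinConf2.ext (h.1.antisymm h0.1) (h.2.antisymm h0.2)
  · rintro rfl
    simp [size]

lemma toConf2_flipToMinus (η : FinConf2 d) (x : E d) :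
    η.toConf2.flipToMinus x = (η.flipToMinus x).toConf2 := by
  apply Subtype.ext
  apply Prod.ext <;> apply Subtype.ext
  · simp [toConf2, Conf2.flipToMinus, Conf.erase]
  · simp [toConf2, Conf2.flipToMinus, Conf.insert]

lemma toConf2_flipToPlus (η : FinConf2 d) (x : E d) :
    η.toConf2.flipToPlus x = (η.flipToPlus x).toConf2 := by
  apply Subtype.ext
  apply Prod.ext <;> apply Subtype.ext
  · simp [toConf2, Conf2.flipToPlus, Conf.insert]
  · simp [toConf2, Conf2.flipToPlus, Conf.erase]

lemma toConf2_erasePlus (η : FinConf2 d) (x : E d) :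
    η.toConf2.erasePlus x = (η.erasePlus x).toConf2 := by
  apply Subtype.ext
  apply Prod.ext <;> apply Subtype.ext
  · simp [toConf2, Conf2.erasePlus, Conf.erase]
  · simp [toConf2, Conf2.erasePlus]

lemma toConf2_eraseMinus (η : FinConf2 d) (x : E d) :
    η.toConf2.eraseMinus x = (η.eraseMinus x).toConf2 := by
  apply Subtype.ext
  apply Prod.ext <;> apply Subtype.ext
  · simp [toConf2, Conf2.eraseMinus]
  · simp [toConf2, Conf2.eraseMinus, Conf.erase]

lemma flipToPlus_flipToMinus {η : FinConf2 d} {x : E d} (hx : x ∈ η.plus) :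
    (η.flipToMinus x).flipToPlus x = η := by
  have := notMem_minus hx
  ext z <;> by_cases hz : z = x <;> simp_all

lemma flipToMinus_flipToPlus {η : FinConf2 d} {x : E d} (hx : x ∈ η.minus) :
    (η.flipToPlus x).flipToMinus x = η := by
  have := notMem_plus hx
  ext z <;> by_cases hz : z = x <;> simp_all

end FinConf2

open FinConf2

/-! ### Möbius inversion and the explicit form of `L̂₀` -/

/-- After exchanging the sums, the coefficient of `F ζ` is an alternating sum over the
configurations between `ζ` and `η`, which vanishes unless `ζ = η`. -/
lemma KInv_sum_subs (F : FinConf2 d → ℝ) (η : FinConf2 d) :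
    KInv (fun ξ => ∑ ζ ∈ ξ.subs, F ζ) η = F η := by
  simp only [KInv, Finset.mul_sum]
  rw [sum_subs_subs η fun ζ ξ => (-1 : ℝ) ^ (η.diff ξ).size * F ζ]
  rw [Finset.sum_eq_single_of_mem η (self_mem_subs η)]
  · rw [← Finset.sum_mul]
    have : ∑ ρ ∈ (η.diff η).subs, (-1 : ℝ) ^ (η.diff (ρ.union η)).size =
        ∑ ρ ∈ (η.diff η).subs, (-1 : ℝ) ^ ρ.size := by
      refine Finset.sum_congr rfl fun ρ hρ => ?_
      have hρ' := subs_trans hρ (diff_mem_subs η η)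
      have h1 := size_diff (union_mem_subs hρ' (self_mem_subs η))
      have h2 := size_diff hρ
      have h3 := size_diff (self_mem_subs η)
      have h4 : ρ.size = 0 := by omega
      have h5 : (ρ.union η).size = (ρ.union η |>.diff η).size + η.size := by
        refine (size_diff (mem_subs.2 ?_)).symm
        have h := disjoint_union_of_mem_subs hρ' (self_mem_subs η)
        rw [plus_union h, minus_union h]
        exact ⟨Finset.subset_union_right, Finset.subset_union_right⟩
      rw [union_diff_cancel (self_mem_subs η) hρ] at h5
      congr 1
      omega
    rw [this, sum_neg_one_pow_size, if_pos ((size_diff_eq_zero (self_mem_subs η)).2 rfl), one_mul]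
  · intro ζ hζ hne
    rw [← Finset.sum_mul]
    have : ∑ ρ ∈ (η.diff ζ).subs, (-1 : ℝ) ^ (η.diff (ρ.union ζ)).size =
        (-1) ^ (η.diff ζ).size * ∑ ρ ∈ (η.diff ζ).subs, (-1 : ℝ) ^ ρ.size := by
      rw [Finset.mul_sum]
      refine Finset.sum_congr rfl fun ρ hρ => ?_
      have hρ' := subs_trans hρ (diff_mem_subs η ζ)
      have h1 := size_diff (union_mem_subs hρ' hζ)
      have h3 := size_diff hζ
      have h5 : (ρ.union ζ |>.diff ζ).size + ζ.size = (ρ.union ζ).size := by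
        refine size_diff (mem_subs.2 ?_)
        have h := disjoint_union_of_mem_subs hρ' hζ
        rw [plus_union h, minus_union h]
        exact ⟨Finset.subset_union_right, Finset.subset_union_right⟩
      rw [union_diff_cancel hζ hρ] at h5
      have h6 : (η.diff ζ).size = (η.diff (ρ.union ζ)).size + ρ.size := by omega
      -- The sign of `η \ ζ` is the product of the signs of `ρ` and of what remains, and the sign of
      -- `ρ` squares to one.
      rw [h6, pow_add, mul_assoc, ← pow_add, Even.neg_one_pow ⟨ρ.size, rfl⟩, mul_one]
    rw [this, sum_neg_one_pow_size, if_neg (fun h => hne ((size_diff_eq_zero hζ).1 h)), mul_zero,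
      zero_mul]

/-- The inversion in the other order. It is what recovers a rate from its transform. -/
lemma sum_subs_KInv (F : FinConf2 d → ℝ) (η : FinConf2 d) :
    ∑ ξ ∈ η.subs, KInv F ξ = F η := by
  simp only [KInv]
  rw [sum_subs_subs η fun ζ ξ => (-1 : ℝ) ^ (ξ.diff ζ).size * F ζ]
  have key : ∀ ζ ∈ η.subs, ∑ ρ ∈ (η.diff ζ).subs, (-1 : ℝ) ^ ((ρ.union ζ).diff ζ).size * F ζ =
      (if (η.diff ζ).size = 0 then 1 else 0) * F ζ := by
    intro ζ hζ
    rw [← Finset.sum_mul, Finset.sum_congr rfl fun ρ hρ => by rw [union_diff_cancel hζ hρ],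
      sum_neg_one_pow_size]
  rw [Finset.sum_eq_single_of_mem η (self_mem_subs η), key η (self_mem_subs η),
    if_pos ((size_diff_eq_zero (self_mem_subs η)).2 rfl), one_mul]
  intro ζ hζ hne
  rw [key ζ hζ, if_neg (fun h => hne ((size_diff_eq_zero hζ).1 h)), zero_mul]

lemma KInv_congr {F F' : FinConf2 d → ℝ} {η : FinConf2 d} (h : ∀ ξ ∈ η.subs, F ξ = F' ξ) :
    KInv F η = KInv F' η :=
  Finset.sum_congr rfl fun ξ hξ => by rw [h ξ hξ]

lemma KTransform_toConf2 (G : FinConf2 d → ℝ) (η : FinConf2 d) :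
    KTransform G η.toConf2 = ∑ ξ ∈ η.subs, G ξ := by
  rw [KTransform, ← finsum_mem_coe_finset]
  refine finsum_congr fun ξ => ?_
  have : (ξ ∈ (η.subs : Set (FinConf2 d))) =
      ((ξ.plus : Set (E d)) ⊆ η.toConf2.plus ∧ (ξ.minus : Set (E d)) ⊆ η.toConf2.minus) := by
    rw [Finset.mem_coe, mem_subs, ← Finset.coe_subset, ← Finset.coe_subset]
    rfl
  rw [this]

/-- Sub-configurations avoiding `x` are common to `η` and its flip and cancel. Those containing `x`
correspond to each other by flipping `x`. -/
lemma sum_subs_flipToMinus_sub (G : FinConf2 d → ℝ) {η : FinConf2 d} {x : E d}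
    (hx : x ∈ η.plus) :
    ∑ ξ ∈ (η.flipToMinus x).subs, G ξ - ∑ ξ ∈ η.subs, G ξ =
      ∑ ξ ∈ η.subs with x ∈ ξ.plus, (G (ξ.flipToMinus x) - G ξ) := by
  have hx' := notMem_minus hx
  rw [Finset.sum_sub_distrib,
    ← Finset.sum_filter_add_sum_filter_not (η.flipToMinus x).subs (fun ξ => x ∈ ξ.minus),
    ← Finset.sum_filter_add_sum_filter_not η.subs (fun ξ => x ∈ ξ.plus)]
  have h1 : ∑ ξ ∈ (η.flipToMinus x).subs with x ∉ ξ.minus, G ξ =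
      ∑ ξ ∈ η.subs with x ∉ ξ.plus, G ξ := by
    refine Finset.sum_congr ?_ fun _ _ => rfl
    ext ξ
    simp only [Finset.mem_filter, mem_subs, plus_flipToMinus, minus_flipToMinus,
      Finset.subset_iff, Finset.mem_sdiff, Finset.mem_union, Finset.mem_singleton]
    constructor
    · rintro ⟨⟨h, h'⟩, h''⟩
      refine ⟨⟨fun z hz => (h hz).1, fun z hz => (h' hz).resolve_right ?_⟩,
        fun hz => (h hz).2 rfl⟩
      rintro rfl
      exact h'' hz
    · rintro ⟨⟨h, h'⟩, h''⟩
      refine ⟨⟨fun z hz => ⟨h hz, ?_⟩, fun z hz => Or.inl (h' hz)⟩, fun hz => hx' (h' hz)⟩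
      rintro rfl
      exact h'' hz
  have h2 : ∑ ξ ∈ (η.flipToMinus x).subs with x ∈ ξ.minus, G ξ =
      ∑ ξ ∈ η.subs with x ∈ ξ.plus, G (ξ.flipToMinus x) := by
    refine Finset.sum_bij' (fun ξ _ => ξ.flipToPlus x) (fun ξ _ => ξ.flipToMinus x) ?_ ?_ ?_ ?_ ?_
    · intro ξ
      simp only [Finset.mem_filter, mem_subs, plus_flipToMinus, minus_flipToMinus,
        plus_flipToPlus, minus_flipToPlus,
        Finset.subset_iff, Finset.mem_sdiff, Finset.mem_union, Finset.mem_singleton]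
      rintro ⟨⟨h, h'⟩, h''⟩
      refine ⟨⟨?_, fun z hz => (h' hz.1).resolve_right hz.2⟩, Or.inr trivial⟩
      rintro z (hz | rfl)
      exacts [(h hz).1, hx]
    · intro ξ
      simp only [Finset.mem_filter, mem_subs, plus_flipToMinus, minus_flipToMinus,
        Finset.subset_iff, Finset.mem_sdiff, Finset.mem_union, Finset.mem_singleton]
      rintro ⟨⟨h, h'⟩, h''⟩
      exact ⟨⟨fun z hz => ⟨h hz.1, hz.2⟩, fun z hz => hz.imp_left (h' ·)⟩, Or.inr trivial⟩
    · intro ξ hξ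
      exact flipToMinus_flipToPlus (Finset.mem_filter.1 hξ).2
    · intro ξ hξ
      exact flipToPlus_flipToMinus (Finset.mem_filter.1 hξ).2
    · intro ξ hξ
      rw [flipToMinus_flipToPlus (Finset.mem_filter.1 hξ).2]
  rw [h1, h2]
  ring

/-! ### Exchange of the two components, which reduces the minus-to-plus flips to the plus-to-minus
ones. -/

namespace FinConf2

/-- `(η⁻, η⁺)`. -/
def swap (η : FinConf2 d) : FinConf2 d := ⟨(η.1.2, η.1.1), η.2.symm⟩

@[simp] lemma plus_swap (η : FinConf2 d) : η.swap.plus = η.minus := rfl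
@[simp] lemma minus_swap (η : FinConf2 d) : η.swap.minus = η.plus := rfl
@[simp] lemma swap_swap (η : FinConf2 d) : η.swap.swap = η := rfl
@[simp] lemma size_swap (η : FinConf2 d) : η.swap.size = η.size := Nat.add_comm _ _
@[simp] lemma erasePlus_swap (η : FinConf2 d) (x : E d) :
    η.swap.erasePlus x = (η.eraseMinus x).swap := rfl
@[simp] lemma eraseMinus_swap (η : FinConf2 d) (x : E d) :
    η.swap.eraseMinus x = (η.erasePlus x).swap := rfl
@[simp] lemma flipToMinus_swap (η : FinConf2 d) (x : E d) :
    η.swap.flipToMinus x = (η.flipToPlus x).swap := rfl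
@[simp] lemma flipToPlus_swap (η : FinConf2 d) (x : E d) :
    η.swap.flipToPlus x = (η.flipToMinus x).swap := rfl
@[simp] lemma diff_swap (η ξ : FinConf2 d) : η.swap.diff ξ.swap = (η.diff ξ).swap := rfl

@[simp]
lemma union_swap (η ξ : FinConf2 d) : η.swap.union ξ.swap = (η.union ξ).swap := by
  by_cases h : Disjoint (η.plus ∪ ξ.plus) (η.minus ∪ ξ.minus)
  · have h' : Disjoint (η.swap.plus ∪ ξ.swap.plus) (η.swap.minus ∪ ξ.swap.minus) := h.symm
    apply FinConf2.ext
    · rw [plus_union h']; exact (minus_union h).symm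
    · rw [minus_union h']; exact (plus_union h).symm
  · have h' : ¬ Disjoint (η.swap.plus ∪ ξ.swap.plus) (η.swap.minus ∪ ξ.swap.minus) :=
      fun h' => h h'.symm
    rw [union, union, dif_neg h, dif_neg h']
    rfl

lemma sum_subs_swap {M : Type*} [AddCommMonoid M] (η : FinConf2 d) (f : FinConf2 d → M) :
    ∑ ξ ∈ η.swap.subs, f ξ = ∑ ξ ∈ η.subs, f ξ.swap := by
  refine Finset.sum_bij' (fun ξ _ => ξ.swap) (fun ξ _ => ξ.swap) ?_ ?_ ?_ ?_ ?_
  · intro ξ hξ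
    rw [mem_subs] at hξ ⊢
    exact hξ.symm
  · intro ξ hξ
    rw [mem_subs] at hξ ⊢
    exact hξ.symm
  all_goals intros; rfl

end FinConf2

lemma KInv_swap (F : FinConf2 d → ℝ) (η : FinConf2 d) :
    KInv F η.swap = KInv (fun ξ => F ξ.swap) η := by
  simp only [KInv]
  rw [sum_subs_swap]
  simp

/-- The `⁺ → ⁻` part of `L̂₀` for the transformed rate `B`. -/
def flipPart (B : E d → FinConf2 d → FinConf2 d → ℝ) (G : FinConf2 d → ℝ) (η : FinConf2 d) : ℝ :=
  ∑ ξ ∈ η.subs, ∑ x ∈ ξ.plus, (G (ξ.flipToMinus x) - G ξ) * B x (ξ.erasePlus x) (η.diff ξ)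

/-- The transformed rate with the roles of `⁺` and `⁻` interchanged. -/
def swapRate (B : E d → FinConf2 d → FinConf2 d → ℝ) (x : E d) (ξ η : FinConf2 d) : ℝ :=
  B x ξ.swap η.swap

lemma hatL0Formula_eq (aP aM : E d → Conf2 d → ℝ) (G : FinConf2 d → ℝ) (η : FinConf2 d) :
    hatL0Formula aP aM G η = flipPart (transformedRate aP) G η +
      flipPart (swapRate (transformedRate aM)) (fun ξ => G ξ.swap) η.swap := by
  rw [hatL0Formula, flipPart, flipPart, sum_subs_swap]
  rfl

/-- For fixed `ξ` and `x ∈ ξ⁺`, the sum over `ρ ⊆ η \ ξ` undoes `KInv` and leaves the value of `b`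
at `(η \ ξ) ∪ (ξ \ x) = η \ x`. This no longer depends on `ξ`, so the sum over all `ξ` containing
`x` is the increment of the K-transform under the flip of `x`. -/
lemma sum_subs_flipPart (b : E d → FinConf2 d → ℝ) (G : FinConf2 d → ℝ) (η : FinConf2 d) :
    ∑ ζ ∈ η.subs, flipPart (fun x ξ => KInv fun ζ => b x (ζ.union ξ)) G ζ =
      ∑ x ∈ η.plus, b x (η.erasePlus x) *
        (∑ ξ ∈ (η.flipToMinus x).subs, G ξ - ∑ ξ ∈ η.subs, G ξ) := by
  simp only [flipPart]
  rw [sum_subs_subs η fun ξ ζ => ∑ x ∈ ξ.plus, (G (ξ.flipToMinus x) - G ξ) *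
    KInv (fun ζ => b x (ζ.union (ξ.erasePlus x))) (ζ.diff ξ)]
  have h1 : ∀ ξ ∈ η.subs, ∑ ρ ∈ (η.diff ξ).subs, ∑ x ∈ ξ.plus, (G (ξ.flipToMinus x) - G ξ) *
      KInv (fun ζ => b x (ζ.union (ξ.erasePlus x))) ((ρ.union ξ).diff ξ) =
      ∑ x ∈ ξ.plus, (G (ξ.flipToMinus x) - G ξ) * b x (η.erasePlus x) := by
    intro ξ hξ
    rw [Finset.sum_comm]
    refine Finset.sum_congr rfl fun x hx => ?_
    rw [Finset.sum_congr rfl fun ρ hρ => by rw [union_diff_cancel hξ hρ], ← Finset.mul_sum,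
      sum_subs_KInv]
    congr 2
    have hx' : ξ.erasePlus x ∈ η.subs := by
      rw [mem_subs] at hξ ⊢
      exact ⟨Finset.sdiff_subset.trans hξ.1, hξ.2⟩
    have h := disjoint_union_of_mem_subs (diff_mem_subs η ξ) hx'
    rw [mem_subs] at hξ
    apply FinConf2.ext
    · rw [plus_union h, plus_diff, plus_erasePlus, plus_erasePlus]
      ext z
      have := @hξ.1 z
      by_cases hz : z = x
      · simp [hz, hx]
      · by_cases hz' : z ∈ ξ.plus <;> simp_all
    · rw [minus_union h]
      exact Finset.sdiff_union_of_subset hξ.2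
  rw [Finset.sum_congr rfl h1, Finset.sum_comm' (s' := fun x => {ξ ∈ η.subs | x ∈ ξ.plus})
    (t' := η.plus)]
  · refine Finset.sum_congr rfl fun x hx => ?_
    rw [sum_subs_flipToMinus_sub G hx, Finset.mul_sum]
    exact Finset.sum_congr rfl fun ξ _ => mul_comm _ _
  · intro ξ x
    rw [Finset.mem_filter]
    exact ⟨fun h => ⟨h, (mem_subs.1 h.1).1 h.2⟩, fun h => h.1⟩

theorem hatL0_eq_hatL0Formula (aP aM : E d → Conf2 d → ℝ) (G : FinConf2 d → ℝ) (η : FinConf2 d) :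
    hatL0 aP aM G η = hatL0Formula aP aM G η := by
  rw [hatL0, ← KInv_sum_subs (hatL0Formula aP aM G) η]
  refine KInv_congr fun ζ _ => ?_
  simp only [hatL0Formula_eq]
  rw [Finset.sum_add_distrib]
  -- The exchanged transform of `aM` is the transform of the rate `aM` with its components
  -- exchanged, so `sum_subs_flipPart` applies to it as well.
  have h2 : ∑ ξ ∈ ζ.subs, flipPart (swapRate (transformedRate aM)) (fun ξ => G ξ.swap) ξ.swap =
      ∑ ξ ∈ ζ.swap.subs, flipPart (fun x ξ => KInv fun ζ => aM x (ζ.union ξ).swap.toConf2)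
        (fun ξ => G ξ.swap) ξ := by
    rw [sum_subs_swap]
    refine Finset.sum_congr rfl fun ξ _ => ?_
    congr 1
    funext x ξ ζ
    rw [swapRate, transformedRate, KInv_swap]
    refine KInv_congr fun ρ _ => ?_
    rw [union_swap]
  rw [h2]
  have h1 := sum_subs_flipPart (fun x ξ => aP x ξ.toConf2) G ζ
  have h3 := sum_subs_flipPart (fun x ξ => aM x ξ.swap.toConf2) (fun ξ => G ξ.swap) ζ.swap
  rw [L0]
  congr 1
  · refine Eq.trans ?_ h1.symm
    rw [← finsum_mem_coe_finset]
    refine finsum_mem_congr rfl fun x _ => ?_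
    rw [toConf2_flipToMinus, toConf2_erasePlus, KTransform_toConf2, KTransform_toConf2]
  · refine Eq.trans ?_ h3.symm
    rw [← finsum_mem_coe_finset]
    refine finsum_mem_congr rfl fun x _ => ?_
    rw [toConf2_flipToPlus, toConf2_eraseMinus, KTransform_toConf2, KTransform_toConf2,
      flipToMinus_swap, sum_subs_swap, sum_subs_swap]
    rfl

/-! ### The σ-algebra of the space of finite configurations -/

instance : BorelSpace (FinConf d) := ⟨rfl⟩

namespace FinConf

@[ext]
lemma ext {η ξ : FinConf d} (h : η.pts = ξ.pts) : η = ξ := by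
  cases η; cases ξ; simpa using h

/-- The configurations with a point in `U`. -/
def hits (U : Set (E d)) : Set (FinConf d) := {η | ∃ x ∈ η.pts, x ∈ U}

/-- The configuration of the points of a finite family. -/
def ofFamily {ι : Type*} [Fintype ι] (x : ι → E d) : FinConf d := ⟨Finset.univ.image x⟩

lemma mem_ofFamily {ι : Type*} [Fintype ι] {x : ι → E d} {z : E d} :
    z ∈ (ofFamily x).pts ↔ ∃ i, x i = z := by
  simp [ofFamily]

lemma toFinConf_eq_ofFamily {n : ℕ} (x : {x : Fin n → E d // Function.Injective x}) :
    toFinConf d n x = ofFamily x.1 := by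
  simp [toFinConf, ofFamily, Finset.map_eq_image]

lemma isOpen_hits {U : Set (E d)} (hU : IsOpen U) : IsOpen (hits U) := by
  refine isOpen_iSup_iff.2 fun n => isOpen_coinduced.2 ?_
  have : toFinConf d n ⁻¹' hits U = ⋃ i, {x | x.1 i ∈ U} := by
    ext x
    simp [hits, toFinConf_eq_ofFamily, mem_ofFamily]
  rw [this]
  exact isOpen_iUnion fun i => hU.preimage ((continuous_apply i).comp continuous_subtype_val)

lemma measurable_toFinConf (n : ℕ) : Measurable (toFinConf d n) :=
  (continuous_iSup_rng (i := n) continuous_coinduced_rng).measurable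

/-- The σ-algebra generated by the sets of configurations with a point in a given open set. -/
@[reducible]
def hitMeasurableSpace (d : ℕ) : MeasurableSpace (FinConf d) :=
  MeasurableSpace.generateFrom {s | ∃ U : Set (E d), IsOpen U ∧ hits U = s}

lemma hitMeasurableSpace_le : hitMeasurableSpace d ≤ finConfMeasurableSpace d := by
  refine MeasurableSpace.generateFrom_le ?_
  rintro _ ⟨U, hU, rfl⟩
  exact (isOpen_hits hU).measurableSet

/-- A finite set is closed, so a point of `η` outside `ξ` has a basic neighbourhood that misses `ξ`.
Countably many hitting events therefore distinguish configurations. -/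
lemma countablySeparated_hitMeasurableSpace :
    @MeasurableSpace.CountablySeparated (FinConf d) (hitMeasurableSpace d) := by
  refine @MeasurableSpace.CountablySeparated.mk _ (_) ⟨hits '' TopologicalSpace.countableBasis (E d),
    (TopologicalSpace.countable_countableBasis _).image _, ?_, ?_⟩
  · rintro _ ⟨U, hU, rfl⟩
    exact MeasurableSpace.measurableSet_generateFrom
      ⟨U, TopologicalSpace.isOpen_of_mem_countableBasis hU, rfl⟩
  · have key : ∀ η ξ : FinConf d,
        (∀ s ∈ hits '' TopologicalSpace.countableBasis (E d), η ∈ s → ξ ∈ s) →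
          η.pts ⊆ ξ.pts := by
      intro η ξ h x hx
      by_contra hx'
      obtain ⟨U, hU, hxU, hUs⟩ := (TopologicalSpace.isBasis_countableBasis (E d)).exists_subset_of_mem_open
        (show x ∈ ((ξ.pts : Set (E d)))ᶜ from hx') ξ.pts.finite_toSet.isClosed.isOpen_compl
      obtain ⟨z, hz, hzU⟩ := h (hits U) ⟨U, hU, rfl⟩ ⟨x, hx, hxU⟩
      exact hUs hzU hz
    intro η _ ξ _ h
    exact FinConf.ext ((key η ξ fun s hs => (h s hs).1).antisymm (key ξ η fun s hs => (h s hs).2))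

lemma injective_of_strictMono_comp {n : ℕ} {g : E d → ℝ} {x : Fin n → E d}
    (hx : StrictMono (g ∘ x)) : Function.Injective x :=
  hx.injective.of_comp

lemma measurableSet_strictMono_comp {g : E d → ℝ} (hg : Measurable g) (n : ℕ) :
    MeasurableSet {x : Fin n → E d | StrictMono (g ∘ x)} := by
  have : {x : Fin n → E d | StrictMono (g ∘ x)} =
      ⋂ i, ⋂ j, ⋂ (_ : i < j), {x | g (x i) < g (x j)} := by
    ext x
    simp [StrictMono]
  rw [this]
  exact MeasurableSet.iInter fun i => MeasurableSet.iInter fun j => MeasurableSet.iInter fun _ =>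
    measurableSet_lt (hg.comp (measurable_pi_apply i)) (hg.comp (measurable_pi_apply j))

/-- The injection `g` orders the points, and an increasing tuple is determined by its range.
Increasing tuples thus form a cross-section of the quotient by permutations. -/
lemma injective_ofFamily_of_strictMono {n : ℕ} {g : E d → ℝ} (hg : Function.Injective g) :
    Function.Injective
      fun x : {x : Fin n → E d // StrictMono (g ∘ x)} => ofFamily x.1 := by
  intro x y hxy
  have h : g ∘ x.1 = g ∘ y.1 := by
    rw [← StrictMono.range_inj x.2 y.2, Set.range_comp, Set.range_comp]
    congr 1
    ext z
    have := congrArg (z ∈ FinConf.pts ·) hxy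
    simpa only [mem_ofFamily, eq_iff_iff, Set.mem_range] using this
  exact Subtype.ext (funext fun i => hg (congrFun h i))

lemma exists_strictMono_ofFamily {g : E d → ℝ} (hg : Function.Injective g) {n : ℕ}
    {η : FinConf d} (hη : η.pts.card = n) : ∃ x : Fin n → E d, StrictMono (g ∘ x) ∧ ofFamily x = η := by
  let _ : LinearOrder (E d) := LinearOrder.lift' g hg
  refine ⟨η.pts.orderEmbOfFin hη, fun i j hij => ?_, ?_⟩
  · exact (η.pts.orderEmbOfFin hη).strictMono hij
  · ext z
    rw [mem_ofFamily]
    have := Finset.range_orderEmbOfFin η.pts hη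
    rw [← Finset.mem_coe, ← this]
    rfl

lemma card_ofFamily {ι : Type*} [Fintype ι] {x : ι → E d} (hx : Function.Injective x) :
    (ofFamily x).pts.card = Fintype.card ι := by
  rw [ofFamily, Finset.card_image_of_injective _ hx, Finset.card_univ]

lemma measurable_ofFamily_strictMono {n : ℕ} (g : E d → ℝ) :
    Measurable fun x : {x : Fin n → E d // StrictMono (g ∘ x)} => ofFamily x.1 := by
  have : (fun x : {x : Fin n → E d // StrictMono (g ∘ x)} => ofFamily x.1) =
      fun x => toFinConf d n ⟨x.1, injective_of_strictMono_comp x.2⟩ :=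
    funext fun x => by rw [toFinConf_eq_ofFamily]
  rw [this]
  exact (measurable_toFinConf n).comp (measurable_subtype_coe.subtype_mk)

/-- A Borel set of configurations is a countable union, over the number of points, of images of
Borel sets of increasing tuples. These tuples form standard Borel spaces and the map to
configurations is injective on them, so by Lusin–Souslin the images already belong to the countably
separated σ-algebra of hitting events. -/
lemma finConfMeasurableSpace_eq : finConfMeasurableSpace d = hitMeasurableSpace d := by
  refine le_antisymm (fun A hA => ?_) hitMeasurableSpace_le
  obtain ⟨g, hg⟩ := MeasureTheory.exists_measurableEmbedding_real (E d)
  have hA' : A = ⋃ n, (fun x : {x : Fin n → E d // StrictMono (g ∘ x)} => ofFamily x.1) ''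
      ((fun x : {x : Fin n → E d // StrictMono (g ∘ x)} => ofFamily x.1) ⁻¹' A) := by
    ext η
    simp only [Set.mem_iUnion, Set.mem_image, Set.mem_preimage]
    constructor
    · intro h
      obtain ⟨x, hx, hx'⟩ := exists_strictMono_ofFamily hg.injective (η := η) rfl
      exact ⟨_, ⟨x, hx⟩, by rwa [hx'], hx'⟩
    · rintro ⟨n, x, hx, rfl⟩
      exact hx
  rw [hA']
  refine @MeasurableSet.iUnion _ _ (hitMeasurableSpace d) _ _ fun n => ?_
  have : StandardBorelSpace {x : Fin n → E d // StrictMono (g ∘ x)} :=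
    (measurableSet_strictMono_comp hg.measurable n).standardBorel
  -- Two σ-algebras are in play: `hm` is for the Borel one and makes the preimage of `A` measurable,
  -- while `hm'` is for the smaller one, in which the image has to be measurable.
  have hm := measurable_ofFamily_strictMono (n := n) g
  have hm' := @Measurable.measurableEmbedding _ _ (hitMeasurableSpace d) _
    countablySeparated_hitMeasurableSpace _ _ (hm.mono le_rfl hitMeasurableSpace_le)
    (injective_ofFamily_of_strictMono hg.injective)
  exact @MeasurableEmbedding.measurableSet_image' _ _ _ (hitMeasurableSpace d) _ hm' _ (hm hA)

lemma measurable_iff {Y : Type*} [MeasurableSpace Y] {g : Y → FinConf d} :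
    Measurable g ↔ ∀ U : Set (E d), IsOpen U → MeasurableSet {y | ∃ x ∈ (g y).pts, x ∈ U} := by
  constructor
  · intro hg U hU
    exact hg (isOpen_hits hU).measurableSet
  · intro h
    rw [finConfMeasurableSpace_eq]
    refine measurable_generateFrom ?_
    rintro _ ⟨U, hU, rfl⟩
    exact h U hU

instance : MeasurableSpace.CountablySeparated (FinConf d) := by
  rw [finConfMeasurableSpace_eq]
  exact countablySeparated_hitMeasurableSpace

/-- The map from increasing tuples to configurations is a measurable embedding. Its range is the
`n`-point sector, and its inverse extends measurably to all configurations. -/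
lemma exists_measurable_section (n : ℕ) :
    MeasurableSet {η : FinConf d | η.pts.card = n} ∧
    ∃ s : FinConf d → Fin n → E d, Measurable s ∧ ∀ η, η.pts.card = n → ofFamily (s η) = η := by
  obtain ⟨g, hg⟩ := MeasureTheory.exists_measurableEmbedding_real (E d)
  have : StandardBorelSpace {x : Fin n → E d // StrictMono (g ∘ x)} :=
    (measurableSet_strictMono_comp hg.measurable n).standardBorel
  have hm := (measurable_ofFamily_strictMono (n := n) g).measurableEmbedding
    (injective_ofFamily_of_strictMono hg.injective)
  constructor
  · convert hm.measurableSet_range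
    ext η
    constructor
    · intro hη
      obtain ⟨x, hx, hx'⟩ := exists_strictMono_ofFamily hg.injective hη
      exact ⟨⟨x, hx⟩, hx'⟩
    · rintro ⟨x, rfl⟩
      simpa using card_ofFamily (injective_of_strictMono_comp x.2)
  · obtain ⟨s, hs, hs'⟩ := hm.exists_measurable_extend measurable_subtype_coe
      (fun _ => inferInstance)
    refine ⟨s, hs, ?_⟩
    intro η hη
    obtain ⟨x, hx, hx'⟩ := exists_strictMono_ofFamily hg.injective hη
    have := congrFun hs' ⟨x, hx⟩
    simp only [Function.comp_apply] at this
    rw [← hx', this]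

end FinConf

lemma measurable_of_nat {Y Z : Type*} [MeasurableSpace Y] [MeasurableSpace Z] {c : Y → ℕ}
    (hc : Measurable c) {F : ℕ → Y → Z} (hF : ∀ n, Measurable (F n)) :
    Measurable fun y => F (c y) y :=
  (measurable_from_prod_countable_right (f := fun p : ℕ × Y => F p.1 p.2) hF).comp
    (hc.prodMk measurable_id)

/-! ### Measurable enumeration of the points, and measurability of finite sums and set operations.
-/

namespace FinConf

@[fun_prop]
lemma _root_.Measurable.card_pts {Y : Type*} [MeasurableSpace Y] {g : Y → FinConf d}
    (hg : Measurable g) : Measurable fun y => (g y).pts.card :=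
  measurable_to_countable' fun n => hg (exists_measurable_section n).1

lemma exists_measurable_enumeration (d : ℕ) :
    ∃ e : ℕ → FinConf d → E d, (∀ i, Measurable (e i)) ∧
      ∀ η : FinConf d, (Finset.range η.pts.card).image (e · η) = η.pts := by
  choose s hs hs' using fun n => (exists_measurable_section (d := d) n).2
  -- Beyond the number of points the value `0` is a filler; only indices below the cardinality are
  -- used to list the configuration.
  refine ⟨fun i η => if h : i < η.pts.card then s η.pts.card η ⟨i, h⟩ else 0, fun i => ?_,
    fun η => ?_⟩
  · refine measurable_of_nat (F := fun n η => if h : i < n then s n η ⟨i, h⟩ else 0)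
      (measurable_id.card_pts) fun n => ?_
    by_cases h : i < n
    · simp only [h, dite_true]
      exact (measurable_pi_apply _).comp (hs n)
    · simp only [h, dite_false]
      exact measurable_const
  · ext z
    have := mem_ofFamily (x := s η.pts.card η) (z := z)
    rw [hs' _ _ rfl] at this
    rw [this, Finset.mem_image]
    constructor
    · rintro ⟨i, hi, rfl⟩
      rw [Finset.mem_range] at hi
      exact ⟨⟨i, hi⟩, by simp [hi]⟩
    · rintro ⟨i, rfl⟩
      exact ⟨i, by simp, by simp⟩

/-- A measurable enumeration of the points of a finite configuration. -/
def enum (i : ℕ) (η : FinConf d) : E d := (exists_measurable_enumeration d).choose i η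

@[fun_prop]
lemma measurable_enum (i : ℕ) : Measurable (enum (d := d) i) :=
  (exists_measurable_enumeration d).choose_spec.1 i

lemma image_enum (η : FinConf d) : (Finset.range η.pts.card).image (enum · η) = η.pts :=
  (exists_measurable_enumeration d).choose_spec.2 η

lemma injOn_enum (η : FinConf d) :
    Set.InjOn (enum · η) (Finset.range η.pts.card) := by
  rw [← Finset.card_image_iff, image_enum, Finset.card_range]

section Measurability

variable {Y : Type*} [MeasurableSpace Y] {M : Type*} [AddCommMonoid M] [MeasurableSpace M]
  [MeasurableAdd₂ M]

lemma measurable_sum_pts {g : Y → FinConf d} (hg : Measurable g) {f : Y → E d → M}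
    (hf : Measurable fun p : Y × E d => f p.1 p.2) :
    Measurable fun y => ∑ x ∈ (g y).pts, f y x := by
  have : (fun y => ∑ x ∈ (g y).pts, f y x) =
      fun y => ∑ i ∈ Finset.range (g y).pts.card, f y (enum i (g y)) := by
    funext y
    conv_lhs => rw [← image_enum (g y)]
    rw [Finset.sum_image (injOn_enum _)]
  rw [this]
  exact measurable_of_nat (F := fun n y => ∑ i ∈ Finset.range n, f y (enum i (g y)))
    hg.card_pts fun n => Finset.measurable_fun_sum _ fun i _ =>
      hf.comp (measurable_id.prodMk ((measurable_enum i).comp hg))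

lemma measurableSet_exists_mem {g : Y → FinConf d} (hg : Measurable g) {P : Y → E d → Prop}
    (hP : MeasurableSet {p : Y × E d | P p.1 p.2}) :
    MeasurableSet {y | ∃ x ∈ (g y).pts, P y x} := by
  have : {y | ∃ x ∈ (g y).pts, P y x} =
      ⋃ i, ({y | i < (g y).pts.card} ∩ {y | P y (enum i (g y))}) := by
    ext y
    simp only [Set.mem_iUnion, Set.mem_inter_iff, Set.mem_ofPred_eq]
    conv_lhs => rw [← image_enum (g y)]
    simp
  rw [this]
  refine MeasurableSet.iUnion fun i => MeasurableSet.inter ?_ ?_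
  · exact measurableSet_lt measurable_const hg.card_pts
  · exact (measurable_id.prodMk ((measurable_enum i).comp hg)) hP

lemma measurableSet_mem {g : Y → FinConf d} (hg : Measurable g) {x : Y → E d}
    (hx : Measurable x) : MeasurableSet {y | x y ∈ (g y).pts} := by
  have : {y | x y ∈ (g y).pts} = {y | ∃ z ∈ (g y).pts, z = x y} := by
    ext y; simp
  rw [this]
  exact measurableSet_exists_mem hg
    (measurableSet_eq_fun measurable_snd (hx.comp measurable_fst))

@[fun_prop]
lemma _root_.Measurable.finConfSdiff {g g' : Y → FinConf d} (hg : Measurable g)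
    (hg' : Measurable g') : Measurable fun y => (⟨(g y).pts \ (g' y).pts⟩ : FinConf d) := by
  refine measurable_iff.2 fun U hU => ?_
  have : {y | ∃ x ∈ (g y).pts \ (g' y).pts, x ∈ U} =
      {y | ∃ x ∈ (g y).pts, x ∉ (g' y).pts ∧ x ∈ U} := by
    ext y; simp [and_assoc]
  rw [this]
  exact measurableSet_exists_mem hg ((measurableSet_mem (hg'.comp measurable_fst)
    measurable_snd).compl.inter (measurable_snd hU.measurableSet))

@[fun_prop]
lemma _root_.Measurable.finConfUnion {g g' : Y → FinConf d} (hg : Measurable g)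
    (hg' : Measurable g') : Measurable fun y => (⟨(g y).pts ∪ (g' y).pts⟩ : FinConf d) := by
  refine measurable_iff.2 fun U hU => ?_
  have : {y | ∃ x ∈ (g y).pts ∪ (g' y).pts, x ∈ U} =
      {y | ∃ x ∈ (g y).pts, x ∈ U} ∪ {y | ∃ x ∈ (g' y).pts, x ∈ U} := by
    ext y; simp [or_and_right, exists_or]
  rw [this]
  exact (measurable_iff.1 hg U hU).union (measurable_iff.1 hg' U hU)

lemma measurable_singleton : Measurable fun x : E d => (⟨{x}⟩ : FinConf d) := by
  refine measurable_iff.2 fun U hU => ?_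
  simpa using hU.measurableSet

lemma measurable_image {ι : Type*} (I : Finset ι) {x : Y → ι → E d}
    (hx : ∀ i ∈ I, Measurable fun y => x y i) :
    Measurable fun y => (⟨I.image (x y)⟩ : FinConf d) := by
  refine measurable_iff.2 fun U hU => ?_
  have : {y | ∃ z ∈ I.image (x y), z ∈ U} = ⋃ i ∈ I, {y | x y i ∈ U} := by
    ext y; simp
  rw [this]
  exact Finset.measurableSet_biUnion I fun i hi => hx i hi hU.measurableSet

@[fun_prop]
lemma measurable_ofFamily {ι : Type*} [Fintype ι] :
    Measurable (ofFamily : (ι → E d) → FinConf d) :=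
  measurable_image Finset.univ fun i _ => measurable_pi_apply i

lemma measurable_sum_powerset {g : Y → FinConf d} (hg : Measurable g) {f : Y → FinConf d → M}
    (hf : Measurable fun p : Y × FinConf d => f p.1 p.2) :
    Measurable fun y => ∑ a ∈ (g y).pts.powerset, f y ⟨a⟩ := by
  have : (fun y => ∑ a ∈ (g y).pts.powerset, f y ⟨a⟩) =
      fun y => ∑ I ∈ (Finset.range (g y).pts.card).powerset, f y ⟨I.image (enum · (g y))⟩ := by
    funext y
    symm
    refine Finset.sum_bij (fun I _ => I.image (enum · (g y))) ?_ ?_ ?_ fun _ _ => rfl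
    · intro I hI
      rw [Finset.mem_powerset] at hI ⊢
      conv_rhs => rw [← image_enum (g y)]
      exact Finset.image_subset_image hI
    · intro I hI J hJ hIJ
      rw [Finset.mem_powerset] at hI hJ
      have hIJ' := congrArg (fun s : Finset (E d) => (s : Set (E d))) hIJ
      simp only [Finset.coe_image] at hIJ'
      exact_mod_cast (injOn_enum (g y)).image_eq_image_iff (Finset.coe_subset.2 hI)
        (Finset.coe_subset.2 hJ) |>.1 hIJ'
    · intro a ha
      rw [Finset.mem_powerset] at ha
      conv_rhs at ha => rw [← image_enum (g y)]
      obtain ⟨I, hI, hI'⟩ := Finset.subset_image_iff.1 ha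
      exact ⟨I, Finset.mem_powerset.2 hI, hI'⟩
  rw [this]
  exact measurable_of_nat
    (F := fun n y => ∑ I ∈ (Finset.range n).powerset, f y ⟨I.image (enum · (g y))⟩)
    hg.card_pts fun n => Finset.measurable_fun_sum _ fun I _ => hf.comp
      (measurable_id.prodMk (measurable_image I fun i _ => (measurable_enum i).comp hg))

lemma measurableSet_disjoint {g g' : Y → FinConf d} (hg : Measurable g) (hg' : Measurable g') :
    MeasurableSet {y | Disjoint (g y).pts (g' y).pts} := by
  have : {y | Disjoint (g y).pts (g' y).pts} = {y | ∃ x ∈ (g y).pts, x ∈ (g' y).pts}ᶜ := by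
    ext y; simp [Finset.disjoint_left]
  rw [this]
  exact (measurableSet_exists_mem hg
    (measurableSet_mem (hg'.comp measurable_fst) measurable_snd)).compl

lemma measurableSet_subset {g : Y → FinConf d} (hg : Measurable g) {Λ : Set (E d)}
    (hΛ : MeasurableSet Λ) : MeasurableSet {y | ((g y).pts : Set (E d)) ⊆ Λ} := by
  have : {y | ((g y).pts : Set (E d)) ⊆ Λ} = {y | ∃ x ∈ (g y).pts, x ∈ Λᶜ}ᶜ := by
    ext y; simp [Set.subset_def]
  rw [this]
  exact (measurableSet_exists_mem hg (P := fun _ x => x ∈ Λᶜ) (measurable_snd hΛ.compl)).compl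

end Measurability

end FinConf

/-! ### Measurability of the operations on pairs of configurations. -/

namespace FinConf2

variable {Y : Type*} [MeasurableSpace Y]

/-- `η⁺` as a point of `Γ₀`. -/
def plusConf (η : FinConf2 d) : FinConf d := ⟨η.plus⟩

/-- `η⁻` as a point of `Γ₀`. -/
def minusConf (η : FinConf2 d) : FinConf d := ⟨η.minus⟩

@[simp] lemma pts_plusConf (η : FinConf2 d) : η.plusConf.pts = η.plus := rfl
@[simp] lemma pts_minusConf (η : FinConf2 d) : η.minusConf.pts = η.minus := rfl

@[fun_prop]
lemma _root_.Measurable.plusConf {g : Y → FinConf2 d} (hg : Measurable g) :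
    Measurable fun y => (g y).plusConf :=
  measurable_fst.comp (measurable_subtype_coe.comp hg)

@[fun_prop]
lemma _root_.Measurable.minusConf {g : Y → FinConf2 d} (hg : Measurable g) :
    Measurable fun y => (g y).minusConf :=
  measurable_snd.comp (measurable_subtype_coe.comp hg)

lemma measurable_of_conf {g : Y → FinConf2 d} (hp : Measurable fun y => (g y).plusConf)
    (hm : Measurable fun y => (g y).minusConf) : Measurable g :=
  (hp.prodMk hm).subtype_mk

@[fun_prop]
lemma _root_.Measurable.ofPair {p q : Y → FinConf d} (hp : Measurable p) (hq : Measurable q) :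
    Measurable fun y => ofPair (p y) (q y) := by
  have h := FinConf.measurableSet_disjoint hp hq
  classical
  refine measurable_of_conf ?_ ?_
  · have : (fun y => (FinConf2.ofPair (p y) (q y)).plusConf) =
        fun y => if y ∈ {y | Disjoint (p y).pts (q y).pts} then p y else ⟨∅⟩ := by
      funext y
      simp only [FinConf2.ofPair, Set.mem_ofPred_eq]
      split_ifs <;> rfl
    rw [this]
    exact Measurable.ite h hp measurable_const
  · have : (fun y => (FinConf2.ofPair (p y) (q y)).minusConf) =
        fun y => if y ∈ {y | Disjoint (p y).pts (q y).pts} then q y else ⟨∅⟩ := by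
      funext y
      simp only [FinConf2.ofPair, Set.mem_ofPred_eq]
      split_ifs <;> rfl
    rw [this]
    exact Measurable.ite h hq measurable_const

@[fun_prop]
lemma _root_.Measurable.finConf2Swap {g : Y → FinConf2 d} (hg : Measurable g) :
    Measurable fun y => (g y).swap :=
  measurable_of_conf hg.minusConf hg.plusConf

@[fun_prop]
lemma _root_.Measurable.finConf2Union {g g' : Y → FinConf2 d} (hg : Measurable g)
    (hg' : Measurable g') : Measurable fun y => (g y).union (g' y) :=
  (hg.plusConf.finConfUnion hg'.plusConf).ofPair (hg.minusConf.finConfUnion hg'.minusConf)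

@[fun_prop]
lemma _root_.Measurable.finConf2Diff {g g' : Y → FinConf2 d} (hg : Measurable g)
    (hg' : Measurable g') : Measurable fun y => (g y).diff (g' y) :=
  measurable_of_conf (hg.plusConf.finConfSdiff hg'.plusConf)
    (hg.minusConf.finConfSdiff hg'.minusConf)

@[fun_prop]
lemma _root_.Measurable.erasePlus {g : Y → FinConf2 d} {x : Y → E d} (hg : Measurable g)
    (hx : Measurable x) : Measurable fun y => (g y).erasePlus (x y) :=
  measurable_of_conf (hg.plusConf.finConfSdiff (FinConf.measurable_singleton.comp hx)) hg.minusConf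

@[fun_prop]
lemma _root_.Measurable.eraseMinus {g : Y → FinConf2 d} {x : Y → E d} (hg : Measurable g)
    (hx : Measurable x) : Measurable fun y => (g y).eraseMinus (x y) :=
  measurable_of_conf hg.plusConf (hg.minusConf.finConfSdiff (FinConf.measurable_singleton.comp hx))

@[fun_prop]
lemma _root_.Measurable.flipToMinus {g : Y → FinConf2 d} {x : Y → E d} (hg : Measurable g)
    (hx : Measurable x) : Measurable fun y => (g y).flipToMinus (x y) :=
  measurable_of_conf (hg.plusConf.finConfSdiff (FinConf.measurable_singleton.comp hx))
    (hg.minusConf.finConfUnion (FinConf.measurable_singleton.comp hx))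

@[fun_prop]
lemma _root_.Measurable.flipToPlus {g : Y → FinConf2 d} {x : Y → E d} (hg : Measurable g)
    (hx : Measurable x) : Measurable fun y => (g y).flipToPlus (x y) :=
  measurable_of_conf (hg.plusConf.finConfUnion (FinConf.measurable_singleton.comp hx))
    (hg.minusConf.finConfSdiff (FinConf.measurable_singleton.comp hx))

@[fun_prop]
lemma _root_.Measurable.finConf2Size {g : Y → FinConf2 d} (hg : Measurable g) :
    Measurable fun y => (g y).size :=
  hg.plusConf.card_pts.add hg.minusConf.card_pts

section Sums

variable {M : Type*} [AddCommMonoid M] [MeasurableSpace M] [MeasurableAdd₂ M]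

lemma measurable_sum_plus {g : Y → FinConf2 d} (hg : Measurable g) {f : Y → E d → M}
    (hf : Measurable fun p : Y × E d => f p.1 p.2) :
    Measurable fun y => ∑ x ∈ (g y).plus, f y x :=
  FinConf.measurable_sum_pts hg.plusConf hf

lemma measurable_sum_minus {g : Y → FinConf2 d} (hg : Measurable g) {f : Y → E d → M}
    (hf : Measurable fun p : Y × E d => f p.1 p.2) :
    Measurable fun y => ∑ x ∈ (g y).minus, f y x :=
  FinConf.measurable_sum_pts hg.minusConf hf

lemma measurable_sum_subs {g : Y → FinConf2 d} (hg : Measurable g) {f : Y → FinConf2 d → M}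
    (hf : Measurable fun p : Y × FinConf2 d => f p.1 p.2) :
    Measurable fun y => ∑ ξ ∈ (g y).subs, f y ξ := by
  simp only [sum_subs]
  refine FinConf.measurable_sum_powerset hg.plusConf
    (f := fun y a => ∑ b ∈ (g y).minus.powerset, f y (ofPair a ⟨b⟩)) ?_
  refine FinConf.measurable_sum_powerset (g := fun p : Y × FinConf d => (g p.1).minusConf)
    (by fun_prop) (f := fun p b => f p.1 (ofPair p.2 b)) ?_
  exact hf.comp ((measurable_fst.comp measurable_fst).prodMk
    ((measurable_snd.comp measurable_fst).ofPair measurable_snd))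

end Sums

end FinConf2

/-! ### Sums over random finite sets -/

/-- The measure `ν` is the intensity of the family `T ω i`, `i ∈ S ω`, of random points. -/
structure IsIntensity {Ω ι Z : Type*} [MeasurableSpace Ω] [MeasurableSpace Z] (μ : Measure Ω)
    (S : Ω → Finset ι) (T : Ω → ι → Z) (ν : Measure Z) : Prop where
  measurable : ∀ h : Z → ℝ≥0∞, Measurable h → Measurable fun ω => ∑ i ∈ S ω, h (T ω i)
  lintegral : ∀ h : Z → ℝ≥0∞, Measurable h →
    ∫⁻ ω, ∑ i ∈ S ω, h (T ω i) ∂μ = ∫⁻ z, h z ∂ν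

namespace IsIntensity

variable {Ω ι Z : Type*} [MeasurableSpace Ω] [MeasurableSpace Z] {μ : Measure Ω}
  {S : Ω → Finset ι} {T : Ω → ι → Z} {ν : Measure Z}

/-- Applied to the indicator of a measurable null set containing the exceptional points, the
intensity formula says that the expected number of such points is zero. -/
lemma ae_forall (H : IsIntensity μ S T ν) {P : Z → Prop} (hP : ∀ᵐ z ∂ν, P z) :
    ∀ᵐ ω ∂μ, ∀ i ∈ S ω, P (T ω i) := by
  have h0 : ν (toMeasurable ν {z | ¬ P z}) = 0 := by
    rw [measure_toMeasurable]; exact hP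
  have hm := measurableSet_toMeasurable ν {z | ¬ P z}
  have hi : Measurable ((toMeasurable ν {z | ¬ P z}).indicator fun _ => (1 : ℝ≥0∞)) :=
    measurable_const.indicator hm
  have := H.lintegral _ hi
  rw [lintegral_indicator_const hm, h0, mul_zero, lintegral_eq_zero_iff (H.measurable _ hi)] at this
  filter_upwards [this] with ω hω i hiS
  rw [Pi.zero_apply, Finset.sum_eq_zero_iff] at hω
  by_contra hn
  have h1 := hω i hiS
  rw [Set.indicator_of_mem (subset_toMeasurable _ _ hn)] at h1
  exact one_ne_zero h1

/-- Positive and negative parts are summed separately in `ℝ≥0∞`, the form in which measurability and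
integral identities for nonnegative functions carry over to real ones. -/
lemma sum_eq {Ω ι Z : Type*} (S : Ω → Finset ι) (T : Ω → ι → Z) (f : Z → ℝ) (ω : Ω) :
    ∑ i ∈ S ω, f (T ω i) = (∑ i ∈ S ω, ENNReal.ofReal (f (T ω i))).toReal -
      (∑ i ∈ S ω, ENNReal.ofReal (-f (T ω i))).toReal := by
  rw [ENNReal.toReal_sum fun _ _ => ENNReal.ofReal_ne_top,
    ENNReal.toReal_sum fun _ _ => ENNReal.ofReal_ne_top, ← Finset.sum_sub_distrib]
  refine Finset.sum_congr rfl fun i _ => ?_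
  rw [ENNReal.toReal_ofReal', ENNReal.toReal_ofReal', max_zero_sub_max_neg_zero_eq_self]

lemma measurable_real (H : IsIntensity μ S T ν) {f : Z → ℝ} (hf : Measurable f) :
    Measurable fun ω => ∑ i ∈ S ω, f (T ω i) := by
  simp only [sum_eq S T f]
  exact (H.measurable _ hf.ennreal_ofReal).ennreal_toReal.sub
    (H.measurable _ hf.neg.ennreal_ofReal).ennreal_toReal

lemma integrable (H : IsIntensity μ S T ν) {f : Z → ℝ} (hf : Measurable f) (hi : Integrable f ν) :
    Integrable (fun ω => ∑ i ∈ S ω, f (T ω i)) μ := by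
  refine ⟨(H.measurable_real hf).aestronglyMeasurable, ?_⟩
  rw [hasFiniteIntegral_iff_enorm]
  calc ∫⁻ ω, ‖∑ i ∈ S ω, f (T ω i)‖ₑ ∂μ ≤ ∫⁻ ω, ∑ i ∈ S ω, ‖f (T ω i)‖ₑ ∂μ :=
        lintegral_mono fun ω => enorm_sum_le _ _
    _ = ∫⁻ z, ‖f z‖ₑ ∂ν := H.lintegral _ hf.enorm
    _ < ∞ := hi.2

lemma integral (H : IsIntensity μ S T ν) {f : Z → ℝ} (hf : Measurable f) (hi : Integrable f ν) :
    ∫ ω, ∑ i ∈ S ω, f (T ω i) ∂μ = ∫ z, f z ∂ν := by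
  have key : ∀ g : Z → ℝ, Measurable g → Integrable g ν →
      Integrable (fun ω => (∑ i ∈ S ω, ENNReal.ofReal (g (T ω i))).toReal) μ ∧
      ∫ ω, (∑ i ∈ S ω, ENNReal.ofReal (g (T ω i))).toReal ∂μ =
        (∫⁻ z, ENNReal.ofReal (g z) ∂ν).toReal := by
    intro g hg hgi
    have h1 := H.lintegral _ hg.ennreal_ofReal
    have h2 : ∫⁻ z, ENNReal.ofReal (g z) ∂ν ≠ ∞ := hgi.lintegral_lt_top.ne
    constructor
    · exact integrable_toReal_of_lintegral_ne_top (H.measurable _ hg.ennreal_ofReal).aemeasurable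
        (h1 ▸ h2)
    · rw [integral_toReal (H.measurable _ hg.ennreal_ofReal).aemeasurable
        (Eventually.of_forall fun ω => ENNReal.sum_lt_top.2 fun _ _ => ENNReal.ofReal_lt_top), h1]
  have hpos := key f hf hi
  have hneg := key (fun z => -f z) hf.neg hi.neg
  simp only [sum_eq S T f]
  rw [integral_sub hpos.1 hneg.1, hpos.2, hneg.2,
    integral_eq_lintegral_pos_part_sub_lintegral_neg_part hi]

end IsIntensity

/-! ### The Lebesgue–Poisson measure -/

section LebesguePoisson

lemma measurableSet_injective (ι : Type*) [Fintype ι] :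
    MeasurableSet {x : ι → E d | Function.Injective x} := by
  have : {x : ι → E d | Function.Injective x} =
      ⋂ i, ⋂ j, ⋂ (_ : i ≠ j), {x | x i = x j}ᶜ := by
    ext x
    simp only [Set.mem_iInter, Set.mem_compl_iff, Set.mem_ofPred_eq]
    exact ⟨fun h i j hij hx => hij (h hx), fun h i j hx => by_contra fun hij => h i j hij hx⟩
  rw [this]
  exact MeasurableSet.iInter fun i => MeasurableSet.iInter fun j => MeasurableSet.iInter fun _ =>
    (measurableSet_eq_fun (measurable_pi_apply i) (measurable_pi_apply j)).compl

/-- Each diagonal is a proper linear subspace, hence null. Positive dimension is essential: for `d =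
0` a diagonal is the whole space. -/
lemma ae_injective [Nonempty (Fin d)] (ι : Type*) [Fintype ι] :
    ∀ᵐ x : ι → E d, Function.Injective x := by
  classical
  have key : ∀ i j : ι, i ≠ j → ∀ᵐ x : ι → E d, x i ≠ x j := by
    intro i j hij
    let V : Submodule ℝ (ι → E d) := LinearMap.ker
      ((LinearMap.proj i : (ι → E d) →ₗ[ℝ] E d) - LinearMap.proj j)
    have hV : V ≠ ⊤ := by
      intro hV
      obtain ⟨v, hv⟩ := exists_ne (0 : E d)
      have : Pi.single i v ∈ V := hV ▸ Submodule.mem_top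
      simp [V, Pi.single_eq_of_ne hij.symm] at this
      exact hv this
    have := Measure.addHaar_submodule volume V hV
    refine measure_mono_null (fun x hx => ?_) this
    simpa [V, sub_eq_zero] using hx
  have : ∀ᵐ x : ι → E d, ∀ i j, i ≠ j → x i ≠ x j :=
    ae_all_iff.2 fun i => ae_all_iff.2 fun j => Filter.eventually_imp_distrib_left.2 (key i j)
  filter_upwards [this] with x hx i j hij
  exact by_contra fun h => hx i j h hij

/-- As the diagonals are null, integrals over tuples of distinct points may be taken over all
tuples. -/
lemma sectorMeasure_eq [Nonempty (Fin d)] (n : ℕ) :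
    sectorMeasure d n = (volume : Measure (Fin n → E d)).map FinConf.ofFamily := by
  have h1 : toFinConf d n = FinConf.ofFamily ∘ Subtype.val :=
    funext FinConf.toFinConf_eq_ofFamily
  have hE : MeasurableEmbedding (Subtype.val : {x : Fin n → E d // Function.Injective x} → _) :=
    MeasurableEmbedding.subtype_coe (measurableSet_injective (Fin n))
  rw [sectorMeasure, h1, ← Measure.map_map FinConf.measurable_ofFamily measurable_subtype_coe,
    hE.map_comap, Measure.restrict_eq_self_of_ae_mem]
  filter_upwards [ae_injective (Fin n)] with x hx using ⟨⟨x, hx⟩, rfl⟩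

lemma lintegral_lebesguePoisson [Nonempty (Fin d)] (z : ℝ) {f : FinConf d → ℝ≥0∞}
    (hf : Measurable f) :
    ∫⁻ η, f η ∂(lebesguePoisson d z) = ∑' n : ℕ, ENNReal.ofReal (z ^ n / (n.factorial : ℝ)) *
      ∫⁻ x : Fin n → E d, f (FinConf.ofFamily x) := by
  rw [lebesguePoisson, lintegral_sum_measure]
  congr 1 with n
  rw [lintegral_smul_measure, sectorMeasure_eq, lintegral_map hf FinConf.measurable_ofFamily,
    smul_eq_mul]

instance [Nonempty (Fin d)] (z : ℝ) : SFinite (lebesguePoisson d z) := by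
  have : ∀ n, SFinite (sectorMeasure d n) := fun n => by rw [sectorMeasure_eq]; infer_instance
  unfold lebesguePoisson
  infer_instance

lemma lintegral_lebesguePoisson_one [Nonempty (Fin d)] {f : FinConf d → ℝ≥0∞}
    (hf : Measurable f) :
    ∫⁻ η, f η ∂(lebesguePoisson d 1) = ∑' n : ℕ, (n.factorial : ℝ≥0∞)⁻¹ *
      ∫⁻ x : Fin n → E d, f (FinConf.ofFamily x) := by
  rw [lintegral_lebesguePoisson 1 hf]
  congr 1 with n
  rw [one_pow, one_div, ENNReal.ofReal_inv_of_pos (by positivity), ENNReal.ofReal_natCast]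

lemma lintegral_lebesguePoisson_eq [Nonempty (Fin d)] {C : ℝ} (hC : 0 ≤ C) {f : FinConf d → ℝ≥0∞}
    (hf : Measurable f) :
    ∫⁻ η, f η ∂(lebesguePoisson d C) =
      ∫⁻ η, ENNReal.ofReal C ^ η.pts.card * f η ∂(lebesguePoisson d 1) := by
  rw [lintegral_lebesguePoisson C hf, lintegral_lebesguePoisson_one (by fun_prop)]
  congr 1 with n
  have : ∫⁻ x : Fin n → E d, ENNReal.ofReal C ^ (FinConf.ofFamily x).pts.card *
      f (FinConf.ofFamily x) = ENNReal.ofReal C ^ n * ∫⁻ x : Fin n → E d, f (FinConf.ofFamily x) := by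
    rw [← lintegral_const_mul _ (by fun_prop)]
    refine lintegral_congr_ae ?_
    filter_upwards [ae_injective (Fin n)] with x hx
    rw [FinConf.card_ofFamily hx, Fintype.card_fin]
  rw [this, ← mul_assoc, div_eq_inv_mul, ENNReal.ofReal_mul (by positivity),
    ENNReal.ofReal_inv_of_pos (by positivity), ENNReal.ofReal_natCast, ENNReal.ofReal_pow hC]

lemma ae_notMem [Nonempty (Fin d)] (z : ℝ) (x : E d) :
    ∀ᵐ η ∂(lebesguePoisson d z), x ∉ η.pts := by
  have hm : MeasurableSet {η : FinConf d | x ∈ η.pts} :=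
    FinConf.measurableSet_mem measurable_id measurable_const
  have : lebesguePoisson d z {η | x ∈ η.pts} = 0 := by
    rw [← lintegral_indicator_one hm, lintegral_lebesguePoisson z (measurable_one.indicator hm)]
    refine ENNReal.tsum_eq_zero.2 fun n => mul_eq_zero_of_right _ ?_
    refine lintegral_eq_zero_of_ae_eq_zero ?_
    have : ∀ᵐ y : Fin n → E d, ∀ i, y i ≠ x :=
      ae_all_iff.2 fun i => Measure.ae_eval_ne (μ := fun _ : Fin n => (volume : Measure (E d))) i x
    filter_upwards [this] with y hy
    refine Set.indicator_of_notMem ?_ _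
    simpa [FinConf.mem_ofFamily] using hy
  rw [ae_iff]
  simpa using this

lemma ae_disjoint [Nonempty (Fin d)] (z : ℝ) (p : FinConf d) :
    ∀ᵐ q ∂(lebesguePoisson d z), Disjoint p.pts q.pts := by
  have : ∀ᵐ q ∂(lebesguePoisson d z), ∀ x ∈ p.pts, x ∉ q.pts :=
    (Finset.eventually_all p.pts).2 fun x _ => ae_notMem z x
  filter_upwards [this] with q hq
  exact Finset.disjoint_left.2 fun x hx => hq x hx

lemma lintegral_ofFamily_eq {ι : Type*} [Fintype ι] {k : ℕ} (hk : Fintype.card ι = k)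
    {f : FinConf d → ℝ≥0∞} (hf : Measurable f) :
    ∫⁻ x : ι → E d, f (FinConf.ofFamily x) = ∫⁻ x : Fin k → E d, f (FinConf.ofFamily x) := by
  let e : Fin k ≃ ι := (Fintype.equivFinOfCardEq hk).symm
  have he := volume_measurePreserving_piCongrLeft (fun _ : ι => E d) e
  rw [← he.lintegral_comp (f := fun x => f (FinConf.ofFamily x)) (by fun_prop)]
  refine lintegral_congr fun x => ?_
  congr 1
  ext z
  simp only [FinConf.mem_ofFamily]
  constructor
  · rintro ⟨i, rfl⟩
    obtain ⟨j, rfl⟩ := e.surjective i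
    exact ⟨j, (MeasurableEquiv.piCongrLeft_apply_apply (β := fun _ : ι => E d) e x j).symm⟩
  · rintro ⟨j, rfl⟩
    exact ⟨e j, MeasurableEquiv.piCongrLeft_apply_apply (β := fun _ : ι => E d) e x j⟩

/-- Fubini for the splitting of the coordinates into those in `I` and the others. Up to relabelling,
the result depends only on the cardinality of `I`. -/
lemma lintegral_split {n : ℕ} (I : Finset (Fin n)) {h : FinConf d → FinConf d → ℝ≥0∞}
    (hh : Measurable fun p : FinConf d × FinConf d => h p.1 p.2) :
    ∫⁻ x : Fin n → E d, h ⟨I.image x⟩ ⟨Iᶜ.image x⟩ =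
      ∫⁻ x : Fin I.card → E d, ∫⁻ y : Fin (n - I.card) → E d,
        h (FinConf.ofFamily x) (FinConf.ofFamily y) := by
  have he : MeasurePreserving (MeasurableEquiv.piEquivPiSubtypeProd (fun _ : Fin n => E d) (· ∈ I))
      volume volume := by
    convert volume_preserving_piEquivPiSubtypeProd (fun _ : Fin n => E d) (· ∈ I) <;> rfl
  have hm : Measurable fun p : ({i // i ∈ I} → E d) × ({i // i ∉ I} → E d) =>
      h (FinConf.ofFamily p.1) (FinConf.ofFamily p.2) :=
    hh.comp ((FinConf.measurable_ofFamily.comp measurable_fst).prodMk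
      (FinConf.measurable_ofFamily.comp measurable_snd))
  have h1 : ∫⁻ x : Fin n → E d, h ⟨I.image x⟩ ⟨Iᶜ.image x⟩ =
      ∫⁻ p : ({i // i ∈ I} → E d) × ({i // i ∉ I} → E d),
        h (FinConf.ofFamily p.1) (FinConf.ofFamily p.2) := by
    refine Eq.trans ?_ (he.lintegral_comp hm)
    refine lintegral_congr fun x => ?_
    congr 1 <;> ext z <;>
      simp [FinConf.mem_ofFamily, MeasurableEquiv.piEquivPiSubtypeProd,
        Equiv.piEquivPiSubtypeProd]
  rw [h1, Measure.volume_eq_prod, lintegral_prod _ hm.aemeasurable]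
  have h2 : ∀ x : {i // i ∈ I} → E d, ∫⁻ y : {i // i ∉ I} → E d,
      h (FinConf.ofFamily x) (FinConf.ofFamily y) = ∫⁻ y : Fin (n - I.card) → E d,
      h (FinConf.ofFamily x) (FinConf.ofFamily y) := fun x =>
    lintegral_ofFamily_eq (by simp [Fintype.card_subtype_compl])
      (hh.comp (measurable_const.prodMk measurable_id))
  simp only [h2]
  refine lintegral_ofFamily_eq (f := fun p => ∫⁻ y : Fin (n - I.card) → E d,
      h p (FinConf.ofFamily y)) (by simp) ?_
  exact Measurable.lintegral_prod_right' (f := fun q : FinConf d × (Fin (n - I.card) → E d) =>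
      h q.1 (FinConf.ofFamily q.2)) (hh.comp (measurable_fst.prodMk
        (FinConf.measurable_ofFamily.comp measurable_snd)))

lemma factorial_inv_mul_choose {k l : ℕ} :
    ((k + l).factorial : ℝ≥0∞)⁻¹ * ((k + l).choose k : ℝ≥0∞) =
      (k.factorial : ℝ≥0∞)⁻¹ * (l.factorial : ℝ≥0∞)⁻¹ := by
  have h : ((k + l).choose k * k.factorial * l.factorial : ℝ≥0∞) = (k + l).factorial := by
    rw [Nat.choose_symm_add]
    exact_mod_cast Nat.add_choose_mul_factorial_mul_factorial k l
  have h1 : (k.factorial : ℝ≥0∞) ≠ 0 := by exact_mod_cast k.factorial_ne_zero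
  have h2 : (l.factorial : ℝ≥0∞) ≠ 0 := by exact_mod_cast l.factorial_ne_zero
  have h3 : ((k + l).choose k : ℝ≥0∞) ≠ 0 := by
    exact_mod_cast (Nat.choose_pos (Nat.le_add_right k l)).ne'
  have h1' := ENNReal.natCast_ne_top k.factorial
  have h2' := ENNReal.natCast_ne_top l.factorial
  have h3' := ENNReal.natCast_ne_top ((k + l).choose k)
  rw [← h, ENNReal.mul_inv (Or.inr h2') (Or.inr h2), ENNReal.mul_inv (Or.inr h1') (Or.inr h1)]
  calc _ = ((k + l).choose k : ℝ≥0∞)⁻¹ * ((k + l).choose k : ℝ≥0∞) *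
        ((k.factorial : ℝ≥0∞)⁻¹ * (l.factorial : ℝ≥0∞)⁻¹) := by ring
    _ = _ := by rw [ENNReal.inv_mul_cancel h3 h3', one_mul]

lemma sum_powerset_ofFamily {n : ℕ} {x : Fin n → E d} (hx : Function.Injective x)
    (h : FinConf d → FinConf d → ℝ≥0∞) :
    ∑ a ∈ (FinConf.ofFamily x).pts.powerset, h ⟨a⟩ ⟨(FinConf.ofFamily x).pts \ a⟩ =
      ∑ I ∈ (Finset.univ : Finset (Fin n)).powerset, h ⟨I.image x⟩ ⟨Iᶜ.image x⟩ := by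
  symm
  refine Finset.sum_bij (fun I _ => I.image x) ?_ ?_ ?_ ?_
  · intro I _
    exact Finset.mem_powerset.2 (Finset.image_subset_image (Finset.subset_univ I))
  · intro I _ J _ hIJ
    exact Finset.image_injective hx hIJ
  · intro a ha
    obtain ⟨I, hI, hI'⟩ := Finset.subset_image_iff.1 (Finset.mem_powerset.1 ha)
    exact ⟨I, by simp, hI'⟩
  · intro I _
    congr 2
    rw [FinConf.ofFamily, ← Finset.image_sdiff _ _ hx, Finset.compl_eq_univ_sdiff]

/-- The Minlos lemma: the pairs `(ξ, η \ ξ)`, `ξ ⊆ η`, have intensity `λ ⊗ λ`. -/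
lemma lintegral_sum_powerset [Nonempty (Fin d)] {h : FinConf d → FinConf d → ℝ≥0∞}
    (hh : Measurable fun p : FinConf d × FinConf d => h p.1 p.2) :
    ∫⁻ η, ∑ a ∈ η.pts.powerset, h ⟨a⟩ ⟨η.pts \ a⟩ ∂(lebesguePoisson d 1) =
      ∫⁻ ξ, ∫⁻ ζ, h ξ ζ ∂(lebesguePoisson d 1) ∂(lebesguePoisson d 1) := by
  have hsum : Measurable fun η : FinConf d => ∑ a ∈ η.pts.powerset, h ⟨a⟩ ⟨η.pts \ a⟩ :=
    FinConf.measurable_sum_powerset measurable_id (f := fun η a => h a ⟨η.pts \ a.pts⟩)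
      (hh.comp (measurable_snd.prodMk (measurable_fst.finConfSdiff measurable_snd)))
  let J : ℕ → ℕ → ℝ≥0∞ := fun k l => ∫⁻ x : Fin k → E d, ∫⁻ y : Fin l → E d,
        h (FinConf.ofFamily x) (FinConf.ofFamily y)
  -- In the `n`-point sector all index sets of the same size `k` contribute equally, and `n.choose k
  -- / n! = 1 / (k! (n - k)!)`.
  have hL : ∀ n : ℕ, (n.factorial : ℝ≥0∞)⁻¹ * ∫⁻ x : Fin n → E d,
      ∑ a ∈ (FinConf.ofFamily x).pts.powerset, h ⟨a⟩ ⟨(FinConf.ofFamily x).pts \ a⟩ =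
      ∑ p ∈ Finset.HasAntidiagonal.antidiagonal n,
        (p.1.factorial : ℝ≥0∞)⁻¹ * ((p.2.factorial : ℝ≥0∞)⁻¹ * J p.1 p.2) := by
    intro n
    have h1 : ∫⁻ x : Fin n → E d,
        ∑ a ∈ (FinConf.ofFamily x).pts.powerset, h ⟨a⟩ ⟨(FinConf.ofFamily x).pts \ a⟩ =
        ∑ I ∈ (Finset.univ : Finset (Fin n)).powerset, J I.card (n - I.card) := by
      have : ∫⁻ x : Fin n → E d,
          ∑ a ∈ (FinConf.ofFamily x).pts.powerset, h ⟨a⟩ ⟨(FinConf.ofFamily x).pts \ a⟩ =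
          ∫⁻ x : Fin n → E d, ∑ I ∈ (Finset.univ : Finset (Fin n)).powerset,
            h ⟨I.image x⟩ ⟨Iᶜ.image x⟩ := by
        refine lintegral_congr_ae ?_
        filter_upwards [ae_injective (Fin n)] with x hx using sum_powerset_ofFamily hx h
      rw [this, lintegral_finsetSum]
      · exact Finset.sum_congr rfl fun I _ => lintegral_split I hh
      · exact fun I _ => hh.comp ((FinConf.measurable_image I fun i _ => measurable_pi_apply i).prodMk
          (FinConf.measurable_image Iᶜ fun i _ => measurable_pi_apply i))
    rw [h1, Finset.sum_powerset_apply_card (fun k => J k (n - k)), Finset.card_univ,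
      Fintype.card_fin, Finset.Nat.sum_antidiagonal_eq_sum_range_succ
        (fun k l => (k.factorial : ℝ≥0∞)⁻¹ * ((l.factorial : ℝ≥0∞)⁻¹ * J k l)), Finset.mul_sum]
    refine Finset.sum_congr rfl fun k hk => ?_
    obtain ⟨l, rfl⟩ := Nat.exists_eq_add_of_le (Nat.lt_succ_iff.1 (Finset.mem_range.1 hk))
    rw [nsmul_eq_mul, ← mul_assoc, factorial_inv_mul_choose, Nat.add_sub_cancel_left, mul_assoc]
  have hinner : Measurable fun ξ => ∫⁻ ζ, h ξ ζ ∂(lebesguePoisson d 1) :=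
    Measurable.lintegral_prod_right' hh
  rw [lintegral_lebesguePoisson_one hsum, lintegral_lebesguePoisson_one hinner]
  simp only [hL]
  have hR : ∀ k : ℕ, (k.factorial : ℝ≥0∞)⁻¹ * ∫⁻ x : Fin k → E d,
      ∫⁻ ζ, h (FinConf.ofFamily x) ζ ∂(lebesguePoisson d 1) =
      ∑' l : ℕ, (k.factorial : ℝ≥0∞)⁻¹ * ((l.factorial : ℝ≥0∞)⁻¹ * J k l) := by
    intro k
    rw [ENNReal.tsum_mul_left]
    congr 1
    have : ∀ x : Fin k → E d, ∫⁻ ζ, h (FinConf.ofFamily x) ζ ∂(lebesguePoisson d 1) =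
        ∑' l : ℕ, (l.factorial : ℝ≥0∞)⁻¹ * ∫⁻ y : Fin l → E d,
          h (FinConf.ofFamily x) (FinConf.ofFamily y) := fun x =>
      lintegral_lebesguePoisson_one (hh.comp (measurable_const.prodMk measurable_id))
    simp only [this]
    have hm : ∀ l : ℕ, Measurable fun x : Fin k → E d => ∫⁻ y : Fin l → E d,
        h (FinConf.ofFamily x) (FinConf.ofFamily y) := fun l =>
      Measurable.lintegral_prod_right' (f := fun q : (Fin k → E d) × (Fin l → E d) =>
        h (FinConf.ofFamily q.1) (FinConf.ofFamily q.2)) (hh.comp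
          ((FinConf.measurable_ofFamily.comp measurable_fst).prodMk
            (FinConf.measurable_ofFamily.comp measurable_snd)))
    rw [lintegral_tsum fun l => ((hm l).const_mul _).aemeasurable]
    congr 1 with l
    rw [lintegral_const_mul _ (hm l)]
  simp only [hR]
  -- The double series over `(k, l)` is summed along the antidiagonals `k + l = n`, as in a Cauchy
  -- product of exponential series.
  rw [← ENNReal.tsum_prod (f := fun k l : ℕ =>
      (k.factorial : ℝ≥0∞)⁻¹ * ((l.factorial : ℝ≥0∞)⁻¹ * J k l)),
    ← Finset.HasAntidiagonal.sigmaAntidiagonalEquivProd.tsum_eq, ENNReal.tsum_sigma']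
  congr 1 with n
  rw [tsum_fintype, ← Finset.sum_coe_sort]
  rfl

end LebesguePoisson

/-! ### The two-component Lebesgue–Poisson measure -/

section TwoComponents

lemma measurableSet_disjointPairs :
    MeasurableSet {η : FinConf d × FinConf d | Disjoint η.1.pts η.2.pts} :=
  FinConf.measurableSet_disjoint measurable_fst measurable_snd

lemma enum_zero_singleton (x : E d) : FinConf.enum 0 (⟨{x}⟩ : FinConf d) = x := by
  have := FinConf.image_enum (⟨{x}⟩ : FinConf d)
  simpa using this

variable [Nonempty (Fin d)]

lemma ae_prod_disjoint (z : ℝ) :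
    ∀ᵐ p ∂((lebesguePoisson d z).prod (lebesguePoisson d z)), Disjoint p.1.pts p.2.pts :=
  (Measure.ae_prod_iff_ae_ae measurableSet_disjointPairs).2
    (Eventually.of_forall fun p => ae_disjoint z p)

/-- Overlapping pairs are null for the product measure, so the dummy value of `ofPair` is harmless
and integrals become iterated integrals over single configurations. -/
lemma lebesguePoisson2_eq (z : ℝ) :
    lebesguePoisson2 d z = ((lebesguePoisson d z).prod (lebesguePoisson d z)).map
      fun p => ofPair p.1 p.2 := by
  have hE : MeasurableEmbedding (Subtype.val : FinConf2 d → FinConf d × FinConf d) :=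
    MeasurableEmbedding.subtype_coe measurableSet_disjointPairs
  have h1 : (lebesguePoisson2 d z).map Subtype.val =
      (lebesguePoisson d z).prod (lebesguePoisson d z) := by
    rw [lebesguePoisson2, hE.map_comap, Measure.restrict_eq_self_of_ae_mem]
    filter_upwards [ae_prod_disjoint z] with x hx using ⟨⟨x, hx⟩, rfl⟩
  have h2 : (fun p : FinConf d × FinConf d => ofPair p.1 p.2) ∘ Subtype.val = id :=
    funext fun η : FinConf2 d => ofPair_fst_snd η
  rw [← h1, Measure.map_map (by fun_prop) measurable_subtype_coe, h2, Measure.map_id]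

instance (z : ℝ) : SFinite (lebesguePoisson2 d z) := by
  rw [lebesguePoisson2_eq]; infer_instance

instance : SFinite (lam2 d) := by
  unfold lam2; infer_instance

lemma lintegral_lebesguePoisson2 (z : ℝ) {f : FinConf2 d → ℝ≥0∞} (hf : Measurable f) :
    ∫⁻ η, f η ∂(lebesguePoisson2 d z) =
      ∫⁻ p, ∫⁻ q, f (ofPair p q) ∂(lebesguePoisson d z) ∂(lebesguePoisson d z) := by
  rw [lebesguePoisson2_eq, lintegral_map hf (by fun_prop),
    lintegral_prod _ (by fun_prop)]

lemma lintegral_lebesguePoisson2_eq_of_measurable {C : ℝ} (hC : 0 ≤ C) {f : FinConf2 d → ℝ≥0∞}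
    (hf : Measurable f) :
    ∫⁻ η, f η ∂(lebesguePoisson2 d C) = ∫⁻ η, ENNReal.ofReal C ^ η.size * f η ∂(lam2 d) := by
  have hm : ∀ z, Measurable fun p => ∫⁻ q, f (ofPair p q) ∂(lebesguePoisson d z) := fun z =>
    Measurable.lintegral_prod_right' (f := fun x : FinConf d × FinConf d => f (ofPair x.1 x.2))
      (by fun_prop)
  rw [lam2, lintegral_lebesguePoisson2 C hf, lintegral_lebesguePoisson2 1 (by fun_prop),
    lintegral_lebesguePoisson_eq hC (hm C)]
  refine lintegral_congr fun p => ?_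
  rw [lintegral_lebesguePoisson_eq hC (by fun_prop), ← lintegral_const_mul _ (by fun_prop)]
  refine lintegral_congr_ae ?_
  filter_upwards [ae_disjoint 1 p] with q hq
  rw [ofPair_of_disjoint hq, ← mul_assoc, ← pow_add]
  rfl

lemma lebesguePoisson2_eq_withDensity {C : ℝ} (hC : 0 ≤ C) :
    lebesguePoisson2 d C = (lam2 d).withDensity fun η => ENNReal.ofReal C ^ η.size := by
  ext s hs
  rw [withDensity_apply _ hs, ← lintegral_indicator_one hs,
    lintegral_lebesguePoisson2_eq_of_measurable hC (measurable_one.indicator hs), ← lintegral_indicator hs]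
  refine lintegral_congr fun η => ?_
  by_cases h : η ∈ s <;> simp [h]

/-- The density is finite everywhere, so the identity extends to non-measurable integrands; norms of
arbitrary functions can then be computed with `lam2`. -/
lemma lintegral_lebesguePoisson2_eq {C : ℝ} (hC : 0 ≤ C) (f : FinConf2 d → ℝ≥0∞) :
    ∫⁻ η, f η ∂(lebesguePoisson2 d C) = ∫⁻ η, ENNReal.ofReal C ^ η.size * f η ∂(lam2 d) := by
  rw [lebesguePoisson2_eq_withDensity hC,
    lintegral_withDensity_eq_lintegral_mul_non_measurable _ (by fun_prop)
      (Eventually.of_forall fun η => ENNReal.pow_lt_top ENNReal.ofReal_lt_top)]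
  rfl

lemma ae_lebesguePoisson2_iff {C : ℝ} (hC : 0 < C) {P : FinConf2 d → Prop} :
    (∀ᵐ η ∂(lebesguePoisson2 d C), P η) ↔ ∀ᵐ η ∂(lam2 d), P η := by
  rw [lebesguePoisson2_eq_withDensity hC.le, ae_withDensity_iff (by fun_prop)]
  have : ∀ η : FinConf2 d, ENNReal.ofReal C ^ η.size ≠ 0 := fun η =>
    pow_ne_zero _ (ENNReal.ofReal_pos.2 hC).ne'
  simp [this]

lemma measurePreserving_swap_lebesguePoisson2 (z : ℝ) :
    MeasurePreserving FinConf2.swap (lebesguePoisson2 d z) (lebesguePoisson2 d z) := by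
  have hs : Measurable (FinConf2.swap (d := d)) := measurable_id.finConf2Swap
  have h1 : FinConf2.swap ∘ (fun p : FinConf d × FinConf d => ofPair p.1 p.2) =
      (fun p : FinConf d × FinConf d => ofPair p.1 p.2) ∘ Prod.swap := by
    funext p
    by_cases h : Disjoint p.1.pts p.2.pts
    · simp only [Function.comp_apply, ofPair_of_disjoint h, Prod.fst_swap, Prod.snd_swap,
        ofPair_of_disjoint h.symm]
      rfl
    · have h' : ¬ Disjoint p.2.pts p.1.pts := fun h' => h h'.symm
      simp only [Function.comp_apply, Prod.fst_swap, Prod.snd_swap]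
      rw [ofPair, ofPair, dif_neg h, dif_neg h']
      rfl
  refine ⟨hs, ?_⟩
  rw [lebesguePoisson2_eq, Measure.map_map hs (by fun_prop), h1,
    ← Measure.map_map (by fun_prop) measurable_swap, Measure.prod_swap]

lemma measurePreserving_swap : MeasurePreserving (FinConf2.swap (d := d)) (lam2 d) (lam2 d) :=
  measurePreserving_swap_lebesguePoisson2 1

/-- The Minlos lemma for two-component configurations. -/
lemma isIntensity_subs : IsIntensity (lam2 d) FinConf2.subs (fun η ξ => (ξ, η.diff ξ))
    ((lam2 d).prod (lam2 d)) := by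
  have hm : ∀ h : FinConf2 d × FinConf2 d → ℝ≥0∞, Measurable h →
      Measurable fun η : FinConf2 d => ∑ ξ ∈ η.subs, h (ξ, η.diff ξ) := fun h hh =>
    measurable_sum_subs measurable_id (f := fun η ξ => h (ξ, η.diff ξ)) (hh.comp (by fun_prop))
  refine ⟨hm, fun h hh => ?_⟩
  rw [lam2, lintegral_lebesguePoisson2 1 (hm h hh), lintegral_prod _ hh.aemeasurable,
    lintegral_lebesguePoisson2 1 (Measurable.lintegral_prod_right' hh)]
  -- With the plus component fixed, this is the one-component Minlos lemma in the minus component.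
  -- The plus component is treated afterwards.
  have h1 : ∀ p : FinConf d, ∫⁻ q, ∑ ξ ∈ (ofPair p q).subs, h (ξ, (ofPair p q).diff ξ)
      ∂(lebesguePoisson d 1) = ∑ a ∈ p.pts.powerset, ∫⁻ b, ∫⁻ b',
        h (ofPair ⟨a⟩ b, ofPair ⟨p.pts \ a⟩ b') ∂(lebesguePoisson d 1) ∂(lebesguePoisson d 1) := by
    intro p
    have h2 : ∫⁻ q, ∑ ξ ∈ (ofPair p q).subs, h (ξ, (ofPair p q).diff ξ) ∂(lebesguePoisson d 1) =
        ∫⁻ q, ∑ a ∈ p.pts.powerset, ∑ b ∈ q.pts.powerset,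
          h (ofPair ⟨a⟩ ⟨b⟩, ofPair ⟨p.pts \ a⟩ ⟨q.pts \ b⟩) ∂(lebesguePoisson d 1) := by
      refine lintegral_congr_ae ?_
      filter_upwards [ae_disjoint 1 p] with q hq
      rw [sum_subs, ofPair_of_disjoint hq]
      refine Finset.sum_congr rfl fun a ha => Finset.sum_congr rfl fun b hb => ?_
      have hab := (hq.mono_left (Finset.mem_powerset.1 ha)).mono_right (Finset.mem_powerset.1 hb)
      have hab' : Disjoint (p.pts \ a) (q.pts \ b) :=
        (hq.mono_left Finset.sdiff_subset).mono_right Finset.sdiff_subset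
      rw [ofPair_of_disjoint hab, ofPair_of_disjoint hab']
      rfl
    rw [h2, lintegral_finsetSum]
    · refine Finset.sum_congr rfl fun a _ => ?_
      exact lintegral_sum_powerset (h := fun b b' => h (ofPair ⟨a⟩ b, ofPair ⟨p.pts \ a⟩ b'))
        (hh.comp (by fun_prop))
    · intro a _
      exact FinConf.measurable_sum_powerset measurable_id
        (f := fun q b => h (ofPair ⟨a⟩ b, ofPair ⟨p.pts \ a⟩ ⟨q.pts \ b.pts⟩)) (hh.comp (by fun_prop))
  simp only [h1]
  have hJ : Measurable fun x : FinConf d × FinConf d => ∫⁻ b, ∫⁻ b',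
      h (ofPair x.1 b, ofPair x.2 b') ∂(lebesguePoisson d 1) ∂(lebesguePoisson d 1) := by
    refine Measurable.lintegral_prod_right' (f := fun y : (FinConf d × FinConf d) × FinConf d =>
      ∫⁻ b', h (ofPair y.1.1 y.2, ofPair y.1.2 b') ∂(lebesguePoisson d 1)) ?_
    exact Measurable.lintegral_prod_right'
      (f := fun y : ((FinConf d × FinConf d) × FinConf d) × FinConf d =>
        h (ofPair y.1.1.1 y.1.2, ofPair y.1.1.2 y.2)) (hh.comp (by fun_prop))
  rw [lintegral_sum_powerset (h := fun a a' => ∫⁻ b, ∫⁻ b',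
      h (ofPair a b, ofPair a' b') ∂(lebesguePoisson d 1) ∂(lebesguePoisson d 1)) hJ]
  refine lintegral_congr fun a => ?_
  -- The variables arrive in the order `a, a', b, b'` and are regrouped into the pairs `(a, b)` and
  -- `(a', b')`.
  rw [lintegral_lintegral_swap]
  · refine lintegral_congr fun b => ?_
    rw [lintegral_lebesguePoisson2 1 (by fun_prop)]
  · refine Measurable.aemeasurable ?_
    exact Measurable.lintegral_prod_right' (f := fun y : (FinConf d × FinConf d) × FinConf d =>
      h (ofPair a y.1.2, ofPair y.1.1 y.2)) (hh.comp (by fun_prop))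

/-- The intensity of the points of a configuration. -/
def pointMeasure (d : ℕ) : Measure (E d) :=
  ((lebesguePoisson d 1).restrict {η | η.pts.card = 1}).map (FinConf.enum 0)

instance : SFinite (pointMeasure d) := by
  unfold pointMeasure; infer_instance

/-- The Mecke formula: it is the Minlos lemma for functions that vanish unless the first piece is a
single point. Identifying `pointMeasure` with Lebesgue measure is not needed, only that it is the
same for both components. -/
lemma lintegral_sum_pts {h : E d → FinConf d → ℝ≥0∞}
    (hh : Measurable fun p : E d × FinConf d => h p.1 p.2) :
    ∫⁻ η, ∑ x ∈ η.pts, h x ⟨η.pts \ {x}⟩ ∂(lebesguePoisson d 1) =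
      ∫⁻ x, ∫⁻ ζ, h x ζ ∂(lebesguePoisson d 1) ∂(pointMeasure d) := by
  have hc : MeasurableSet {η : FinConf d | η.pts.card = 1} :=
    (FinConf.exists_measurable_section 1).1
  have hI : Measurable fun x => ∫⁻ ζ, h x ζ ∂(lebesguePoisson d 1) :=
    Measurable.lintegral_prod_right' hh
  let g : FinConf d → FinConf d → ℝ≥0∞ := fun ξ ζ =>
    {η : FinConf d | η.pts.card = 1}.indicator (fun ξ => h (FinConf.enum 0 ξ) ζ) ξ
  have hg : Measurable fun p : FinConf d × FinConf d => g p.1 p.2 := by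
    have : (fun p : FinConf d × FinConf d => g p.1 p.2) =
        (Prod.fst ⁻¹' {η : FinConf d | η.pts.card = 1}).indicator
          fun p => h (FinConf.enum 0 p.1) p.2 := by
      funext p
      by_cases hp : p.1.pts.card = 1 <;> simp [g, hp]
    rw [this]
    refine Measurable.indicator ?_ (measurable_fst hc)
    exact hh.comp (g := fun p : E d × FinConf d => h p.1 p.2)
      (f := fun p : FinConf d × FinConf d => (FinConf.enum 0 p.1, p.2)) (by fun_prop)
  have := lintegral_sum_powerset hg
  rw [pointMeasure, lintegral_map hI (FinConf.measurable_enum 0), ← lintegral_indicator hc]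
  convert this using 1
  · refine lintegral_congr fun η => ?_
    have h1 : ∑ a ∈ η.pts.powerset, g ⟨a⟩ ⟨η.pts \ a⟩ =
        ∑ a ∈ Finset.powersetCard 1 η.pts, g ⟨a⟩ ⟨η.pts \ a⟩ := by
      rw [Finset.powersetCard_eq_filter]
      refine (Finset.sum_filter_of_ne fun a _ ha => ?_).symm
      by_contra hne
      exact ha (by simp [g, hne])
    rw [h1, Finset.powersetCard_one, Finset.sum_map]
    refine Finset.sum_congr rfl fun x _ => ?_
    simp [g, enum_zero_singleton]
  · refine lintegral_congr fun ξ => ?_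
    by_cases hξ : ξ.pts.card = 1 <;> simp [g, hξ]

lemma lintegral_sum_erasePlus {h : E d × FinConf2 d → ℝ≥0∞} (hh : Measurable h) :
    ∫⁻ η, ∑ x ∈ η.plus, h (x, η.erasePlus x) ∂(lam2 d) =
      ∫⁻ p, h p ∂((pointMeasure d).prod (lam2 d)) := by
  have hm : Measurable fun η : FinConf2 d => ∑ x ∈ η.plus, h (x, η.erasePlus x) :=
    measurable_sum_plus measurable_id (f := fun η x => h (x, η.erasePlus x)) (hh.comp (by fun_prop))
  rw [lintegral_prod _ hh.aemeasurable]
  have h0 : ∀ x, ∫⁻ ζ, h (x, ζ) ∂(lam2 d) = ∫⁻ p, ∫⁻ q, h (x, ofPair p q)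
      ∂(lebesguePoisson d 1) ∂(lebesguePoisson d 1) := fun x => by
    rw [lam2, lintegral_lebesguePoisson2 1 (by fun_prop)]
  simp only [h0]
  rw [lam2, lintegral_lebesguePoisson2 1 hm]
  have h1 : ∀ p : FinConf d, ∫⁻ q, ∑ x ∈ (ofPair p q).plus, h (x, (ofPair p q).erasePlus x)
      ∂(lebesguePoisson d 1) = ∑ x ∈ p.pts, ∫⁻ q, h (x, ofPair ⟨p.pts \ {x}⟩ q)
      ∂(lebesguePoisson d 1) := by
    intro p
    rw [← lintegral_finsetSum _ fun x _ => by fun_prop]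
    refine lintegral_congr_ae ?_
    filter_upwards [ae_disjoint 1 p] with q hq
    rw [ofPair_of_disjoint hq]
    refine Finset.sum_congr rfl fun x _ => ?_
    rw [ofPair_of_disjoint (p := ⟨p.pts \ {x}⟩) (hq.mono_left Finset.sdiff_subset)]
    rfl
  simp only [h1]
  exact lintegral_sum_pts (h := fun x p => ∫⁻ q, h (x, ofPair p q) ∂(lebesguePoisson d 1))
    (Measurable.lintegral_prod_right' (f := fun y : (E d × FinConf d) × FinConf d =>
      h (y.1.1, ofPair y.1.2 y.2)) (hh.comp (by fun_prop)))

lemma lintegral_sum_eraseMinus {h : E d × FinConf2 d → ℝ≥0∞} (hh : Measurable h) :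
    ∫⁻ η, ∑ y ∈ η.minus, h (y, η.eraseMinus y) ∂(lam2 d) =
      ∫⁻ p, h p ∂((pointMeasure d).prod (lam2 d)) := by
  have hm : Measurable fun η : FinConf2 d => ∑ x ∈ η.plus, h (x, (η.erasePlus x).swap) :=
    measurable_sum_plus measurable_id (f := fun η x => h (x, (η.erasePlus x).swap))
      (hh.comp (by fun_prop))
  have h1 := lintegral_sum_erasePlus (h := fun p => h (p.1, p.2.swap)) (hh.comp (by fun_prop))
  rw [← measurePreserving_swap.lintegral_comp hm,
    lintegral_prod _ (by fun_prop)] at h1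
  rw [lintegral_prod _ hh.aemeasurable]
  refine Eq.trans h1 (lintegral_congr fun x => ?_)
  exact measurePreserving_swap.lintegral_comp (f := fun ζ => h (x, ζ)) (hh.comp (by fun_prop))

/-- The intensity of the pairs `(y, η)`, `y ∈ η⁻`. -/
def flipMeasure (d : ℕ) : Measure (E d × FinConf2 d) :=
  ((pointMeasure d).prod (lam2 d)).map fun p => (p.1, p.2.flipToMinus p.1)

/-- By the Mecke formula, `x` and `η \ x` are distributed according to the product of `pointMeasure`
and `lam2`; inserting `x` in the minus component of `η \ x` gives the flip of `η`. -/
lemma isIntensity_flipToMinus :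
    IsIntensity (lam2 d) FinConf2.plus (fun η x => (x, η.flipToMinus x)) (flipMeasure d) := by
  refine ⟨fun h hh => measurable_sum_plus measurable_id (f := fun η x => h (x, η.flipToMinus x))
      (hh.comp (by fun_prop)), fun h hh => ?_⟩
  rw [flipMeasure, lintegral_map hh (by fun_prop), ← lintegral_sum_erasePlus (by fun_prop)]
  refine lintegral_congr fun η => Finset.sum_congr rfl fun x _ => ?_
  congr 2
  ext z <;> simp

lemma isIntensity_minus :
    IsIntensity (lam2 d) FinConf2.minus (fun η y => (y, η)) (flipMeasure d) := by
  refine ⟨fun h hh => measurable_sum_minus measurable_id (f := fun η y => h (y, η))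
      (hh.comp (by fun_prop)), fun h hh => ?_⟩
  rw [flipMeasure, lintegral_map hh (by fun_prop),
    ← lintegral_sum_eraseMinus (by fun_prop)]
  refine lintegral_congr fun η => Finset.sum_congr rfl fun y hy => ?_
  -- Since `y ∉ η⁺`, flipping `y` in `η \ y` removes nothing from the plus component and merely puts
  -- `y` back.
  have hy' := notMem_plus hy
  congr 2
  ext z
  · by_cases hz : z = y <;> simp_all
  · by_cases hz : z = y <;> simp_all

end TwoComponents

/-! ### Null sets -/

section NullSets

lemma erasePlus_eraseMinus_flip {ξ : FinConf2 d} {x : E d} (hx : x ∈ ξ.plus) :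
    (ξ.flipToMinus x).eraseMinus x = ξ.erasePlus x := by
  have := notMem_minus hx
  ext z <;> by_cases hz : z = x <;> simp_all

lemma size_flipToMinus {ξ : FinConf2 d} {x : E d} (hx : x ∈ ξ.plus) :
    (ξ.flipToMinus x).size = ξ.size := by
  have hx' := notMem_minus hx
  have h1 := Finset.card_sdiff_add_card_eq_card (Finset.singleton_subset_iff.2 hx)
  have h2 : (ξ.minus ∪ {x}).card = ξ.minus.card + ({x} : Finset (E d)).card :=
    Finset.card_union_of_disjoint (by simpa using hx')
  simp only [size, plus_flipToMinus, minus_flipToMinus]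
  omega

variable [Nonempty (Fin d)]

/-- In the representation by minus points the second coordinate is `η` itself, so null sets are
inherited. Combined with the representation by flipped plus points, this shows that flips preserve
null sets. -/
lemma ae_flipMeasure_snd {P : FinConf2 d → Prop} (hP : ∀ᵐ η ∂(lam2 d), P η) :
    ∀ᵐ z ∂(flipMeasure d), P z.2 := by
  have h0 : lam2 d (toMeasurable (lam2 d) {η | ¬ P η}) = 0 := by
    rw [measure_toMeasurable]; exact hP
  have hm := measurableSet_toMeasurable (lam2 d) {η | ¬ P η}
  have h1 : flipMeasure d (Prod.snd ⁻¹' toMeasurable (lam2 d) {η | ¬ P η}) = 0 := by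
    rw [← lintegral_indicator_one (measurable_snd hm), ← isIntensity_minus.lintegral _
      (measurable_one.indicator (measurable_snd hm))]
    refine lintegral_eq_zero_of_ae_eq_zero ?_
    filter_upwards [measure_eq_zero_iff_ae_notMem.1 h0] with η hη
    exact Finset.sum_eq_zero fun y _ => Set.indicator_of_notMem (by simpa using hη) _
  exact measure_mono_null (fun z hz => subset_toMeasurable (lam2 d) _ hz) h1

lemma ae_forall_flipToMinus {P : FinConf2 d → Prop} (hP : ∀ᵐ η ∂(lam2 d), P η) :
    ∀ᵐ η ∂(lam2 d), ∀ x ∈ η.plus, P (η.flipToMinus x) :=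
  isIntensity_flipToMinus.ae_forall (ae_flipMeasure_snd hP)

lemma ae_swap {P : FinConf2 d → Prop} (hP : ∀ᵐ η ∂(lam2 d), P η) :
    ∀ᵐ η ∂(lam2 d), P η.swap :=
  measurePreserving_swap.quasiMeasurePreserving.ae hP

lemma ae_forall_flipToPlus {P : FinConf2 d → Prop} (hP : ∀ᵐ η ∂(lam2 d), P η) :
    ∀ᵐ η ∂(lam2 d), ∀ y ∈ η.minus, P (η.flipToPlus y) := by
  have := ae_swap (ae_forall_flipToMinus (ae_swap hP))
  simpa using this

lemma ae_forall_subs {P : FinConf2 d → Prop} (hP : ∀ᵐ η ∂(lam2 d), P η) :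
    ∀ᵐ η ∂(lam2 d), ∀ ξ ∈ η.subs, P ξ :=
  isIntensity_subs.ae_forall (P := fun z => P z.1) (Measure.quasiMeasurePreserving_fst.ae hP)

/-- The explicit formula evaluates `G` only at sub-configurations and their flips, and almost surely
all of these avoid a given null set. -/
theorem hatL0_congr_ae (aP aM : E d → Conf2 d → ℝ) {G G' : FinConf2 d → ℝ}
    (h : G' =ᵐ[lam2 d] G) : hatL0 aP aM G' =ᵐ[lam2 d] hatL0 aP aM G := by
  filter_upwards [ae_forall_subs h, ae_forall_subs (ae_forall_flipToMinus h),
    ae_forall_subs (ae_forall_flipToPlus h)] with η h1 h2 h3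
  rw [hatL0_eq_hatL0Formula, hatL0_eq_hatL0Formula, hatL0Formula, hatL0Formula]
  congr 1
  · refine Finset.sum_congr rfl fun ξ hξ => Finset.sum_congr rfl fun x hx => ?_
    rw [h1 ξ hξ, h2 ξ hξ x hx]
  · refine Finset.sum_congr rfl fun ξ hξ => Finset.sum_congr rfl fun x hx => ?_
    rw [h1 ξ hξ, h3 ξ hξ x hx]

end NullSets

/-! ### Bounds in `𝓛_C` -/

/-- Joint measurability of a kernel. -/
def MeasurableKernel (B : E d → FinConf2 d → FinConf2 d → ℝ) : Prop :=
  Measurable fun p : (E d × FinConf2 d) × FinConf2 d => B p.1.1 p.1.2 p.2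

namespace MeasurableKernel

variable {B : E d → FinConf2 d → FinConf2 d → ℝ}

lemma comp (hB : MeasurableKernel B) {Y : Type*} [MeasurableSpace Y] {x : Y → E d}
    {ξ ζ : Y → FinConf2 d} (hx : Measurable x) (hξ : Measurable ξ) (hζ : Measurable ζ) :
    Measurable fun y => B (x y) (ξ y) (ζ y) :=
  Measurable.comp hB ((hx.prodMk hξ).prodMk hζ)

lemma swapRate (hB : MeasurableKernel B) : MeasurableKernel (swapRate B) :=
  hB.comp (by fun_prop) (by fun_prop) (by fun_prop)

lemma measurable_normL [Nonempty (Fin d)] (hB : MeasurableKernel B) (C : ℝ) {Y : Type*}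
    [MeasurableSpace Y] {x : Y → E d} {ξ : Y → FinConf2 d} (hx : Measurable x)
    (hξ : Measurable ξ) : Measurable fun y => normL C (B (x y) (ξ y)) := by
  have : Measurable fun q : E d × FinConf2 d => normL C (B q.1 q.2) :=
    Measurable.lintegral_prod_right'
      (f := fun p : (E d × FinConf2 d) × FinConf2 d => ‖B p.1.1 p.1.2 p.2‖ₑ)
      (Measurable.enorm hB)
  exact this.comp (hx.prodMk hξ)

lemma measurable_flipPart (hB : MeasurableKernel B) {G : FinConf2 d → ℝ} (hG : Measurable G) :
    Measurable (flipPart B G) := by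
  refine measurable_sum_subs measurable_id (f := fun η ξ => ∑ x ∈ ξ.plus,
    (G (ξ.flipToMinus x) - G ξ) * B x (ξ.erasePlus x) (η.diff ξ)) ?_
  refine measurable_sum_plus measurable_snd
    (f := fun (p : FinConf2 d × FinConf2 d) x => (G (p.2.flipToMinus x) - G p.2) *
      B x (p.2.erasePlus x) (p.1.diff p.2)) ?_
  exact (Measurable.sub (by fun_prop) (by fun_prop)).mul
    (hB.comp (by fun_prop) (by fun_prop) (by fun_prop))

end MeasurableKernel

lemma IsRate.measurableKernel {a : E d → Conf2 d → ℝ} (ha : IsRate a) :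
    MeasurableKernel (transformedRate a) := by
  refine measurable_sum_subs measurable_snd (f := fun (p : (E d × FinConf2 d) × FinConf2 d) ζ =>
    (-1 : ℝ) ^ (p.2.diff ζ).size * a p.1.1 (ζ.union p.1.2).toConf2) ?_
  refine Measurable.mul (by fun_prop) ?_
  exact ha.measurable.comp (f := fun p : ((E d × FinConf2 d) × FinConf2 d) × FinConf2 d =>
    (p.1.1.1, p.2.union p.1.1.2)) (by fun_prop)

/-- The sum of the `𝓛_C`-norms of the kernel `B` at the points of `η`. -/
def kernelNorm (B : E d → FinConf2 d → FinConf2 d → ℝ) (C : ℝ) (η : FinConf2 d) : ℝ≥0∞ :=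
  ∑ x ∈ η.plus, normL C (B x (η.erasePlus x)) + ∑ y ∈ η.minus, normL C (B y (η.eraseMinus y))

/-- The integrand majorizing `flipPart B G` for a pair `(ξ, ζ)` of configurations. -/
def flipMajorant (B : E d → FinConf2 d → FinConf2 d → ℝ) (G : FinConf2 d → ℝ)
    (p : FinConf2 d × FinConf2 d) : ℝ≥0∞ :=
  ∑ x ∈ p.1.plus, (‖G (p.1.flipToMinus x)‖ₑ + ‖G p.1‖ₑ) * ‖B x (p.1.erasePlus x) p.2‖ₑ

lemma enorm_flipPart_le (B : E d → FinConf2 d → FinConf2 d → ℝ) (G : FinConf2 d → ℝ)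
    (η : FinConf2 d) : ‖flipPart B G η‖ₑ ≤ ∑ ξ ∈ η.subs, flipMajorant B G (ξ, η.diff ξ) := by
  refine (enorm_sum_le _ _).trans (Finset.sum_le_sum fun ξ _ => ?_)
  refine (enorm_sum_le _ _).trans (Finset.sum_le_sum fun x _ => ?_)
  rw [enorm_mul]
  gcongr
  exact enorm_sub_le

section Bounds

variable {B : E d → FinConf2 d → FinConf2 d → ℝ}

lemma MeasurableKernel.measurable_flipMajorant (hB : MeasurableKernel B) {G : FinConf2 d → ℝ}
    (hG : Measurable G) : Measurable (flipMajorant B G) := by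
  refine measurable_sum_plus measurable_fst (f := fun (p : FinConf2 d × FinConf2 d) x =>
    (‖G (p.1.flipToMinus x)‖ₑ + ‖G p.1‖ₑ) * ‖B x (p.1.erasePlus x) p.2‖ₑ) ?_
  exact Measurable.mul (by fun_prop) (hB.comp (by fun_prop) (by fun_prop) (by fun_prop)).enorm

lemma measurable_hatL0Formula {aP aM : E d → Conf2 d → ℝ} (haP : IsRate aP) (haM : IsRate aM)
    {G : FinConf2 d → ℝ} (hG : Measurable G) : Measurable (hatL0Formula aP aM G) := by
  have h1 := haP.measurableKernel.measurable_flipPart hG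
  have h2 := haM.measurableKernel.swapRate.measurable_flipPart
    (G := fun ξ => G ξ.swap) (by fun_prop)
  simp only [funext (hatL0Formula_eq aP aM G)]
  fun_prop

lemma RateBound.kernelNorm_le {aP aM : E d → Conf2 d → ℝ} {C : ℝ} {N₀ : FinConf2 d → ℝ}
    (h : RateBound aP aM C N₀) : ∀ᵐ η ∂(lam2 d), kernelNorm (transformedRate aP) C η +
      kernelNorm (transformedRate aM) C η ≤ ENNReal.ofReal (N₀ η) := by
  filter_upwards [h] with η hη
  refine le_trans (le_of_eq ?_) hη
  rw [kernelNorm, kernelNorm, Finset.sum_add_distrib, Finset.sum_add_distrib]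
  ring

variable [Nonempty (Fin d)]

lemma normL_eq {C : ℝ} (hC : 0 ≤ C) (G : FinConf2 d → ℝ) :
    normL C G = ∫⁻ η, ENNReal.ofReal C ^ η.size * ‖G η‖ₑ ∂(lam2 d) :=
  lintegral_lebesguePoisson2_eq hC _

lemma normL_swap (C : ℝ) {G : FinConf2 d → ℝ} (hG : Measurable G) :
    normL C (fun η => G η.swap) = normL C G :=
  (measurePreserving_swap_lebesguePoisson2 C).lintegral_comp hG.enorm

/-- Integrating over `ζ` with weight `C^|ζ|` turns the kernel into its norm. The terms with
unflipped `G` give the plus sum of `kernelNorm`. The flipped terms, carried over by the flip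
symmetry, give the minus sum. -/
lemma lintegral_flipMajorant (hB : MeasurableKernel B) {G : FinConf2 d → ℝ} (hG : Measurable G)
    {C : ℝ} (hC : 0 ≤ C) :
    ∫⁻ p, ENNReal.ofReal C ^ (p.1.size + p.2.size) * flipMajorant B G p
      ∂((lam2 d).prod (lam2 d)) =
    ∫⁻ η, ENNReal.ofReal C ^ η.size * (‖G η‖ₑ * kernelNorm B C η) ∂(lam2 d) := by
  have hF := hB.measurable_flipMajorant hG
  have hΦ : Measurable fun z : E d × FinConf2 d => ENNReal.ofReal C ^ z.2.size *
      (‖G z.2‖ₑ * normL C (B z.1 (z.2.eraseMinus z.1))) :=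
    Measurable.mul (by fun_prop) (Measurable.mul (by fun_prop)
      (hB.measurable_normL C (by fun_prop) (by fun_prop)))
  rw [lintegral_prod _ (by fun_prop)]
  have h1 : ∀ ξ : FinConf2 d, ∫⁻ ζ, ENNReal.ofReal C ^ (ξ.size + ζ.size) *
      flipMajorant B G (ξ, ζ) ∂(lam2 d) =
      ∑ x ∈ ξ.plus, ENNReal.ofReal C ^ (ξ.flipToMinus x).size *
        (‖G (ξ.flipToMinus x)‖ₑ * normL C (B x ((ξ.flipToMinus x).eraseMinus x))) +
      ENNReal.ofReal C ^ ξ.size * (‖G ξ‖ₑ * ∑ x ∈ ξ.plus, normL C (B x (ξ.erasePlus x))) := by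
    intro ξ
    have hBx : ∀ x, Measurable fun ζ => ‖B x (ξ.erasePlus x) ζ‖ₑ := fun x =>
      (hB.comp (by fun_prop) (by fun_prop) (by fun_prop)).enorm
    have h2 : ∀ ζ : FinConf2 d, ENNReal.ofReal C ^ (ξ.size + ζ.size) * flipMajorant B G (ξ, ζ) =
        ∑ x ∈ ξ.plus, ENNReal.ofReal C ^ ξ.size * (‖G (ξ.flipToMinus x)‖ₑ + ‖G ξ‖ₑ) *
          (ENNReal.ofReal C ^ ζ.size * ‖B x (ξ.erasePlus x) ζ‖ₑ) := by
      intro ζ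
      rw [flipMajorant, Finset.mul_sum]
      refine Finset.sum_congr rfl fun x _ => ?_
      rw [pow_add]
      ring
    simp only [h2]
    rw [lintegral_finsetSum _ fun x _ => by have := hBx x; fun_prop, Finset.mul_sum, Finset.mul_sum,
      ← Finset.sum_add_distrib]
    refine Finset.sum_congr rfl fun x hx => ?_
    rw [lintegral_const_mul _ (by have := hBx x; fun_prop), ← normL_eq hC, size_flipToMinus hx,
      erasePlus_eraseMinus_flip hx]
    ring
  simp only [h1]
  have h3 := isIntensity_flipToMinus.lintegral _ hΦ
  rw [← isIntensity_minus.lintegral _ hΦ] at h3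
  rw [lintegral_add_left (isIntensity_flipToMinus.measurable _ hΦ), h3,
    ← lintegral_add_left (isIntensity_minus.measurable _ hΦ)]
  refine lintegral_congr fun η => ?_
  simp only
  rw [kernelNorm, ← Finset.mul_sum, ← Finset.mul_sum, mul_add, mul_add, add_comm]

/-- The triangle inequality bounds the left side by a sum over splittings of `η`; the weight factors
because `|ξ| + |η \ ξ| = |η|`, and the Minlos lemma applies. -/
lemma normL_flipPart_le (hB : MeasurableKernel B) {G : FinConf2 d → ℝ} (hG : Measurable G)
    {C : ℝ} (hC : 0 ≤ C) :
    normL C (flipPart B G) ≤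
      ∫⁻ η, ENNReal.ofReal C ^ η.size * (‖G η‖ₑ * kernelNorm B C η) ∂(lam2 d) := by
  have hF := hB.measurable_flipMajorant hG
  rw [normL_eq hC, ← lintegral_flipMajorant hB hG hC, ← isIntensity_subs.lintegral
    (fun p => ENNReal.ofReal C ^ (p.1.size + p.2.size) * flipMajorant B G p) (by fun_prop)]
  refine lintegral_mono fun η => ?_
  refine (mul_le_mul_right (enorm_flipPart_le B G η) _).trans ?_
  rw [Finset.mul_sum]
  refine Finset.sum_le_sum fun ξ hξ => ?_
  rw [← size_diff hξ, Nat.add_comm]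

lemma kernelNorm_swapRate (hB : MeasurableKernel B) (C : ℝ) (η : FinConf2 d) :
    kernelNorm (swapRate B) C η.swap = kernelNorm B C η := by
  have h : ∀ x ξ, normL C (swapRate B x ξ) = normL C (B x ξ.swap) := fun x ξ =>
    normL_swap C (G := B x ξ.swap) (hB.comp measurable_const measurable_const measurable_id)
  rw [kernelNorm, kernelNorm, add_comm]
  simp [h]

lemma lintegral_kernelNorm_swap (hB : MeasurableKernel B) {G : FinConf2 d → ℝ}
    (hG : Measurable G) (C : ℝ) :
    ∫⁻ η, ENNReal.ofReal C ^ η.size * (‖G η.swap‖ₑ * kernelNorm (swapRate B) C η) ∂(lam2 d) =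
      ∫⁻ η, ENNReal.ofReal C ^ η.size * (‖G η‖ₑ * kernelNorm B C η) ∂(lam2 d) := by
  have hn : Measurable fun η : FinConf2 d => kernelNorm (swapRate B) C η := by
    refine Measurable.add ?_ ?_
    · exact measurable_sum_plus measurable_id
        (f := fun η y => normL C (swapRate B y (η.erasePlus y)))
        (hB.swapRate.measurable_normL C (by fun_prop) (by fun_prop))
    · exact measurable_sum_minus measurable_id
        (f := fun η y => normL C (swapRate B y (η.eraseMinus y)))
        (hB.swapRate.measurable_normL C (by fun_prop) (by fun_prop))
  rw [← measurePreserving_swap.lintegral_comp (by fun_prop)]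
  simp [kernelNorm_swapRate hB]

lemma normL_hatL0Formula_le {aP aM : E d → Conf2 d → ℝ} (haP : IsRate aP) (haM : IsRate aM)
    {G : FinConf2 d → ℝ} (hG : Measurable G) {C : ℝ} (hC : 0 ≤ C) :
    normL C (hatL0Formula aP aM G) ≤ ∫⁻ η, ENNReal.ofReal C ^ η.size * (‖G η‖ₑ *
      (kernelNorm (transformedRate aP) C η + kernelNorm (transformedRate aM) C η)) ∂(lam2 d) := by
  have h1 := haP.measurableKernel.measurable_flipPart hG
  have h2 := haM.measurableKernel.swapRate.measurable_flipPart
    (G := fun ξ => G ξ.swap) (by fun_prop)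
  have hn : Measurable fun η : FinConf2 d => kernelNorm (transformedRate aP) C η := by
    refine Measurable.add ?_ ?_
    · exact measurable_sum_plus measurable_id
        (f := fun η y => normL C (transformedRate aP y (η.erasePlus y)))
        (haP.measurableKernel.measurable_normL C (by fun_prop) (by fun_prop))
    · exact measurable_sum_minus measurable_id
        (f := fun η y => normL C (transformedRate aP y (η.eraseMinus y)))
        (haP.measurableKernel.measurable_normL C (by fun_prop) (by fun_prop))
  calc normL C (hatL0Formula aP aM G)
      ≤ normL C (flipPart (transformedRate aP) G) + normL C (fun η =>
          flipPart (swapRate (transformedRate aM)) (fun ξ => G ξ.swap) η.swap) := by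
        unfold normL
        rw [← lintegral_add_left (by fun_prop)]
        refine lintegral_mono fun η => ?_
        rw [hatL0Formula_eq]
        exact enorm_add_le _ _
    _ ≤ ∫⁻ η, ENNReal.ofReal C ^ η.size * (‖G η‖ₑ * kernelNorm (transformedRate aP) C η) ∂(lam2 d) +
        ∫⁻ η, ENNReal.ofReal C ^ η.size * (‖G η‖ₑ * kernelNorm (transformedRate aM) C η)
          ∂(lam2 d) := by
        rw [normL_swap C h2, ← lintegral_kernelNorm_swap haM.measurableKernel hG]
        exact add_le_add (normL_flipPart_le haP.measurableKernel hG hC)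
          (normL_flipPart_le haM.measurableKernel.swapRate (by fun_prop) hC)
    _ = _ := by
        rw [← lintegral_add_left (by fun_prop)]
        refine lintegral_congr fun η => ?_
        rw [mul_add, mul_add]

theorem memL_hatL0 {aP aM : E d → Conf2 d → ℝ} (haP : IsRate aP) (haM : IsRate aM) {C : ℝ}
    (hC : 0 < C) {N₀ : FinConf2 d → ℝ} (hN : RateBound aP aM C N₀) {G : FinConf2 d → ℝ}
    (hG : MemL C G) (hNG : MemL C fun η => N₀ η * G η) : MemL C (hatL0 aP aM G) := by
  -- Pass to a measurable representative of `G`. For `C > 0` the measures with parameters `C` and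
  -- `1` have the same null sets.
  obtain ⟨G', hG', hGG'⟩ := hG.1.aemeasurable
  have hae : G' =ᵐ[lam2 d] G := ((ae_lebesguePoisson2_iff hC).1 hGG').mono fun _ h => h.symm
  have h1 : hatL0Formula aP aM G' =ᵐ[lebesguePoisson2 d C] hatL0 aP aM G := by
    refine (ae_lebesguePoisson2_iff hC).2 ?_
    filter_upwards [hatL0_congr_ae aP aM hae] with η hη
    rw [← hη, hatL0_eq_hatL0Formula]
  refine Integrable.congr ⟨(measurable_hatL0Formula haP haM hG').aestronglyMeasurable, ?_⟩ h1
  rw [hasFiniteIntegral_iff_enorm]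
  refine (normL_hatL0Formula_le haP haM hG' hC.le).trans_lt (lt_of_le_of_lt ?_ hNG.2)
  rw [lintegral_lebesguePoisson2_eq hC.le]
  refine lintegral_mono_ae ?_
  filter_upwards [hae, hN.kernelNorm_le] with η h2 h3
  gcongr
  rw [enorm_mul, mul_comm, h2]
  gcongr
  refine h3.trans ?_
  -- The comparison `N₀ ≤ |N₀|` avoids any appeal to the sign of `N₀`.
  rw [← ofReal_norm]
  exact ENNReal.ofReal_le_ofReal (le_abs_self _)

end Bounds

/-! ### Unions with a random configuration -/

/-- The converse of `IsIntensity.ae_forall`: if almost surely no point violates `P`, the intensity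
of the violating set is zero. -/
lemma IsIntensity.ae_of_ae_forall {Ω ι Z : Type*} [MeasurableSpace Ω] [MeasurableSpace Z]
    {μ : Measure Ω} {S : Ω → Finset ι} {T : Ω → ι → Z} {ν : Measure Z}
    (H : IsIntensity μ S T ν) {P : Z → Prop} (hP : MeasurableSet {z | P z})
    (h : ∀ᵐ ω ∂μ, ∀ i ∈ S ω, P (T ω i)) : ∀ᵐ z ∂ν, P z := by
  have h1 : ν {z | P z}ᶜ = 0 := by
    rw [← lintegral_indicator_one hP.compl, ← H.lintegral _ (measurable_one.indicator hP.compl)]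
    refine lintegral_eq_zero_of_ae_eq_zero ?_
    filter_upwards [h] with ω hω
    exact Finset.sum_eq_zero fun i hi => Set.indicator_of_notMem (s := {z | P z}ᶜ) (fun hn => hn (hω i hi)) _
  exact h1

section Union

variable [Nonempty (Fin d)]

/-- By the Minlos lemma, a property of `η = (η \ ξ) ∪ ξ` passes to the union of two independent
configurations. It allows `k` to be changed on a null set in the dual formula. -/
lemma ae_ae_union {P : FinConf2 d → Prop} (hP : ∀ᵐ η ∂(lam2 d), P η) :
    ∀ᵐ ξ ∂(lam2 d), ∀ᵐ ζ ∂(lam2 d), P (ζ.union ξ) := by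
  have h0 : lam2 d (toMeasurable (lam2 d) {η | ¬ P η}) = 0 := by
    rw [measure_toMeasurable]; exact hP
  have hm := (measurableSet_toMeasurable (lam2 d) {η | ¬ P η}).compl
  have : ∀ᵐ p ∂((lam2 d).prod (lam2 d)),
      p.2.union p.1 ∈ (toMeasurable (lam2 d) {η | ¬ P η})ᶜ := by
    refine isIntensity_subs.ae_of_ae_forall ?_ ?_
    · exact (measurable_snd.finConf2Union measurable_fst) hm
    · filter_upwards [measure_eq_zero_iff_ae_notMem.1 h0] with η hη ξ hξ
      rw [diff_union_cancel hξ]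
      exact hη
  filter_upwards [Measure.ae_ae_of_ae_prod this] with ξ hξ
  filter_upwards [hξ] with ζ hζ
  by_contra hn
  exact hζ (subset_toMeasurable _ _ hn)

/-- Almost all configurations do not intersect `ξ`. -/
def SizeUnion (ξ : FinConf2 d) : Prop :=
  ∀ᵐ ζ ∂(lam2 d), (ζ.union ξ).size = ζ.size + ξ.size

/-- For the pieces `ξ` and `η \ ξ` of a configuration the sizes add up exactly, and the Minlos lemma
transfers this to independent pairs. -/
lemma ae_prod_size_union : ∀ᵐ p ∂((lam2 d).prod (lam2 d)),
    (p.2.union p.1).size = p.2.size + p.1.size := by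
  refine isIntensity_subs.ae_of_ae_forall ?_ (Eventually.of_forall fun η ξ hξ => ?_)
  · exact measurableSet_eq_fun (by fun_prop) (by fun_prop)
  · rw [diff_union_cancel hξ, size_diff hξ]

lemma ae_sizeUnion : ∀ᵐ ξ ∂(lam2 d), SizeUnion ξ :=
  Measure.ae_ae_of_ae_prod ae_prod_size_union

/-- The bound on `k` splits as `c^|ζ| c^|ξ|`; the first factor becomes the weight in the norm of
`β`. -/
lemma lintegral_union_le {k : FinConf2 d → ℝ} {b : ℝ≥0∞} {c : ℝ} (hc : 0 ≤ c) (hb : b ≠ ∞)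
    (hk : ∀ η, ‖k η‖ₑ ≤ b * ENNReal.ofReal c ^ η.size) {ξ : FinConf2 d} (hξ : SizeUnion ξ)
    (β : FinConf2 d → ℝ) :
    ∫⁻ ζ, ‖k (ζ.union ξ) * β ζ‖ₑ ∂(lam2 d) ≤
      b * ENNReal.ofReal c ^ ξ.size * normL c β := by
  rw [normL_eq hc, ← lintegral_const_mul' _ _
    (ENNReal.mul_ne_top hb (ENNReal.pow_ne_top ENNReal.ofReal_ne_top))]
  refine lintegral_mono_ae ?_
  filter_upwards [hξ] with ζ hζ
  rw [enorm_mul]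
  refine (mul_le_mul_left (hk _) _).trans (le_of_eq ?_)
  rw [hζ, pow_add]
  ring

lemma MeasurableKernel.measurable_integral_union {B : E d → FinConf2 d → FinConf2 d → ℝ}
    (hB : MeasurableKernel B) {k : FinConf2 d → ℝ} (hk : Measurable k) {Y : Type*}
    [MeasurableSpace Y] {x : Y → E d} {u v : Y → FinConf2 d} (hx : Measurable x)
    (hu : Measurable u) (hv : Measurable v) :
    Measurable fun y => ∫ ζ, k (ζ.union (u y)) * B (x y) (v y) ζ ∂(lam2 d) := by
  have : Measurable fun p : Y × FinConf2 d => k (p.2.union (u p.1)) * B (x p.1) (v p.1) p.2 :=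
    Measurable.mul (by fun_prop) (hB.comp (by fun_prop) (by fun_prop) (by fun_prop))
  exact this.stronglyMeasurable.integral_prod_right'.measurable

end Union

/-! ### The dual operator -/

/-- The part of `L̂₀* k` that is dual to `flipPart B`. -/
def dualPart (B : E d → FinConf2 d → FinConf2 d → ℝ) (k : FinConf2 d → ℝ) (η : FinConf2 d) : ℝ :=
  (∑ y ∈ η.minus, ∫ ξ, k (ξ.union (η.flipToPlus y)) * B y (η.eraseMinus y) ξ ∂(lam2 d)) -
    ∑ x ∈ η.plus, ∫ ξ, k (ξ.union η) * B x (η.erasePlus x) ξ ∂(lam2 d)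

section Dual

variable {B : E d → FinConf2 d → FinConf2 d → ℝ}

lemma size_flipToPlus {η : FinConf2 d} {y : E d} (hy : y ∈ η.minus) :
    (η.flipToPlus y).size = η.size := by
  have h := size_flipToMinus (ξ := η.swap) (x := y) hy
  rwa [flipToMinus_swap, size_swap, size_swap] at h

lemma normL_lt_top_of_mem_plus {c : ℝ} {η : FinConf2 d}
    (h : kernelNorm B c η < ∞) {x : E d}
    (hx : x ∈ η.plus) : normL c (B x (η.erasePlus x)) < ∞ :=
  ENNReal.sum_lt_top.1 (ENNReal.add_lt_top.1 h).1 x hx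

lemma normL_lt_top_of_mem_minus {c : ℝ} {η : FinConf2 d}
    (h : kernelNorm B c η < ∞) {y : E d}
    (hy : y ∈ η.minus) : normL c (B y (η.eraseMinus y)) < ∞ :=
  ENNReal.sum_lt_top.1 (ENNReal.add_lt_top.1 h).2 y hy

/-- The integrand of `∫ (flipPart B G) k dλ²` for a pair `(ξ, ζ)` of configurations. -/
def flipIntegrand (B : E d → FinConf2 d → FinConf2 d → ℝ) (G k : FinConf2 d → ℝ)
    (p : FinConf2 d × FinConf2 d) : ℝ :=
  (∑ x ∈ p.1.plus, (G (p.1.flipToMinus x) - G p.1) * B x (p.1.erasePlus x) p.2) *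
    k (p.2.union p.1)

lemma sum_flipIntegrand (G k : FinConf2 d → ℝ) (η : FinConf2 d) :
    ∑ ξ ∈ η.subs, flipIntegrand B G k (ξ, η.diff ξ) = flipPart B G η * k η := by
  rw [flipPart, Finset.sum_mul]
  refine Finset.sum_congr rfl fun ξ hξ => ?_
  rw [flipIntegrand, diff_union_cancel hξ]

lemma measurable_flipIntegrand (hB : MeasurableKernel B) {G k : FinConf2 d → ℝ}
    (hG : Measurable G) (hk : Measurable k) : Measurable (flipIntegrand B G k) := by
  refine Measurable.mul ?_ (by fun_prop)
  refine measurable_sum_plus measurable_fst (f := fun (p : FinConf2 d × FinConf2 d) x =>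
    (G (p.1.flipToMinus x) - G p.1) * B x (p.1.erasePlus x) p.2) ?_
  exact (Measurable.sub (by fun_prop) (by fun_prop)).mul
    (hB.comp (by fun_prop) (by fun_prop) (by fun_prop))

variable [Nonempty (Fin d)]

lemma integral_swap (f : FinConf2 d → ℝ) : ∫ ξ, f ξ.swap ∂(lam2 d) = ∫ ξ, f ξ ∂(lam2 d) :=
  measurePreserving_swap.integral_comp
    ((MeasurableEquiv.mk ⟨FinConf2.swap, FinConf2.swap, swap_swap, swap_swap⟩
      measurable_id.finConf2Swap measurable_id.finConf2Swap).measurableEmbedding) f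

lemma integrable_swap_iff {f : FinConf2 d → ℝ} :
    Integrable (fun ξ => f ξ.swap) (lam2 d) ↔ Integrable f (lam2 d) :=
  measurePreserving_swap.integrable_comp_emb
    ((MeasurableEquiv.mk ⟨FinConf2.swap, FinConf2.swap, swap_swap, swap_swap⟩
      measurable_id.finConf2Swap measurable_id.finConf2Swap).measurableEmbedding)

lemma hatL0DualFormula_eq (aP aM : E d → Conf2 d → ℝ) (k : FinConf2 d → ℝ) (η : FinConf2 d) :
    hatL0DualFormula aP aM k η = dualPart (transformedRate aP) k η +
      dualPart (swapRate (transformedRate aM)) (fun ξ => k ξ.swap) η.swap := by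
  have h1 : ∀ x, ∫ ξ, k (ξ.union (η.flipToMinus x)) * transformedRate aM x (η.erasePlus x) ξ
      ∂(lam2 d) = ∫ ξ, k (ξ.union (η.swap.flipToPlus x)).swap *
        swapRate (transformedRate aM) x (η.swap.eraseMinus x) ξ ∂(lam2 d) := fun x => by
    rw [← integral_swap]
    refine integral_congr_ae (Eventually.of_forall fun ξ => ?_)
    simp only
    rw [flipToPlus_swap, ← union_swap]
    rfl
  have h2 : ∀ x, ∫ ξ, k (ξ.union η) * transformedRate aM x (η.eraseMinus x) ξ
      ∂(lam2 d) = ∫ ξ, k (ξ.union η.swap).swap *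
        swapRate (transformedRate aM) x (η.swap.erasePlus x) ξ ∂(lam2 d) := fun x => by
    rw [← integral_swap]
    refine integral_congr_ae (Eventually.of_forall fun ξ => ?_)
    simp only
    rw [← union_swap]
    rfl
  rw [hatL0DualFormula, dualPart, dualPart, minus_swap, plus_swap]
  simp only [h1, h2]
  ring

lemma MeasurableKernel.measurable_dualPart (hB : MeasurableKernel B) {k : FinConf2 d → ℝ}
    (hk : Measurable k) : Measurable (dualPart B k) := by
  refine Measurable.sub ?_ ?_
  · exact measurable_sum_minus measurable_id (f := fun η y =>
      ∫ ξ, k (ξ.union (η.flipToPlus y)) * B y (η.eraseMinus y) ξ ∂(lam2 d))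
      (hB.measurable_integral_union hk (by fun_prop) (by fun_prop) (by fun_prop))
  · exact measurable_sum_plus measurable_id (f := fun η x =>
      ∫ ξ, k (ξ.union η) * B x (η.erasePlus x) ξ ∂(lam2 d))
      (hB.measurable_integral_union hk (by fun_prop) (by fun_prop) (by fun_prop))

lemma measurable_hatL0DualFormula {aP aM : E d → Conf2 d → ℝ} (haP : IsRate aP) (haM : IsRate aM)
    {k : FinConf2 d → ℝ} (hk : Measurable k) : Measurable (hatL0DualFormula aP aM k) := by
  have h1 := haP.measurableKernel.measurable_dualPart hk
  have h2 := haM.measurableKernel.swapRate.measurable_dualPart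
    (k := fun ξ => k ξ.swap) (by fun_prop)
  simp only [funext (hatL0DualFormula_eq aP aM k)]
  fun_prop

variable {k : FinConf2 d → ℝ} {b : ℝ≥0∞} {c : ℝ}

lemma lintegral_union_flip_le (hc : 0 ≤ c) (hb : b ≠ ∞)
    (hk : ∀ η, ‖k η‖ₑ ≤ b * ENNReal.ofReal c ^ η.size) {η : FinConf2 d} {y : E d}
    (hy : y ∈ η.minus) (hη : SizeUnion (η.flipToPlus y)) (β : FinConf2 d → ℝ) :
    ∫⁻ ζ, ‖k (ζ.union (η.flipToPlus y)) * β ζ‖ₑ ∂(lam2 d) ≤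
      b * ENNReal.ofReal c ^ η.size * normL c β := by
  have := lintegral_union_le hc hb hk hη β
  rwa [size_flipToPlus hy] at this

lemma MeasurableKernel.integrable_union (hB : MeasurableKernel B) (hkm : Measurable k)
    (hc : 0 ≤ c) (hb : b ≠ ∞) (hk : ∀ η, ‖k η‖ₑ ≤ b * ENNReal.ofReal c ^ η.size)
    {ξ ρ : FinConf2 d} {x : E d} (hξ : SizeUnion ξ) (hn : normL c (B x ρ) < ∞) :
    Integrable (fun ζ => k (ζ.union ξ) * B x ρ ζ) (lam2 d) := by
  have hβ : Measurable (B x ρ) := hB.comp measurable_const measurable_const measurable_id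
  refine ⟨Measurable.aestronglyMeasurable (by fun_prop), ?_⟩
  rw [hasFiniteIntegral_iff_enorm]
  exact (lintegral_union_le hc hb hk hξ _).trans_lt (ENNReal.mul_lt_top
    (ENNReal.mul_lt_top hb.lt_top (ENNReal.pow_lt_top ENNReal.ofReal_lt_top)) hn)

lemma sum_minus_enorm_integral_le (hc : 0 ≤ c) (hb : b ≠ ∞)
    (hk : ∀ η, ‖k η‖ₑ ≤ b * ENNReal.ofReal c ^ η.size) {η : FinConf2 d}
    (hη : ∀ y ∈ η.minus, SizeUnion (η.flipToPlus y)) :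
    ∑ y ∈ η.minus, ‖∫ ξ, k (ξ.union (η.flipToPlus y)) * B y (η.eraseMinus y) ξ ∂(lam2 d)‖ₑ ≤
      b * ENNReal.ofReal c ^ η.size * ∑ y ∈ η.minus, normL c (B y (η.eraseMinus y)) := by
  rw [Finset.mul_sum]
  exact Finset.sum_le_sum fun y hy => (enorm_integral_le_lintegral_enorm _).trans
    (lintegral_union_flip_le hc hb hk hy (hη y hy) _)

lemma sum_plus_enorm_integral_le (hc : 0 ≤ c) (hb : b ≠ ∞)
    (hk : ∀ η, ‖k η‖ₑ ≤ b * ENNReal.ofReal c ^ η.size) {η : FinConf2 d} (hη : SizeUnion η) :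
    ∑ x ∈ η.plus, ‖∫ ξ, k (ξ.union η) * B x (η.erasePlus x) ξ ∂(lam2 d)‖ₑ ≤
      b * ENNReal.ofReal c ^ η.size * ∑ x ∈ η.plus, normL c (B x (η.erasePlus x)) := by
  rw [Finset.mul_sum]
  exact Finset.sum_le_sum fun x _ => (enorm_integral_le_lintegral_enorm _).trans
    (lintegral_union_le hc hb hk hη _)

lemma enorm_dualPart_le (hc : 0 ≤ c) (hb : b ≠ ∞)
    (hk : ∀ η, ‖k η‖ₑ ≤ b * ENNReal.ofReal c ^ η.size) :
    ∀ᵐ η ∂(lam2 d), ‖dualPart B k η‖ₑ ≤ b * ENNReal.ofReal c ^ η.size * kernelNorm B c η := by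
  filter_upwards [ae_sizeUnion, ae_forall_flipToPlus ae_sizeUnion] with η h1 h2
  rw [dualPart, kernelNorm, mul_add, add_comm (b * _ * _)]
  exact enorm_sub_le.trans (add_le_add
    ((enorm_sum_le _ _).trans (sum_minus_enorm_integral_le hc hb hk h2))
    ((enorm_sum_le _ _).trans (sum_plus_enorm_integral_le hc hb hk h1)))

lemma integrable_flipIntegrand (hB : MeasurableKernel B) {G : FinConf2 d → ℝ}
    (hG : Measurable G) (hkm : Measurable k) (hc : 0 ≤ c) (hb : b ≠ ∞)
    (hk : ∀ η, ‖k η‖ₑ ≤ b * ENNReal.ofReal c ^ η.size)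
    (hfin : ∫⁻ η, ENNReal.ofReal c ^ η.size * (‖G η‖ₑ * kernelNorm B c η) ∂(lam2 d) < ∞) :
    Integrable (flipIntegrand B G k) ((lam2 d).prod (lam2 d)) := by
  refine ⟨(measurable_flipIntegrand hB hG hkm).aestronglyMeasurable, ?_⟩
  rw [hasFiniteIntegral_iff_enorm]
  refine lt_of_le_of_lt ?_ (ENNReal.mul_lt_top hb.lt_top hfin)
  rw [← lintegral_flipMajorant hB hG hc, ← lintegral_const_mul' _ _ hb]
  refine lintegral_mono_ae ?_
  filter_upwards [ae_prod_size_union] with p hp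
  rw [flipIntegrand, enorm_mul]
  calc _ ≤ flipMajorant B G p * (b * ENNReal.ofReal c ^ (p.2.union p.1).size) := by
        refine mul_le_mul' ((enorm_sum_le _ _).trans (Finset.sum_le_sum fun x _ => ?_)) (hk _)
        rw [enorm_mul]
        gcongr
        exact enorm_sub_le
    _ = _ := by
        rw [hp, Nat.add_comm]
        ring

/-- As `k` is evaluated at the union of the pieces, the Minlos lemma unfolds the left side into a
double integral. Integrating over `ζ` first leaves a sum over the plus points of `ξ`. The terms
containing the flipped `G` are then moved to minus points by the flip symmetry. -/
lemma integral_flipPart_mul (hB : MeasurableKernel B) {G : FinConf2 d → ℝ}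
    (hG : Measurable G) (hkm : Measurable k) (hc : 0 ≤ c) (hb : b ≠ ∞)
    (hk : ∀ η, ‖k η‖ₑ ≤ b * ENNReal.ofReal c ^ η.size)
    (hBn : ∀ᵐ η ∂(lam2 d), kernelNorm B c η < ∞)
    (hfin : ∫⁻ η, ENNReal.ofReal c ^ η.size * (‖G η‖ₑ * kernelNorm B c η) ∂(lam2 d) < ∞) :
    Integrable (fun η => flipPart B G η * k η) (lam2 d) ∧
    Integrable (fun η => G η * dualPart B k η) (lam2 d) ∧
    ∫ η, flipPart B G η * k η ∂(lam2 d) = ∫ η, G η * dualPart B k η ∂(lam2 d) := by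
  have hI := integrable_flipIntegrand hB hG hkm hc hb hk hfin
  have hm := measurable_flipIntegrand hB hG hkm
  have h1 := isIntensity_subs.integrable hm hI
  have h2 := isIntensity_subs.integral hm hI
  simp only [sum_flipIntegrand] at h1 h2
  refine ⟨h1, ?_⟩
  have hbfin : ∫⁻ η, ‖G η‖ₑ * (b * ENNReal.ofReal c ^ η.size * kernelNorm B c η) ∂(lam2 d) < ∞ := by
    refine lt_of_eq_of_lt ?_ (ENNReal.mul_lt_top hb.lt_top hfin)
    rw [← lintegral_const_mul' _ _ hb]
    refine lintegral_congr fun η => ?_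
    ring
  -- At `(y, η)` with `y ∈ η⁻` this is the gain term of the dual; at `(x, ξ.flipToMinus x)` it is
  -- the term of the double integral with flipped `G`.
  let f₂ : E d × FinConf2 d → ℝ := fun z => G z.2 *
    ∫ ζ, k (ζ.union (z.2.flipToPlus z.1)) * B z.1 (z.2.eraseMinus z.1) ζ ∂(lam2 d)
  have hf₂ : Measurable f₂ := Measurable.mul (by fun_prop)
    (hB.measurable_integral_union hkm (by fun_prop) (by fun_prop) (by fun_prop))
  have hf₂i : Integrable f₂ (flipMeasure d) := by
    refine ⟨hf₂.aestronglyMeasurable, ?_⟩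
    rw [hasFiniteIntegral_iff_enorm, ← isIntensity_minus.lintegral _ hf₂.enorm]
    refine lt_of_le_of_lt (lintegral_mono_ae ?_) hbfin
    filter_upwards [ae_forall_flipToPlus ae_sizeUnion] with η hη
    simp only [f₂, enorm_mul]
    rw [← Finset.mul_sum]
    gcongr
    refine (sum_minus_enorm_integral_le hc hb hk hη).trans ?_
    gcongr
    exact le_add_self
  let f₃ : FinConf2 d → ℝ := fun η => G η *
    ∑ x ∈ η.plus, ∫ ζ, k (ζ.union η) * B x (η.erasePlus x) ζ ∂(lam2 d)
  have hf₃ : Measurable f₃ := Measurable.mul hG (measurable_sum_plus measurable_id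
    (f := fun η x => ∫ ζ, k (ζ.union η) * B x (η.erasePlus x) ζ ∂(lam2 d))
    (hB.measurable_integral_union hkm (by fun_prop) (by fun_prop) (by fun_prop)))
  have hf₃i : Integrable f₃ (lam2 d) := by
    refine ⟨hf₃.aestronglyMeasurable, ?_⟩
    rw [hasFiniteIntegral_iff_enorm]
    refine lt_of_le_of_lt (lintegral_mono_ae ?_) hbfin
    filter_upwards [ae_sizeUnion] with η hη
    simp only [f₃, enorm_mul]
    gcongr
    refine (enorm_sum_le _ _).trans ((sum_plus_enorm_integral_le hc hb hk hη).trans ?_)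
    gcongr
    exact le_self_add
  have h4 := isIntensity_minus.integrable hf₂ hf₂i
  have h5 : (fun η => G η * dualPart B k η) = fun η => ∑ y ∈ η.minus, f₂ (y, η) - f₃ η := by
    funext η
    simp only [f₂, f₃]
    rw [← Finset.mul_sum, ← mul_sub, dualPart]
  rw [h5]
  refine ⟨h4.sub hf₃i, ?_⟩
  rw [integral_sub h4 hf₃i, isIntensity_minus.integral hf₂ hf₂i,
    ← isIntensity_flipToMinus.integral hf₂ hf₂i,
    ← integral_sub (isIntensity_flipToMinus.integrable hf₂ hf₂i) hf₃i, h2, integral_prod _ hI]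
  refine integral_congr_ae ?_
  filter_upwards [ae_sizeUnion, hBn] with ξ h6 h7
  have h8 : ∀ ζ, flipIntegrand B G k (ξ, ζ) = ∑ x ∈ ξ.plus, (G (ξ.flipToMinus x) - G ξ) *
      (k (ζ.union ξ) * B x (ξ.erasePlus x) ζ) := fun ζ => by
    rw [flipIntegrand, Finset.sum_mul]
    refine Finset.sum_congr rfl fun x _ => ?_
    ring
  simp only [h8]
  rw [integral_finsetSum _ fun x hx => (hB.integrable_union hkm hc hb hk h6
    (normL_lt_top_of_mem_plus h7 hx)).const_mul _]
  simp only [f₃]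
  rw [Finset.mul_sum, ← Finset.sum_sub_distrib]
  refine Finset.sum_congr rfl fun x hx => ?_
  simp only [f₂]
  rw [integral_const_mul, erasePlus_eraseMinus_flip hx, flipToPlus_flipToMinus hx]
  ring

end Dual

/-! ### Finiteness on bounded sets -/

section Bounded

lemma measurableSet_subsets {Λ : Set (E d)} (hΛ : MeasurableSet Λ) :
    MeasurableSet {η : FinConf2 d | (η.plus : Set (E d)) ⊆ Λ ∧ (η.minus : Set (E d)) ⊆ Λ} :=
  (FinConf.measurableSet_subset (measurable_id.plusConf) hΛ).inter
    (FinConf.measurableSet_subset (measurable_id.minusConf) hΛ)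

variable [Nonempty (Fin d)]

/-- The `n`-th sector has mass at most `(|z| vol Λ)^n / n!`, so the total is dominated by an
exponential series. The absolute value accounts for a possibly negative `z`. -/
lemma lebesguePoisson_subset_lt_top {z : ℝ} {Λ : Set (E d)} (hΛ : MeasurableSet Λ)
    (hb : Bornology.IsBounded Λ) : lebesguePoisson d z {η | (η.pts : Set (E d)) ⊆ Λ} < ∞ := by
  have hm : MeasurableSet {η : FinConf d | (η.pts : Set (E d)) ⊆ Λ} :=
    FinConf.measurableSet_subset measurable_id hΛ
  have hv : volume Λ ≠ ∞ := hb.measure_lt_top.ne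
  rw [← lintegral_indicator_one hm, lintegral_lebesguePoisson z (measurable_one.indicator hm)]
  have h1 : ∀ n : ℕ, ENNReal.ofReal (z ^ n / n.factorial) *
      ∫⁻ x : Fin n → E d, {η : FinConf d | (η.pts : Set (E d)) ⊆ Λ}.indicator 1
        (FinConf.ofFamily x) ≤ ENNReal.ofReal ((|z| * (volume Λ).toReal) ^ n / n.factorial) := by
    intro n
    have h2 : ∫⁻ x : Fin n → E d, {η : FinConf d | (η.pts : Set (E d)) ⊆ Λ}.indicator 1
        (FinConf.ofFamily x) = volume Λ ^ n := by
      have : (fun x : Fin n → E d => {η : FinConf d | (η.pts : Set (E d)) ⊆ Λ}.indicator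
          (1 : FinConf d → ℝ≥0∞) (FinConf.ofFamily x)) =
          (Set.univ.pi fun _ : Fin n => Λ).indicator 1 := by
        funext x
        have hx : ((FinConf.ofFamily x).pts : Set (E d)) ⊆ Λ ↔ x ∈ Set.univ.pi fun _ => Λ := by
          simp [FinConf.ofFamily, Set.range_subset_iff]
        by_cases h : x ∈ Set.univ.pi fun _ => Λ
        · rw [Set.indicator_of_mem h, Set.indicator_of_mem (hx.2 h)]; rfl
        · rw [Set.indicator_of_notMem h, Set.indicator_of_notMem (fun h' => h (hx.1 h'))]
      rw [this, lintegral_indicator_one (MeasurableSet.univ_pi fun _ => hΛ), volume_pi_pi]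
      simp
    rw [h2, mul_pow, mul_div_right_comm, ENNReal.ofReal_mul (by positivity),
      ENNReal.ofReal_pow ENNReal.toReal_nonneg, ENNReal.ofReal_toReal hv]
    refine mul_le_mul_left (ENNReal.ofReal_le_ofReal
      (div_le_div_of_nonneg_right ?_ (by positivity))) _
    rw [← abs_pow]
    exact le_abs_self _
  refine lt_of_le_of_lt (ENNReal.tsum_le_tsum h1) ?_
  exact (Real.summable_pow_div_factorial _).tsum_ofReal_lt_top

lemma lebesguePoisson2_subset_lt_top {z : ℝ} {Λ : Set (E d)} (hΛ : MeasurableSet Λ)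
    (hb : Bornology.IsBounded Λ) : lebesguePoisson2 d z
      {η | (η.plus : Set (E d)) ⊆ Λ ∧ (η.minus : Set (E d)) ⊆ Λ} < ∞ := by
  have hE : MeasurableEmbedding (Subtype.val : FinConf2 d → FinConf d × FinConf d) :=
    MeasurableEmbedding.subtype_coe measurableSet_disjointPairs
  have h := lebesguePoisson_subset_lt_top (z := z) hΛ hb
  rw [lebesguePoisson2, hE.comap_apply]
  refine lt_of_le_of_lt (measure_mono (t := {η : FinConf d | (η.pts : Set (E d)) ⊆ Λ} ×ˢ
    {η : FinConf d | (η.pts : Set (E d)) ⊆ Λ}) ?_) ?_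
  · rintro _ ⟨η, hη, rfl⟩
    exact hη
  · rw [Measure.prod_prod]
    exact ENNReal.mul_lt_top h h

/-- For `G ∈ B_bs`, the function `G φ` is in `𝓛_z` if `φ` is bounded by a function of the size. -/
lemma IsBbs.lintegral_lt_top {G : FinConf2 d → ℝ} (hG : IsBbs G) {z : ℝ} (hz : 0 ≤ z)
    {φ : FinConf2 d → ℝ≥0∞} {g : ℕ → ℝ} (hg : Monotone g)
    (hφ : ∀ᵐ η ∂(lam2 d), φ η ≤ ENNReal.ofReal (g η.size)) :
    ∫⁻ η, ENNReal.ofReal z ^ η.size * (‖G η‖ₑ * φ η) ∂(lam2 d) < ∞ := by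
  obtain ⟨-, ⟨K, hK⟩, Np, Nm, Λp, Λm, hp, hpm, hm, hmm, hsupp⟩ := hG
  have hΛ := hpm.union hmm
  have hfin := lebesguePoisson2_subset_lt_top (z := z) hΛ (hp.union hm)
  let S := {η : FinConf2 d | (η.plus : Set (E d)) ⊆ Λp ∪ Λm ∧ (η.minus : Set (E d)) ⊆ Λp ∪ Λm}
  have hSm : MeasurableSet S := measurableSet_subsets hΛ
  rw [← lintegral_indicator_one hSm, lintegral_lebesguePoisson2_eq hz] at hfin
  have hfin' := ENNReal.mul_lt_top (ENNReal.mul_lt_top (ENNReal.ofReal_lt_top (r := K))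
    (ENNReal.ofReal_lt_top (r := g (Np + Nm)))) hfin
  rw [← lintegral_const_mul' _ _ (ENNReal.mul_ne_top ENNReal.ofReal_ne_top
    ENNReal.ofReal_ne_top)] at hfin'
  refine lt_of_le_of_lt (lintegral_mono_ae ?_) hfin'
  filter_upwards [hφ] with η hη
  by_cases h0 : G η = 0
  · simp [h0]
  · obtain ⟨h1, h2, h3, h4⟩ := hsupp η h0
    have hηS : η ∈ S := ⟨h2.trans Set.subset_union_left, h4.trans Set.subset_union_right⟩
    rw [Set.indicator_of_mem hηS, Pi.one_apply, mul_one, mul_comm]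
    gcongr
    · rw [← ofReal_norm]
      exact ENNReal.ofReal_le_ofReal (hK η)
    · exact hη.trans (ENNReal.ofReal_le_ofReal (hg (Nat.add_le_add h1 h3)))

end Bounded

/-! ### The dual operator on `𝓚_{αC}` -/

/-- Almost everywhere modification to a measurable function with a bound that holds everywhere. -/
lemma MemK.exists_measurable {c : ℝ} (hc : 0 < c) {k : FinConf2 d → ℝ} (hk : MemK c k) :
    ∃ (k' : FinConf2 d → ℝ) (b : ℝ), Measurable k' ∧ 0 ≤ b ∧
      (∀ η, ‖k' η‖ₑ ≤ ENNReal.ofReal b * ENNReal.ofReal c ^ η.size) ∧ k' =ᵐ[lam2 d] k := by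
  obtain ⟨f, hf, hkf⟩ := hk.1.aemeasurable
  have hb : ∀ᵐ η ∂(lam2 d), ‖k η * (c ^ η.size)⁻¹‖ₑ ≤
      eLpNormEssSup (fun η => k η * (c ^ η.size)⁻¹) (lam2 d) := enorm_ae_le_eLpNormEssSup _ _
  have hfin : eLpNormEssSup (fun η => k η * (c ^ η.size)⁻¹) (lam2 d) ≠ ∞ := by
    have := hk.2.ne
    rwa [eLpNorm_exponent_top] at this
  set b := eLpNormEssSup (fun η => k η * (c ^ η.size)⁻¹) (lam2 d)
  have hS : MeasurableSet {η : FinConf2 d | ‖f η‖ₑ ≤ b} := measurableSet_le hf.enorm measurable_const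
  -- The rescaled function is set to zero where it exceeds its essential supremum, a null event, and
  -- the factor `c^|η|` is restored. The bound then holds at every point.
  refine ⟨fun η => {η : FinConf2 d | ‖f η‖ₑ ≤ b}.indicator f η * c ^ η.size, b.toReal, ?_,
    ENNReal.toReal_nonneg, fun η => ?_, ?_⟩
  · exact (hf.indicator hS).mul (by fun_prop)
  · rw [enorm_mul, ENNReal.ofReal_toReal hfin, enorm_pow, Real.enorm_of_nonneg hc.le]
    gcongr
    by_cases h : ‖f η‖ₑ ≤ b
    · rw [Set.indicator_of_mem (s := {η : FinConf2 d | ‖f η‖ₑ ≤ b}) h]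
      exact h
    · rw [Set.indicator_of_notMem (s := {η : FinConf2 d | ‖f η‖ₑ ≤ b}) h]
      simp
  · filter_upwards [hkf, hb] with η h1 h2
    rw [h1] at h2
    rw [Set.indicator_of_mem (s := {η : FinConf2 d | ‖f η‖ₑ ≤ b}) h2, ← h1, mul_assoc,
      inv_mul_cancel₀ (pow_pos hc _).ne', mul_one]

lemma isBbs_indicator {R : ℕ} {t : Set (FinConf2 d)} (ht : MeasurableSet t) :
    IsBbs (({η : FinConf2 d | η.plus.card ≤ R ∧ η.minus.card ≤ R ∧
      ((η.plus : Set (E d)) ⊆ Metric.ball 0 R ∧ (η.minus : Set (E d)) ⊆ Metric.ball 0 R)} ∩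
        t).indicator fun _ => (1 : ℝ)) := by
  have hS : MeasurableSet {η : FinConf2 d | η.plus.card ≤ R ∧ η.minus.card ≤ R ∧
      ((η.plus : Set (E d)) ⊆ Metric.ball 0 R ∧ (η.minus : Set (E d)) ⊆ Metric.ball 0 R)} :=
    (measurableSet_le measurable_id.plusConf.card_pts measurable_const).inter
      ((measurableSet_le measurable_id.minusConf.card_pts measurable_const).inter
        (measurableSet_subsets measurableSet_ball))
  refine ⟨measurable_const.indicator (hS.inter ht), ⟨1, fun η => ?_⟩, R, R, Metric.ball 0 R,
    Metric.ball 0 R, Metric.isBounded_ball, measurableSet_ball, Metric.isBounded_ball,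
    measurableSet_ball, fun η hη => ?_⟩
  · classical
    rw [Set.indicator_apply]
    split_ifs <;> simp
  · have := (Set.mem_of_indicator_ne_zero hη).1
    exact ⟨this.1, this.2.2.1, this.2.1, this.2.2.2⟩

/-- Testing with indicators of measurable subsets of `S R` identifies the two functions on `S R`,
where both are integrable. The sets `S R` exhaust all configurations. -/
lemma IsHatL0Dual.ae_eq {aP aM : E d → Conf2 d → ℝ} {k h h' : FinConf2 d → ℝ}
    (hh : IsHatL0Dual aP aM k h) (hh' : IsHatL0Dual aP aM k h') : h =ᵐ[lam2 d] h' := by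
  let S : ℕ → Set (FinConf2 d) := fun R => {η : FinConf2 d | η.plus.card ≤ R ∧ η.minus.card ≤ R ∧
      ((η.plus : Set (E d)) ⊆ Metric.ball 0 R ∧ (η.minus : Set (E d)) ⊆ Metric.ball 0 R)}
  have hmul : ∀ (R : ℕ) (t : Set (FinConf2 d)) (g : FinConf2 d → ℝ),
      (fun η => (S R ∩ t).indicator (fun _ => (1 : ℝ)) η * g η) = (S R ∩ t).indicator g := by
    intro R t g
    funext η
    by_cases hη : η ∈ S R ∩ t
    · rw [Set.indicator_of_mem hη, Set.indicator_of_mem hη, one_mul]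
    · rw [Set.indicator_of_notMem hη, Set.indicator_of_notMem hη, zero_mul]
  have key : ∀ R, (S R).indicator h =ᵐ[lam2 d] (S R).indicator h' := by
    intro R
    have h1 := hh _ (isBbs_indicator (R := R) MeasurableSet.univ)
    have h2 := hh' _ (isBbs_indicator (R := R) MeasurableSet.univ)
    have e := hmul R Set.univ
    simp only [Set.inter_univ] at e
    refine Integrable.ae_eq_of_forall_setIntegral_eq _ _ ?_ ?_ fun t ht _ => ?_
    · have := h1.2.1
      simp only [Set.inter_univ] at this
      rwa [← e h]
    · have := h2.2.1
      simp only [Set.inter_univ] at this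
      rwa [← e h']
    · have h3 := (hh _ (isBbs_indicator (R := R) ht)).2.2
      rw [(hh' _ (isBbs_indicator (R := R) ht)).2.2] at h3
      rw [← integral_indicator ht, ← integral_indicator ht, Set.indicator_indicator,
        Set.indicator_indicator, Set.inter_comm, ← hmul R t h, ← hmul R t h']
      exact h3.symm
  filter_upwards [ae_all_iff.2 key] with η hη
  obtain ⟨R₁, hR₁⟩ : ∃ R : ℕ, ∀ x ∈ η.plus ∪ η.minus, ‖x‖ < R := by
    obtain ⟨r, hr⟩ := ((η.plus ∪ η.minus).image fun x => ‖x‖).bddAbove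
    obtain ⟨R, hR⟩ := exists_nat_gt r
    exact ⟨R, fun x hx => (hr (Finset.mem_coe.2 (Finset.mem_image_of_mem _ hx))).trans_lt hR⟩
  -- One index has to dominate the radius and both cardinalities, hence their sum.
  have hmem : η ∈ S (R₁ + η.plus.card + η.minus.card) := by
    have hR : (R₁ : ℝ) ≤ (R₁ + η.plus.card + η.minus.card : ℕ) := by
      exact_mod_cast (by omega : R₁ ≤ R₁ + η.plus.card + η.minus.card)
    refine ⟨by omega, by omega, fun x hx => ?_, fun x hx => ?_⟩
    · rw [mem_ball_zero_iff]
      exact (hR₁ x (Finset.mem_union_left _ hx)).trans_le hR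
    · rw [mem_ball_zero_iff]
      exact (hR₁ x (Finset.mem_union_right _ hx)).trans_le hR
  have := hη (R₁ + η.plus.card + η.minus.card)
  rwa [Set.indicator_of_mem hmem, Set.indicator_of_mem hmem] at this

lemma exists_pow_mul_pow_le (M : ℕ) {q : ℝ} (hq : 0 < q) (hq1 : q < 1) :
    ∃ K : ℝ, ∀ n : ℕ, (1 + (n : ℝ)) ^ M * q ^ n ≤ K := by
  have h := tendsto_pow_const_mul_const_pow_of_abs_lt_one M (r := q) (by rwa [abs_of_pos hq])
  obtain ⟨K, hK⟩ := h.bddAbove_range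
  -- The factor `q⁻¹` pays for the shift `n ↦ n + 1`, since `(1 + n)^M q^n = q⁻¹ (n + 1)^M q^(n +
  -- 1)`.
  refine ⟨K * q⁻¹, fun n => ?_⟩
  rw [le_mul_inv_iff₀ hq]
  have := hK ⟨n + 1, rfl⟩
  push_cast at this
  rw [add_comm 1, mul_assoc, ← pow_succ]
  exact this

section DualOperator

variable [Nonempty (Fin d)] {aP aM : E d → Conf2 d → ℝ}

lemma ae_union_eq {k k' : FinConf2 d → ℝ} (h : k' =ᵐ[lam2 d] k) :
    ∀ᵐ η ∂(lam2 d), (∀ᵐ ζ ∂(lam2 d), k' (ζ.union η) = k (ζ.union η)) ∧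
      (∀ x ∈ η.plus, ∀ᵐ ζ ∂(lam2 d), k' (ζ.union (η.flipToMinus x)) =
        k (ζ.union (η.flipToMinus x))) ∧
      ∀ y ∈ η.minus, ∀ᵐ ζ ∂(lam2 d), k' (ζ.union (η.flipToPlus y)) =
        k (ζ.union (η.flipToPlus y)) := by
  have h1 := ae_ae_union h
  filter_upwards [h1, ae_forall_flipToMinus h1, ae_forall_flipToPlus h1] with η h2 h3 h4
  exact ⟨h2, h3, h4⟩

lemma hatL0DualFormula_congr_ae (aP aM : E d → Conf2 d → ℝ) {k k' : FinConf2 d → ℝ}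
    (h : k' =ᵐ[lam2 d] k) : hatL0DualFormula aP aM k' =ᵐ[lam2 d] hatL0DualFormula aP aM k := by
  filter_upwards [ae_union_eq h] with η ⟨h1, h2, h3⟩
  rw [hatL0DualFormula, hatL0DualFormula]
  congr 1
  · congr 1
    · congr 1
      · refine Finset.sum_congr rfl fun y hy => integral_congr_ae ?_
        filter_upwards [h3 y hy] with ζ hζ using by rw [hζ]
      · refine Finset.sum_congr rfl fun y hy => integral_congr_ae ?_
        filter_upwards [h1] with ζ hζ using by rw [hζ]
    · refine Finset.sum_congr rfl fun y hy => integral_congr_ae ?_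
      filter_upwards [h2 y hy] with ζ hζ using by rw [hζ]
  · refine Finset.sum_congr rfl fun y hy => integral_congr_ae ?_
    filter_upwards [h1] with ζ hζ using by rw [hζ]

lemma hatL0DualConverges_congr_ae {k k' : FinConf2 d → ℝ} (h : k' =ᵐ[lam2 d] k)
    (hk' : ∀ᵐ η ∂(lam2 d), HatL0DualConverges aP aM k' η) :
    ∀ᵐ η ∂(lam2 d), HatL0DualConverges aP aM k η := by
  filter_upwards [ae_union_eq h, hk'] with η ⟨h1, h2, h3⟩ ⟨h4, h5⟩
  refine ⟨fun y hy => ⟨(h4 y hy).1.congr ?_, (h4 y hy).2.congr ?_⟩,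
    fun x hx => ⟨(h5 x hx).1.congr ?_, (h5 x hx).2.congr ?_⟩⟩
  · filter_upwards [h3 y hy] with ζ hζ using by rw [hζ]
  · filter_upwards [h1] with ζ hζ using by rw [hζ]
  · filter_upwards [h1] with ζ hζ using by rw [hζ]
  · filter_upwards [h2 x hx] with ζ hζ using by rw [hζ]

variable {k : FinConf2 d → ℝ} {b : ℝ≥0∞} {c : ℝ}

lemma ae_hatL0DualConverges (haP : IsRate aP) (haM : IsRate aM) (hkm : Measurable k) (hc : 0 ≤ c)
    (hb : b ≠ ∞) (hk : ∀ η, ‖k η‖ₑ ≤ b * ENNReal.ofReal c ^ η.size)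
    (hP : ∀ᵐ η ∂(lam2 d), kernelNorm (transformedRate aP) c η < ∞)
    (hM : ∀ᵐ η ∂(lam2 d), kernelNorm (transformedRate aM) c η < ∞) :
    ∀ᵐ η ∂(lam2 d), HatL0DualConverges aP aM k η := by
  have h1 := ae_sizeUnion (d := d)
  filter_upwards [h1, ae_forall_flipToMinus h1, ae_forall_flipToPlus h1, hP, hM]
    with η h2 h3 h4 h5 h6
  exact ⟨fun y hy =>
    ⟨haP.measurableKernel.integrable_union hkm hc hb hk (h4 y hy) (normL_lt_top_of_mem_minus h5 hy),
      haM.measurableKernel.integrable_union hkm hc hb hk h2 (normL_lt_top_of_mem_minus h6 hy)⟩,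
    fun x hx =>
    ⟨haP.measurableKernel.integrable_union hkm hc hb hk h2 (normL_lt_top_of_mem_plus h5 hx),
      haM.measurableKernel.integrable_union hkm hc hb hk (h3 x hx)
        (normL_lt_top_of_mem_plus h6 hx)⟩⟩

lemma integral_hatL0_mul (haP : IsRate aP) (haM : IsRate aM) {G : FinConf2 d → ℝ}
    (hG : Measurable G) (hkm : Measurable k) (hc : 0 ≤ c) (hb : b ≠ ∞)
    (hk : ∀ η, ‖k η‖ₑ ≤ b * ENNReal.ofReal c ^ η.size)
    (hP : ∀ᵐ η ∂(lam2 d), kernelNorm (transformedRate aP) c η < ∞)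
    (hM : ∀ᵐ η ∂(lam2 d), kernelNorm (transformedRate aM) c η < ∞)
    (hGP : ∫⁻ η, ENNReal.ofReal c ^ η.size * (‖G η‖ₑ * kernelNorm (transformedRate aP) c η)
      ∂(lam2 d) < ∞)
    (hGM : ∫⁻ η, ENNReal.ofReal c ^ η.size * (‖G η‖ₑ * kernelNorm (transformedRate aM) c η)
      ∂(lam2 d) < ∞) :
    Integrable (fun η => hatL0 aP aM G η * k η) (lam2 d) ∧
    Integrable (fun η => G η * hatL0DualFormula aP aM k η) (lam2 d) ∧
    ∫ η, hatL0 aP aM G η * k η ∂(lam2 d) = ∫ η, G η * hatL0DualFormula aP aM k η ∂(lam2 d) := by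
  have hM' : ∀ᵐ η ∂(lam2 d), kernelNorm (swapRate (transformedRate aM)) c η < ∞ := by
    filter_upwards [ae_swap hM] with η hη
    rwa [← kernelNorm_swapRate haM.measurableKernel, swap_swap] at hη
  rw [← lintegral_kernelNorm_swap haM.measurableKernel hG] at hGM
  obtain ⟨h1, h2, h3⟩ := integral_flipPart_mul haP.measurableKernel hG hkm hc hb hk hP hGP
  -- The minus-to-plus part is the same duality with `G`, `k` and the kernel exchanged; the
  -- invariance of `lam2` under the exchange carries the result back.
  obtain ⟨h4, h5, h6⟩ := integral_flipPart_mul (G := fun η => G η.swap) (k := fun η => k η.swap)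
    haM.measurableKernel.swapRate (by fun_prop) (by fun_prop) hc hb
    (fun η => by simpa using hk η.swap) hM' hGM
  rw [← integrable_swap_iff] at h4 h5
  rw [← integral_swap, ← integral_swap (fun η => G η.swap * _)] at h6
  simp only [swap_swap] at h4 h5 h6
  have e1 : (fun η => hatL0 aP aM G η * k η) = fun η =>
      flipPart (transformedRate aP) G η * k η +
        flipPart (swapRate (transformedRate aM)) (fun ξ => G ξ.swap) η.swap * k η := by
    funext η
    rw [hatL0_eq_hatL0Formula, hatL0Formula_eq, add_mul]
  have e2 : (fun η => G η * hatL0DualFormula aP aM k η) = fun η =>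
      G η * dualPart (transformedRate aP) k η +
        G η * dualPart (swapRate (transformedRate aM)) (fun ξ => k ξ.swap) η.swap := by
    funext η
    rw [hatL0DualFormula_eq, mul_add]
  rw [e1, e2]
  refine ⟨h1.add h4, h2.add h5, ?_⟩
  rw [integral_add h1 h4, integral_add h2 h5, h3, h6]

lemma enorm_hatL0DualFormula_le (haM : IsRate aM) (hc : 0 ≤ c) (hb : b ≠ ∞)
    (hk : ∀ η, ‖k η‖ₑ ≤ b * ENNReal.ofReal c ^ η.size) :
    ∀ᵐ η ∂(lam2 d), ‖hatL0DualFormula aP aM k η‖ₑ ≤ b * ENNReal.ofReal c ^ η.size *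
      (kernelNorm (transformedRate aP) c η + kernelNorm (transformedRate aM) c η) := by
  have h1 := enorm_dualPart_le (B := transformedRate aP) hc hb hk
  have h2 := enorm_dualPart_le (B := swapRate (transformedRate aM)) (k := fun η => k η.swap) hc hb
    fun η => by simpa using hk η.swap
  filter_upwards [h1, ae_swap h2] with η h3 h4
  rw [kernelNorm_swapRate haM.measurableKernel, size_swap] at h4
  rw [hatL0DualFormula_eq, mul_add]
  exact (enorm_add_le _ _).trans (add_le_add h3 h4)

lemma kernelNorm_mono {B : E d → FinConf2 d → FinConf2 d → ℝ} {c C : ℝ} (hc : 0 ≤ c)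
    (hcC : c ≤ C) (η : FinConf2 d) : kernelNorm B c η ≤ kernelNorm B C η := by
  have h : ∀ G : FinConf2 d → ℝ, normL c G ≤ normL C G := fun G => by
    rw [normL_eq hc, normL_eq (hc.trans hcC)]
    gcongr
  exact add_le_add (Finset.sum_le_sum fun _ _ => h _) (Finset.sum_le_sum fun _ _ => h _)

end DualOperator

/-- The norms of the rates at `αC` are at most those at `C`, hence controlled by `N₀`. The dual
function is then of order `(αC)^n (1 + n)^M ν^n`, which is a bounded multiple of `C^n`. -/
theorem dual_memK [Nonempty (Fin d)] {aP aM : E d → Conf2 d → ℝ} (haP : IsRate aP)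
    (haM : IsRate aM) {C : ℝ} (hC : 0 < C) {N₀ : FinConf2 d → ℝ} (hN : RateBound aP aM C N₀)
    {A : ℝ} {M : ℕ} {ν : ℝ} (hA : 0 < A) (hν : 1 ≤ ν)
    (hN₀ : ∀ η : FinConf2 d, N₀ η ≤ A * (1 + (η.plus.card : ℝ) + (η.minus.card : ℝ)) ^ M *
      ν ^ (η.plus.card + η.minus.card))
    {α : ℝ} (hα : 0 < α) (hαν : α < 1 / ν) {k : FinConf2 d → ℝ} (hk : MemK (α * C) k) :
    (∀ᵐ η ∂(lam2 d), HatL0DualConverges aP aM k η) ∧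
      IsHatL0Dual aP aM k (hatL0DualFormula aP aM k) ∧ MemK C (hatL0DualFormula aP aM k) := by
  have hν0 : 0 < ν := by linarith
  -- `ν ≥ 1` enters here: it forces `α ≤ 1`, so that `αC ≤ C`.
  have hα1 : α ≤ 1 := hαν.le.trans (by rw [div_le_one hν0]; exact hν)
  have hc : 0 < α * C := by positivity
  have hcC : α * C ≤ C := mul_le_of_le_one_left hC.le hα1
  obtain ⟨k', b, hkm, hb, hkb, hkk'⟩ := MemK.exists_measurable hc hk
  let g : ℕ → ℝ := fun n => A * (1 + (n : ℝ)) ^ M * ν ^ n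
  have hg : Monotone g := by
    intro m n hmn
    have : (m : ℝ) ≤ n := by exact_mod_cast hmn
    simp only [g]
    gcongr
  have hsum : ∀ᵐ η ∂(lam2 d), kernelNorm (transformedRate aP) (α * C) η +
      kernelNorm (transformedRate aM) (α * C) η ≤ ENNReal.ofReal (g η.size) := by
    filter_upwards [hN.kernelNorm_le] with η hη
    refine (add_le_add (kernelNorm_mono hc.le hcC η) (kernelNorm_mono hc.le hcC η)).trans
      (hη.trans (ENNReal.ofReal_le_ofReal ((hN₀ η).trans (le_of_eq ?_))))
    simp only [g, size]
    push_cast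
    rw [add_assoc]
  have hP : ∀ᵐ η ∂(lam2 d), kernelNorm (transformedRate aP) (α * C) η ≤
      ENNReal.ofReal (g η.size) := hsum.mono fun η hη => le_self_add.trans hη
  have hM : ∀ᵐ η ∂(lam2 d), kernelNorm (transformedRate aM) (α * C) η ≤
      ENNReal.ofReal (g η.size) := hsum.mono fun η hη => le_add_self.trans hη
  have hP' := hP.mono fun η hη => hη.trans_lt ENNReal.ofReal_lt_top
  have hM' := hM.mono fun η hη => hη.trans_lt ENNReal.ofReal_lt_top
  have hcongr := hatL0DualFormula_congr_ae aP aM hkk'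
  refine ⟨hatL0DualConverges_congr_ae hkk'
    (ae_hatL0DualConverges haP haM hkm hc.le ENNReal.ofReal_ne_top hkb hP' hM'), ?_, ?_⟩
  · intro G hG
    obtain ⟨h1, h2, h3⟩ := integral_hatL0_mul haP haM hG.1 hkm hc.le ENNReal.ofReal_ne_top hkb
      hP' hM' (hG.lintegral_lt_top hc.le hg hP) (hG.lintegral_lt_top hc.le hg hM)
    have e1 : (fun η => hatL0 aP aM G η * k' η) =ᵐ[lam2 d] fun η => hatL0 aP aM G η * k η := by
      filter_upwards [hkk'] with η hη using by rw [hη]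
    have e2 : (fun η => G η * hatL0DualFormula aP aM k' η) =ᵐ[lam2 d]
        fun η => G η * hatL0DualFormula aP aM k η := by
      filter_upwards [hcongr] with η hη using by rw [hη]
    exact ⟨h1.congr e1, h2.congr e2, by rw [← integral_congr_ae e1, ← integral_congr_ae e2, h3]⟩
  · obtain ⟨K, hK⟩ := exists_pow_mul_pow_le M (q := α * ν) (by positivity)
      (by rwa [lt_div_iff₀ hν0] at hαν)
    -- `b` bounds `k` relative to `(αC)^n`, `A` is the constant of the growth condition, and `K`
    -- bounds `(1 + n)^M (αν)^n`.
    refine memLp_top_of_bound (C := b * A * K) ?_ ?_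
    · refine AEStronglyMeasurable.mul ?_ (Measurable.aestronglyMeasurable (by fun_prop))
      exact (measurable_hatL0DualFormula haP haM hkm).aestronglyMeasurable.congr hcongr
    · filter_upwards [hcongr, hsum,
        enorm_hatL0DualFormula_le (aP := aP) haM hc.le ENNReal.ofReal_ne_top hkb] with η h1 h2 h3
      have hgn : 0 ≤ g η.size := by positivity
      have h4 : |hatL0DualFormula aP aM k η| ≤ b * (α * C) ^ η.size * g η.size := by
        have := h3.trans (mul_le_mul_right h2 _)
        rw [h1, ← ofReal_norm, ← ENNReal.ofReal_pow hc.le, ← ENNReal.ofReal_mul hb,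
          ← ENNReal.ofReal_mul (by positivity), ENNReal.ofReal_le_ofReal_iff (by positivity)] at this
        exact this
      rw [Real.norm_eq_abs, abs_mul, abs_of_pos (inv_pos.2 (pow_pos hC _)),
        mul_inv_le_iff₀ (pow_pos hC _)]
      refine h4.trans ?_
      have h5 := mul_le_mul_of_nonneg_left (hK η.size)
        (by positivity : 0 ≤ b * A * C ^ η.size)
      refine le_trans (le_of_eq ?_) (h5.trans (le_of_eq ?_))
      · simp only [g, mul_pow]
        ring
      · ring

end Flip

end

/-! ### Assembly of the three statements. -/

theorem mainTheorem9 (d : ℕ) (hd : 1 ≤ d) (aP aM : Flip.E d → Flip.Conf2 d → ℝ)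
    (haP : Flip.IsRate aP) (haM : Flip.IsRate aM) :
    -- the explicit form of `L̂₀ G` for `G ∈ B_bs(Γ₀²)`
    (∀ G : Flip.FinConf2 d → ℝ, Flip.IsBbs G →
      ∀ η : Flip.FinConf2 d, Flip.hatL0 aP aM G η = Flip.hatL0Formula aP aM G η) ∧
    ∀ (C : ℝ), 0 < C → ∀ N₀ : Flip.FinConf2 d → ℝ,
      Flip.IsLocallyIntegrableBound N₀ → Flip.RateBound aP aM C N₀ →
      -- `L̂₀` maps `{G ∈ 𝓛_C : N₀ G ∈ 𝓛_C}` to `𝓛_C`, is given by the same expression there,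
      -- and respects equality almost everywhere
      (∀ G : Flip.FinConf2 d → ℝ, Flip.MemL C G → Flip.MemL C (fun η => N₀ η * G η) →
        Flip.MemL C (Flip.hatL0 aP aM G) ∧
        (∀ η : Flip.FinConf2 d, Flip.hatL0 aP aM G η = Flip.hatL0Formula aP aM G η) ∧
        ∀ G' : Flip.FinConf2 d → ℝ, G' =ᵐ[Flip.lam2 d] G →
          Flip.hatL0 aP aM G' =ᵐ[Flip.lam2 d] Flip.hatL0 aP aM G) ∧
      -- `L̂₀*` maps `𝓚_{αC}` to `𝓚_C` and has the explicit form
      (∀ (A : ℝ) (M : ℕ) (ν : ℝ), 0 < A → 1 ≤ ν →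
        (∀ η : Flip.FinConf2 d,
          N₀ η ≤ A * (1 + (η.plus.card : ℝ) + (η.minus.card : ℝ)) ^ M *
            ν ^ (η.plus.card + η.minus.card)) →
        ∀ α : ℝ, 0 < α → α < 1 / ν →
        ∀ k : Flip.FinConf2 d → ℝ, Flip.MemK (α * C) k →
          (∀ᵐ η ∂(Flip.lam2 d), Flip.HatL0DualConverges aP aM k η) ∧
          Flip.IsHatL0Dual aP aM k (Flip.hatL0DualFormula aP aM k) ∧
          ∀ h : Flip.FinConf2 d → ℝ, Flip.IsHatL0Dual aP aM k h →
            Flip.MemK C h ∧ h =ᵐ[Flip.lam2 d] Flip.hatL0DualFormula aP aM k) := by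
  -- Positive dimension makes coinciding points negligible, on which all the measure theory above
  -- relies.
  have hne : Nonempty (Fin d) := Fin.pos_iff_nonempty.1 hd
  refine ⟨fun G _ η => Flip.hatL0_eq_hatL0Formula aP aM G η, fun C hC N₀ _ hN =>
    ⟨fun G hG hNG => ⟨Flip.memL_hatL0 haP haM hC hN hG hNG,
      Flip.hatL0_eq_hatL0Formula aP aM G, fun G' hG' => Flip.hatL0_congr_ae aP aM hG'⟩,
    fun A M ν hA hν hN₀ α hα hαν k hk => ?_⟩⟩
  obtain ⟨h1, h2, h3⟩ := Flip.dual_memK haP haM hC hN hA hν hN₀ hα hαν hk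
  refine ⟨h1, h2, fun h hh => ?_⟩
  have hae := Flip.IsHatL0Dual.ae_eq hh h2
  refine ⟨?_, hae⟩
  refine (memLp_congr_ae ?_).2 h3
  filter_upwards [hae] with η hη using by rw [hη]
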